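/- Let $G=(\mathbb{Z}/2)^3$ and let $C_1,C_2$ be smooth projective connected complex curves, each with a faithful action of $G$ such that $C_i/G\cong\mathbb{P}^1$, and such that the diagonal action of $G$ on $C_1\times C_2$ is free. Let $S=(C_1\times C_2)/G$, and let $p_g(S)=\dim H^0(S,\mathcal{O}_S(K_S))$. "The canonical map of $S$ is birational" means that the rational map $S\dashrightarrow\mathbb{P}(H^0(S,\mathcal{O}_S(K_S))^\vee)$ is birational onto its image. Let $r_i$ be the number of branch points of $C_i\to C_i/G$; the local monodromy at a branch point is the nontrivial element of $G$ that generates the stabilizer of the points above it. Let $\Sigma_i\subset G\setminus\{0\}$ be the set of nontrivial elements of $G$ having a fixed point on $C_i$. For a character $\chi\in G^\vee=\mathrm{Hom}(G,\mathbb{Z}/2)$ let $V_{i,\chi}$ be the subspace of $H^0(C_i,\mathcal{O}_{C_i}(K_{C_i}))$ on which $g\in G$ acts as $(-1)^{\chi(g)}$, and let $N(\chi)=\dim(V_{1,\chi}\otimes V_{2,\chi})$. 1. If $p_g(S)=6$, $r_1=6$, $r_2=11$ and the canonical map of $S$ is birational, then $|\Sigma_1|=3$, $|\Sigma_2|=4$,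 and there is a basis $e_1,e_2,e_3$ of $G$ over $\mathbb{Z}/2$, with dual basis $e_1^\vee,e_2^\vee,e_3^\vee$, such that: each $e_i$ is the local monodromy at exactly $2$ branch points of $C_1\to C_1/G$; the elements $e_1+e_2+e_3$, $e_2+e_3$, $e_1+e_3$, $e_1+e_2$ are the local monodromy at exactly $b=4$, $b_1=3$, $b_2=3$, $b_3=1$ branch points of $C_2\to C_2/G$, respectively; and $$N(e_1^\vee+e_2^\vee+e_3^\vee)=2,\quad N(e_1^\vee+e_2^\vee)=2,\quad N(e_1^\vee+e_3^\vee)=1,\quad N(e_2^\vee+e_3^\vee)=1.$$ 2. If $p_g(S)=4$, $r_1=6$, $r_2=9$, then the canonical map of $S$ is not birational. 3. If $p_g(S)=5$, $r_1=6$, $r_2=10$ and the canonical map of $S$ is birational, then $|\Sigma_1|=3$, $|\Sigma_2|=4$, and there is a basis $e_1,e_2,e_3$ of $G$, with dual basis $e_i^\vee$, such that: each $e_i$ is the local monodromy at exactly $2$ branch points of $C_1\to C_1/G$; $e_1+e_2+e_3$ is the local monodromy at exactly $b=4$ branch points of $C_2\to C_2/G$, and $e_i+e_j$ at exactly $2$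 for all $i\ne j$ (so $b_1=b_2=b_3=2$); and $$N(e_1^\vee+e_2^\vee+e_3^\vee)=2,\qquad N(e_i^\vee+e_j^\vee)=1\quad\text{for all } i\neq j.$$ 4. If $p_g(S)=5$, $r_1=7$, $r_2=8$, then the canonical map of $S$ is not birational. -/

import Mathlib

open scoped TensorProduct Pointwise KaehlerDifferential

noncomputable section

namespace SIP

/-! ### Curves

A smooth projective connected complex curve `C` is given by its function field `F = ℂ(C)`: its
points are the places of `F`, and the local ring at a point is the corresponding valuation ring. -/

section Curve

variable (F : Type*) [Field F] [Algebra ℂ F]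

/-- `F` is the function field of a complex curve: finitely generated over `ℂ`, of transcendence
degree one. -/
structure IsCurveField : Prop where
  essFiniteType : Algebra.EssFiniteType ℂ F
  trdeg_eq_one : Algebra.trdeg ℂ F = 1

/-- The (closed) points of the smooth projective curve with function field `F`: the valuation rings
`ℂ ⊆ 𝒪 ⊊ F` with fraction field `F`; the ring `𝒪` is the local ring at the point. -/
@[ext]
structure Point where
  ring : ValuationSubring F
  algebraMap_mem : ∀ c : ℂ, algebraMap ℂ F c ∈ ring
  ne_top : ring ≠ ⊤

variable {F}

/-- Automorphisms of the curve act on its points. -/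
instance : MulAction (F ≃ₐ[ℂ] F) (Point F) where
  smul σ P :=
    { ring := σ • P.ring
      algebraMap_mem := fun c =>
        ValuationSubring.mem_smul_pointwise_iff_exists _ _ _ |>.2
          ⟨algebraMap ℂ F c, P.algebraMap_mem c, σ.commutes c⟩
      ne_top := fun h => P.ne_top <| by
        rw [eq_top_iff]
        intro x _
        have hx : σ • x ∈ σ • P.ring := by rw [h]; exact ValuationSubring.mem_top _
        exact ValuationSubring.smul_mem_pointwise_smul_iff.1 hx }
  one_smul P := Point.ext (one_smul _ P.ring)
  mul_smul σ τ P := Point.ext (mul_smul σ τ P.ring)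

/-- The action of an automorphism on rational differentials, `a • db ↦ σ a • d (σ b)`. -/
def diffMap (σ : F ≃ₐ[ℂ] F) : Ω[F⁄ℂ] →ₗ[ℂ] Ω[F⁄ℂ] :=
  Ideal.mapCotangent (KaehlerDifferential.ideal ℂ F) (KaehlerDifferential.ideal ℂ F)
    (Algebra.TensorProduct.map (σ : F →ₐ[ℂ] F) (σ : F →ₐ[ℂ] F)) (by
      rw [← KaehlerDifferential.span_range_eq_ideal, Ideal.span_le]
      rintro _ ⟨s, rfl⟩
      have h := KaehlerDifferential.one_smul_sub_smul_one_mem_ideal ℂ (σ s)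
      rw [← KaehlerDifferential.span_range_eq_ideal] at h
      simpa using h)

theorem diffMap_smul_D (σ : F ≃ₐ[ℂ] F) (a b : F) :
    diffMap σ (a • KaehlerDifferential.D ℂ F b) =
      σ a • KaehlerDifferential.D ℂ F (σ b) := by
  have key : ∀ x y : F, ∃ z : KaehlerDifferential.ideal ℂ F,
      (z : F ⊗[ℂ] F) = x ⊗ₜ y - (x * y) ⊗ₜ 1 := fun x y =>
    ⟨⟨_, by
      have h := Ideal.mul_mem_left _ (x ⊗ₜ[ℂ] (1 : F))
        (KaehlerDifferential.one_smul_sub_smul_one_mem_ideal ℂ y)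
      simpa only [mul_sub, Algebra.TensorProduct.tmul_mul_tmul, mul_one, one_mul] using h⟩, rfl⟩
  have key2 : ∀ (x y : F) (z : KaehlerDifferential.ideal ℂ F),
      (z : F ⊗[ℂ] F) = x ⊗ₜ y - (x * y) ⊗ₜ 1 →
      x • KaehlerDifferential.D ℂ F y = (KaehlerDifferential.ideal ℂ F).toCotangent z := by
    intro x y z hz
    rw [KaehlerDifferential.D_apply]
    change x • (KaehlerDifferential.ideal ℂ F).toCotangent _ = _
    rw [← algebraMap_smul (F ⊗[ℂ] F) x, ← map_smul]
    congr 1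
    ext
    simp [hz, mul_sub, Algebra.TensorProduct.algebraMap_apply]
  obtain ⟨z, hz⟩ := key a b
  obtain ⟨w, hw⟩ := key (σ a) (σ b)
  rw [key2 a b z hz, key2 _ _ w hw]
  refine (Ideal.mapCotangent_toCotangent _ _ _ _ z).trans
    (congrArg (KaehlerDifferential.ideal ℂ F).toCotangent (Subtype.ext ?_))
  simp [hz, hw]

variable (F) in
/-- `H⁰(C, K_C)`: the rational differentials which are regular at every point `P` of the curve, that
is, lie in the image of `Ω[𝒪_P⁄ℂ]`. -/
def regularDiff : Submodule ℂ Ω[F⁄ℂ] where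
  carrier := {ω | ∀ P : Point F, ω ∈ Submodule.span P.ring
    {η | ∃ a ∈ P.ring, η = KaehlerDifferential.D ℂ F a}}
  zero_mem' := fun _ => Submodule.zero_mem _
  add_mem' := fun h₁ h₂ P => Submodule.add_mem _ (h₁ P) (h₂ P)
  smul_mem' := fun c ω h P => by
    have := Submodule.smul_mem _ (⟨algebraMap ℂ F c, P.algebraMap_mem c⟩ : P.ring) (h P)
    rwa [show (⟨algebraMap ℂ F c, P.algebraMap_mem c⟩ : P.ring) • ω = c • ω from
      algebraMap_smul F c ω] at this

end Curve

/-! ### Actions of `(ℤ/2)³` -/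

/-- The vector space `(ℤ/2)³`. -/
abbrev E : Type := Fin 3 → ZMod 2

/-- The group `(ℤ/2)³`, written multiplicatively. -/
abbrev G : Type := Multiplicative E

section Action

variable {F : Type*} [Field F] [Algebra ℂ F] (ρ : G →* (F ≃ₐ[ℂ] F))

/-- `C` is a curve with a faithful action of `G` such that `C / G ≅ ℙ¹`. -/
structure IsGaloisCoverOfLine : Prop where
  isCurveField : IsCurveField F
  faithful : Function.Injective ρ
  quotient_eq_line : Nonempty (IntermediateField.fixedField ρ.range ≃ₐ[ℂ] RatFunc ℂ)

/-- The stabilizer in `G` of a point of the curve. -/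
def stab (P : Point F) : Subgroup G := (MulAction.stabilizer (F ≃ₐ[ℂ] F) P).comap ρ

/-- The points of `C / G`, as `G`-orbits of points of `C`. -/
abbrev QuotientPoint : Type _ := MulAction.orbitRel.Quotient ρ.range (Point F)

/-- The number `r` of branch points of `C → C / G`. -/
def numBranch : ℕ :=
  Nat.card {Q : QuotientPoint ρ // ∃ P : Point F, Quotient.mk _ P = Q ∧ stab ρ P ≠ ⊥}

/-- The multiplicity of `v ≠ 0` in the spherical system of generators of `C → C / G`: the number of
branch points with local monodromy `v`. As every nontrivial element has order two, `v` is the local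
monodromy at a point exactly if the stabilizer of a point above it is generated by `v`. -/
def mult (v : E) : ℕ :=
  Nat.card {Q : QuotientPoint ρ // ∃ P : Point F, Quotient.mk _ P = Q ∧
    stab ρ P = Subgroup.zpowers (Multiplicative.ofAdd v)}

/-- The set `Σ` of nontrivial elements of `G` lying in the stabilizer of some point of the curve. -/
def stabSet : Set E := {v | v ≠ 0 ∧ ∃ P : Point F, Multiplicative.ofAdd v ∈ stab ρ P}

/-- The isotypic component `V_χ` of `V = H⁰(C, K_C)`; here `χ` is a linear form on `(ℤ/2)³`,
standing for the character `g ↦ (-1) ^ χ g`. -/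
def eigenDiff (χ : Module.Dual (ZMod 2) E) : Submodule ℂ Ω[F⁄ℂ] :=
  regularDiff F ⊓ ⨅ v : E, LinearMap.ker
    (diffMap (ρ (Multiplicative.ofAdd v)) - ((-1 : ℂ) ^ (χ v).val) • LinearMap.id)

end Action

/-! ### Surfaces isogenous to a product -/

section Surface

variable {F₁ F₂ : Type*} [Field F₁] [Field F₂] [Algebra ℂ F₁] [Algebra ℂ F₂]
  (ρ₁ : G →* (F₁ ≃ₐ[ℂ] F₁)) (ρ₂ : G →* (F₂ ≃ₐ[ℂ] F₂))

/-- The diagonal action of `G` on `C₁ × C₂` is free. -/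
def IsFreeOnProduct : Prop :=
  ∀ (P₁ : Point F₁) (P₂ : Point F₂), stab ρ₁ P₁ ⊓ stab ρ₂ P₂ = ⊥

/-- `N(χ) = dim (V_{1,χ} ⊗ V_{2,χ})`. -/
def N (χ : Module.Dual (ZMod 2) E) : ℕ :=
  Module.finrank ℂ (eigenDiff ρ₁ χ ⊗[ℂ] eigenDiff ρ₂ χ)

/-- The diagonal action of `G` on `F₁ ⊗ F₂`. -/
def tensorAction : G →* (F₁ ⊗[ℂ] F₂ ≃ₐ[ℂ] F₁ ⊗[ℂ] F₂) where
  toFun g := Algebra.TensorProduct.congr (ρ₁ g) (ρ₂ g)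
  map_one' := by
    ext x
    induction x with
    | zero => simp
    | add x y hx hy => simp only [map_add, hx, hy]
    | tmul a b => simp
  map_mul' g h := by
    ext x
    induction x with
    | zero => simp
    | add x y hx hy => simp only [map_add, hx, hy]
    | tmul a b => simp

variable (L : Type*) [Field L] [Algebra ℂ L] [Algebra (F₁ ⊗[ℂ] F₂) L]
  [IsScalarTower ℂ (F₁ ⊗[ℂ] F₂) L] [IsFractionRing (F₁ ⊗[ℂ] F₂) L]

/-- The diagonal action of `G` on the function field `L = Frac (F₁ ⊗ F₂)` of `C₁ × C₂`. -/
def prodAction : G →* (L ≃ₐ[ℂ] L) :=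
  (IsFractionRing.fieldEquivOfAlgEquivHom ℂ L).comp (tensorAction ρ₁ ρ₂)

/-- The function field of `S = (C₁ × C₂) / G`: the `G`-invariant rational functions. -/
abbrev SurfaceField : IntermediateField ℂ L :=
  IntermediateField.fixedField (prodAction ρ₁ ρ₂ L).range

variable (F₁ F₂) in
/-- The pull-back to `C₁ × C₂` of rational functions on `C₁`. -/
def pull₁ : F₁ →ₐ[ℂ] L :=
  (IsScalarTower.toAlgHom ℂ (F₁ ⊗[ℂ] F₂) L).comp Algebra.TensorProduct.includeLeft

variable (F₁ F₂) in
/-- The pull-back to `C₁ × C₂` of rational functions on `C₂`. -/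
def pull₂ : F₂ →ₐ[ℂ] L :=
  (IsScalarTower.toAlgHom ℂ (F₁ ⊗[ℂ] F₂) L).comp Algebra.TensorProduct.includeRight

/-- The subalgebra `𝒪_{P₁} ⊗ 𝒪_{P₂}` of the function field of `C₁ × C₂`. -/
def tensorRing (P₁ : Point F₁) (P₂ : Point F₂) : Subalgebra ℂ L :=
  Algebra.adjoin ℂ (pull₁ F₁ F₂ L '' P₁.ring ∪ pull₂ F₁ F₂ L '' P₂.ring)

/-- The ideal of `𝒪_{P₁} ⊗ 𝒪_{P₂}` of functions vanishing at `(P₁, P₂)`, generated by the maximal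
ideals of `𝒪_{P₁}` and `𝒪_{P₂}`. -/
def vanishingIdeal (P₁ : Point F₁) (P₂ : Point F₂) : Ideal (tensorRing L P₁ P₂) :=
  Ideal.span {f | (∃ a ∈ P₁.ring.nonunits, (f : L) = pull₁ F₁ F₂ L a) ∨
    ∃ a ∈ P₂.ring.nonunits, (f : L) = pull₂ F₁ F₂ L a}

/-- The local ring of `C₁ × C₂` at `(P₁, P₂)`: the localization of `𝒪_{P₁} ⊗ 𝒪_{P₂}` at the
(maximal) ideal of functions vanishing at `(P₁, P₂)`. -/
def prodLocalRing (P₁ : Point F₁) (P₂ : Point F₂) : Subalgebra ℂ L :=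
  Algebra.adjoin ℂ (tensorRing L P₁ P₂ ∪
    {f | ∃ b : tensorRing L P₁ P₂, b ∉ vanishingIdeal L P₁ P₂ ∧ f = (b : L)⁻¹})

/-- The local ring of `S` at the image of `(P₁, P₂)`: the invariant rational functions which are
regular at `(P₁, P₂)`. -/
def surfaceLocalRing (P₁ : Point F₁) (P₂ : Point F₂) : Subalgebra ℂ (SurfaceField ρ₁ ρ₂ L) :=
  (prodLocalRing L P₁ P₂).comap (SurfaceField ρ₁ ρ₂ L).val

/-- `H⁰(S, K_S)`: the rational 2-forms on `S` which are regular at every point `s` of `S`, that is,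
lie in the image of `⋀² Ω[𝒪_{S,s}⁄ℂ]`. -/
def canonicalForms : Submodule ℂ (⋀[SurfaceField ρ₁ ρ₂ L]^2 Ω[SurfaceField ρ₁ ρ₂ L⁄ℂ]) :=
  ⨅ (P₁ : Point F₁) (P₂ : Point F₂),
    (Submodule.span (surfaceLocalRing ρ₁ ρ₂ L P₁ P₂)
      {η | ∃ a ∈ surfaceLocalRing ρ₁ ρ₂ L P₁ P₂, ∃ b ∈ surfaceLocalRing ρ₁ ρ₂ L P₁ P₂,
        η = exteriorPower.ιMulti (SurfaceField ρ₁ ρ₂ L) 2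
          ![KaehlerDifferential.D ℂ _ a, KaehlerDifferential.D ℂ _ b]}).restrictScalars ℂ

/-- The geometric genus `p_g(S) = dim H⁰(S, K_S)`. -/
def geometricGenus : ℕ := Module.finrank ℂ (canonicalForms ρ₁ ρ₂ L)

/-- The function field, inside that of `S`, of the image of the canonical map
`S ⇢ ℙ(H⁰(S, K_S)^∨)`: it is generated by the quotients of homogeneous coordinates, that is, by the
rational functions `ω / η` with `ω, η ∈ H⁰(S, K_S)`, `η ≠ 0`. -/
def canonicalImageField : IntermediateField ℂ (SurfaceField ρ₁ ρ₂ L) :=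
  IntermediateField.adjoin ℂ {f | ∃ ω ∈ canonicalForms ρ₁ ρ₂ L, ∃ η ∈ canonicalForms ρ₁ ρ₂ L,
    η ≠ 0 ∧ ω = f • η}

/-- The canonical map of `S` is birational onto its image `Σ`: pull-back of rational functions
`ℂ(Σ) → ℂ(S)` is an isomorphism. -/
def IsCanonicalMapBirational : Prop := canonicalImageField ρ₁ ρ₂ L = ⊤

end Surface

end SIP

end

open SIP

open SIP

noncomputable section

/-! The proof has three ingredients: explicit equations for the covers, a symmetry argument for the
canonical map, and a small combinatorial problem over `𝔽₂³`.

Equations. For a coordinate `t` on `C / G ≅ ℙ¹`, unbranched at `∞`, each character `c` has an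
eigenfunction `Y c` with `Y c ^ 2 = f c (t)` and `f c` squarefree (`IsCoord.exists_frame_at`). The
roots of `f c` are the branch points whose local monodromy `v` satisfies `c ⬝ᵥ v = 1`, so `deg f c`
is the sum of the multiplicities of these `v` (`sum_mult_eq_natDegree`). This degree is even
(`even_natDegree`), and positive for `c ≠ 0` (`natDegree_pos`). The regular differentials in the
isotypic component of `c` are `p dt / Y c` with `deg p < deg f c / 2 - 1`. Hence `N(χ)` is the
product of the two numbers `deg / 2 - 1`, and it is nonzero exactly when both degrees are at least
`4`.

Symmetry. As `G` is abelian, an element `g ≠ 0` acting on the first factor alone induces a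
nontrivial automorphism of `S`. On the part of `H⁰(S, K_S)` belonging to `χ` it acts by `(-1) ^
χ(g)`. If `χ(g)` has the same value for all `χ` with `N(χ) ≠ 0`, then `g` acts on all 2-forms by one
scalar, so it fixes every quotient of 2-forms and the canonical map is not birational
(`not_isCanonicalMapBirational`). The full decomposition of `H⁰(S, K_S)` is not needed, only that a
2-form with a nonzero `χ`-component forces both `V_{i,χ}` to be nonzero. This follows by restricting
the form to a generic fibre of each projection: the restriction is a regular differential on a curve
(`eigenDiff_ne_bot_of_proj_ne_zero`).

Combinatorics. Birationality thus means that the characters with both degrees at least `4` lie in no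
affine hyperplane of `𝔽₂³` (`IsSpread`). The monodromies of `C₁` contain a basis, and freeness makes
the two supports disjoint. If `r₁ = 6`, parity forces multiplicity two at each basis vector, so only
the four characters `(1,1,0)`, `(1,0,1)`, `(0,1,1)`, `(1,1,1)` can contribute. All four are then
needed, and the resulting inequalities give `r₂ ≥ 10` and fix the multiplicities for `r₂ = 10, 11`.
If `r₁ = 7` and `r₂ = 8`, the contributing characters always lie in an affine hyperplane. -/

namespace SIP

/-! ### Characters and isotypic decomposition -/

/-- The sign character of `ℤ/2`. -/
def sgn (a : ZMod 2) : ℂ := (-1) ^ a.val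

@[simp] theorem sgn_zero : sgn 0 = 1 := by simp [sgn]

@[simp] theorem sgn_one : sgn 1 = -1 := by
  have : (1 : ZMod 2).val = 1 := rfl
  simp [sgn, this]

theorem zmod_two_cases (a : ZMod 2) : a = 0 ∨ a = 1 := by
  revert a; decide

theorem sgn_cases (a : ZMod 2) : sgn a = 1 ∨ sgn a = -1 := by
  rcases zmod_two_cases a with rfl | rfl <;> simp

theorem sgn_add (a b : ZMod 2) : sgn (a + b) = sgn a * sgn b := by
  have h : (1 : ZMod 2) + 1 = 0 := rfl
  rcases zmod_two_cases a with rfl | rfl <;> rcases zmod_two_cases b with rfl | rfl <;> simp [h]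

@[simp] theorem sgn_mul_self (a : ZMod 2) : sgn a * sgn a = 1 := by
  rcases sgn_cases a with h | h <;> simp [h]

theorem sgn_ne_zero (a : ZMod 2) : sgn a ≠ 0 := by
  rcases sgn_cases a with h | h <;> simp [h]

theorem add_self_eq_zero_E (v : E) : v + v = 0 := by
  ext i; exact CharTwo.add_self_eq_zero _

theorem sum_sgn (v : E) : ∑ c : E, sgn (c ⬝ᵥ v) = if v = 0 then 8 else 0 := by
  have h : ∀ v : E, ∑ c : E, ((-1 : ℤ) ^ (c ⬝ᵥ v).val) = if v = 0 then 8 else 0 := by decide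
  have := congrArg (Int.cast : ℤ → ℂ) (h v)
  push_cast at this
  simpa only [sgn] using this

section Eigen

variable {F : Type*} [Field F] [Algebra ℂ F] (ρ : G →* (F ≃ₐ[ℂ] F))

/-- The automorphism of `F` by which `v` acts. -/
abbrev act (v : E) : F ≃ₐ[ℂ] F := ρ (Multiplicative.ofAdd v)

theorem act_add (v w : E) (x : F) : act ρ (v + w) x = act ρ v (act ρ w x) := by
  simp [act, ofAdd_add]

@[simp] theorem act_zero (x : F) : act ρ 0 x = x := by simp [act]

@[simp] theorem act_act (v : E) (x : F) : act ρ v (act ρ v x) = x := by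
  rw [← act_add, add_self_eq_zero_E, act_zero]

/-- `x` lies in the isotypic component of the character with coordinates `c`. -/
def IsEigen (c : E) (x : F) : Prop := ∀ v, act ρ v x = sgn (c ⬝ᵥ v) • x

variable {ρ}

theorem IsEigen.mul {c d : E} {x y : F} (hx : IsEigen ρ c x) (hy : IsEigen ρ d y) :
    IsEigen ρ (c + d) (x * y) := fun v => by
  rw [map_mul, hx, hy, add_dotProduct, sgn_add, smul_mul_smul_comm]

theorem IsEigen.inv {c : E} {x : F} (hx : IsEigen ρ c x) : IsEigen ρ c x⁻¹ := fun v => by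
  rw [map_inv₀, hx]
  rcases sgn_cases (c ⬝ᵥ v) with h | h <;> simp [h, inv_neg]

theorem IsEigen.mul_self_fixed {c : E} {x y : F} (hx : IsEigen ρ c x) (hy : IsEigen ρ c y) :
    IsEigen ρ 0 (x * y) := by
  simpa [add_self_eq_zero_E] using hx.mul hy

theorem isEigen_zero_iff {x : F} : IsEigen ρ 0 x ↔ ∀ v, act ρ v x = x := by
  simp [IsEigen]

theorem IsEigen.div_fixed {c : E} {x y : F} (hx : IsEigen ρ c x) (hy : IsEigen ρ c y) :
    IsEigen ρ 0 (x / y) := by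
  rw [div_eq_mul_inv]; exact hx.mul_self_fixed hy.inv

theorem IsEigen.fixed_mul {c : E} {x y : F} (hx : IsEigen ρ 0 x) (hy : IsEigen ρ c y) :
    IsEigen ρ c (x * y) := by
  simpa using hx.mul hy

variable (ρ) in
/-- The projection to the isotypic component with coordinates `c`. -/
def proj (c : E) (x : F) : F := (8⁻¹ : ℂ) • ∑ v : E, sgn (c ⬝ᵥ v) • act ρ v x

theorem isEigen_proj (c : E) (x : F) : IsEigen ρ c (proj ρ c x) := fun w => by
  simp only [proj, map_smul, map_sum]
  rw [smul_comm]
  congr 1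
  rw [Finset.smul_sum, ← Equiv.sum_comp (Equiv.addLeft w)]
  refine Finset.sum_congr rfl fun v _ => ?_
  simp only [Equiv.coe_addLeft, dotProduct_add, sgn_add, act_add, act_act, smul_smul]

theorem sum_proj (x : F) : ∑ c : E, proj ρ c x = x := by
  simp only [proj]
  rw [← Finset.smul_sum, Finset.sum_comm]
  simp_rw [← Finset.sum_smul, sum_sgn]
  simp

/-- If the projector to the `c`-component were zero, it would be a linear relation with nonzero
coefficients between the automorphisms `act ρ v`. These are distinct by faithfulness, contradicting
Dedekind's independence of characters. -/
theorem exists_isEigen_ne_zero (hρ : Function.Injective ρ) (c : E) :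
    ∃ x : F, x ≠ 0 ∧ IsEigen ρ c x := by
  by_contra! h
  have hz : ∀ x, proj ρ c x = 0 := fun x => by
    by_contra hx; exact h _ hx (isEigen_proj c x)
  have hli : LinearIndependent F (fun f : F →* F => (f : F → F)) := linearIndependent_monoidHom F F
  have hinj : Function.Injective (fun v : E => ((act ρ v : F ≃ₐ[ℂ] F) : F →* F)) := by
    intro v w hvw
    have : act ρ v = act ρ w := AlgEquiv.ext fun x => DFunLike.congr_fun hvw x
    exact Multiplicative.ofAdd.injective (hρ this)
  have hli2 := hli.comp _ hinj
  rw [Fintype.linearIndependent_iff] at hli2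
  have := hli2 (fun v => algebraMap ℂ F (sgn (c ⬝ᵥ v))) (by
    funext x
    have hx := hz x
    rw [proj, smul_eq_zero_iff_right (by norm_num)] at hx
    simpa [Finset.sum_apply, Algebra.smul_def] using hx) 0
  simp at this

end Eigen

section

open Polynomial

/-! ### Points and coordinates -/

section Point

variable {F : Type*} [Field F] [Algebra ℂ F]

/-- The valuation of a point. -/
abbrev Point.val (P : Point F) : Valuation F P.ring.ValueGroup := P.ring.valuation

theorem Point.mem_iff (P : Point F) {x : F} : x ∈ P.ring ↔ P.val x ≤ 1 :=
  (P.ring.valuation_le_one_iff x).symm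

theorem Point.val_algebraMap (P : Point F) {c : ℂ} (hc : c ≠ 0) : P.val (algebraMap ℂ F c) = 1 := by
  refine le_antisymm (P.mem_iff.1 (P.algebraMap_mem c)) ?_
  have h := P.mem_iff.1 (P.algebraMap_mem c⁻¹)
  rw [map_inv₀, map_inv₀] at h
  have h0 : P.val (algebraMap ℂ F c) ≠ 0 := by simpa using hc
  exact (inv_le_one₀ (zero_lt_iff.2 h0)).1 h

theorem Point.val_smul (P : Point F) {c : ℂ} (hc : c ≠ 0) (x : F) : P.val (c • x) = P.val x := by
  rw [Algebra.smul_def, map_mul, P.val_algebraMap hc, one_mul]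

theorem Point.val_smul_le (P : Point F) (c : ℂ) (x : F) : P.val (c • x) ≤ P.val x := by
  by_cases hc : c = 0
  · simp [hc]
  · rw [P.val_smul hc]

theorem Point.val_algebraMap_le (P : Point F) (c : ℂ) : P.val (algebraMap ℂ F c) ≤ 1 :=
  P.mem_iff.1 (P.algebraMap_mem c)

theorem Point.eq_of_val_sub_lt (P : Point F) {x : F} {c d : ℂ}
    (hc : P.val (x - algebraMap ℂ F c) < 1) (hd : P.val (x - algebraMap ℂ F d) < 1) : c = d := by
  by_contra h
  have h1 := P.val.map_sub_lt hd hc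
  rw [sub_sub_sub_cancel_left, ← map_sub, P.val_algebraMap (sub_ne_zero.2 h)] at h1
  exact lt_irrefl _ h1

theorem Point.val_aeval_le (P : Point F) {t : F} (ht : P.val t ≤ 1) (p : ℂ[X]) :
    P.val (aeval t p) ≤ 1 := by
  induction p using Polynomial.induction_on' with
  | add p q hp hq => rw [map_add]; exact P.val.map_add_le hp hq
  | monomial n a =>
    rw [aeval_monomial, map_mul, map_pow]
    exact mul_le_one' (P.val_algebraMap_le a) (pow_le_one₀ zero_le ht)

theorem Point.val_aeval_le_of_eval_zero (P : Point F) {t : F} (ht : P.val t ≤ 1) {p : ℂ[X]}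
    (hp : p.eval 0 = 0) : P.val (aeval t p) ≤ P.val t := by
  obtain ⟨q, rfl⟩ := X_dvd_iff.2 (by rwa [coeff_zero_eq_eval_zero] : p.coeff 0 = 0)
  rw [map_mul, aeval_X, map_mul]
  exact mul_le_of_le_one_right' (P.val_aeval_le ht q)

theorem Point.val_aeval_sub_lt (P : Point F) {t : F} (ht : P.val t < 1) (p : ℂ[X]) :
    P.val (aeval t p - algebraMap ℂ F (p.eval 0)) < 1 := by
  have := P.val_aeval_le_of_eval_zero ht.le (p := p - C (p.eval 0)) (by simp)
  rw [map_sub, aeval_C] at this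
  exact this.trans_lt ht

theorem Point.val_eq_one_of_val_sub_lt (P : Point F) {x : F} {c : ℂ} (hc : c ≠ 0)
    (h : P.val (x - algebraMap ℂ F c) < 1) : P.val x = 1 := by
  have := P.val.map_add_eq_of_lt_right (x := x - algebraMap ℂ F c) (y := algebraMap ℂ F c)
    (by rwa [P.val_algebraMap hc])
  rwa [sub_add_cancel, P.val_algebraMap hc] at this

theorem Point.val_aeval_eq_one (P : Point F) {t : F} (ht : P.val t < 1) {p : ℂ[X]}
    (hp : p.eval 0 ≠ 0) : P.val (aeval t p) = 1 :=
  P.val_eq_one_of_val_sub_lt hp (P.val_aeval_sub_lt ht p)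

/-- Every element of the residue field of a point with coordinate `t = 0` which is a square root of a
constant is a constant. -/
theorem Point.exists_const_of_sq (P : Point F) {x : F} {c : ℂ}
    (h : P.val (x ^ 2 - algebraMap ℂ F c) < 1) : ∃ d : ℂ, d ^ 2 = c ∧
      P.val (x - algebraMap ℂ F d) < 1 := by
  obtain ⟨d, hd⟩ := IsAlgClosed.exists_eq_mul_self c
  rw [hd, map_mul, show x ^ 2 - algebraMap ℂ F d * algebraMap ℂ F d =
    (x - algebraMap ℂ F d) * (x + algebraMap ℂ F d) by ring, map_mul] at h
  by_cases h1 : P.val (x - algebraMap ℂ F d) < 1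
  · exact ⟨d, by rw [hd, sq], h1⟩
  · refine ⟨-d, by rw [hd]; ring, ?_⟩
    rw [map_neg, sub_neg_eq_add]
    by_contra h2
    push Not at h1 h2
    exact absurd h (not_lt.2 (one_le_mul h1 h2))

/-- The ideal `(t)` of the polynomial ring `ℂ[t] ⊆ F` is proper, so some valuation ring of `F`
dominates it. It is not all of `F`, because `t` is a nonzero nonunit. -/
theorem Point.exists_val_lt_one {t : F} (ht : Transcendental ℂ t) :
    ∃ P : Point F, P.val t < 1 := by
  let A : Subring F := (Algebra.adjoin ℂ {t}).toSubring
  let tA : A := ⟨t, Algebra.self_mem_adjoin_singleton ℂ t⟩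
  have hne : Ideal.span {tA} ≠ ⊤ := by
    rw [Ne, Ideal.span_singleton_eq_top]
    intro hu
    obtain ⟨⟨b, hb⟩, hb'⟩ := hu.exists_right_inv
    have hb2 : b ∈ (aeval (R := ℂ) t).range := by
      rw [← Algebra.adjoin_singleton_eq_range_aeval]; exact hb
    obtain ⟨p, rfl⟩ := hb2
    have h1 : t * aeval t p = 1 := congrArg Subtype.val hb'
    have h2 : aeval t (X * p - 1) = 0 := by simp [h1]
    have h3 : X * p - 1 = 0 := by
      by_contra h; exact ht ⟨_, h, h2⟩
    simpa using congrArg (eval 0) h3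
  obtain ⟨V, hV, hV'⟩ := Ideal.image_subset_nonunits_valuationSubring _ hne
  have htV : V.valuation t < 1 := hV' ⟨tA, Ideal.mem_span_singleton_self _, rfl⟩
  have ht0 : t ≠ 0 := by rintro rfl; exact ht isAlgebraic_zero
  refine ⟨⟨V, fun c => hV ((Algebra.adjoin ℂ {t}).algebraMap_mem c), ?_⟩, htV⟩
  rintro rfl
  have h := (ValuationSubring.valuation_le_one_iff (⊤ : ValuationSubring F) t⁻¹).2
    (ValuationSubring.mem_top _)
  rw [map_inv₀] at h
  have := (inv_le_one₀ (zero_lt_iff.2 ((Valuation.ne_zero_iff _).2 ht0))).1 h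
  exact absurd htV (not_lt.2 this)

theorem Point.smul_mem_iff (P : Point F) (σ : F ≃ₐ[ℂ] F) (x : F) :
    x ∈ (σ • P).ring ↔ σ.symm x ∈ P.ring := by
  change x ∈ σ • P.ring ↔ _
  rw [ValuationSubring.mem_pointwise_smul_iff_inv_smul_mem]
  rfl

theorem Point.val_lt_one_iff (P : Point F) {x : F} : P.val x < 1 ↔ x = 0 ∨ x⁻¹ ∉ P.ring :=
  P.ring.mem_nonunits_iff_or

theorem Point.smul_val_lt_one_iff (P : Point F) (σ : F ≃ₐ[ℂ] F) (x : F) :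
    (σ • P).val x < 1 ↔ P.val (σ.symm x) < 1 := by
  rw [Point.val_lt_one_iff, Point.val_lt_one_iff, P.smul_mem_iff]
  simp

end Point

section Coord

variable {F : Type*} [Field F] [Algebra ℂ F] (ρ : G →* (F ≃ₐ[ℂ] F))

theorem act_symm (v : E) (x : F) : (act ρ v).symm x = act ρ v x := by
  rw [AlgEquiv.symm_apply_eq, act_act]

/-- `t` is a coordinate on `C / G ≅ ℙ¹`: it generates the field of invariants. -/
structure IsCoord (t : F) : Prop where
  transcendental : Transcendental ℂ t
  fixed : IsEigen ρ 0 t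
  mem_adjoin : ∀ x : F, IsEigen ρ 0 x → x ∈ IntermediateField.adjoin ℂ {t}

theorem mem_fixedField_iff (x : F) :
    x ∈ IntermediateField.fixedField ρ.range ↔ IsEigen ρ 0 x := by
  rw [IntermediateField.mem_fixedField_iff, isEigen_zero_iff]
  constructor
  · intro h v; exact h _ ⟨_, rfl⟩
  · rintro h _ ⟨g, rfl⟩; exact h (Multiplicative.toAdd g)

variable {ρ}

theorem IsGaloisCoverOfLine.exists_isCoord (h : IsGaloisCoverOfLine ρ) : ∃ t, IsCoord ρ t := by
  obtain ⟨ψ⟩ := h.quotient_eq_line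
  let φ : RatFunc ℂ →ₐ[ℂ] F := (IntermediateField.val _).comp ψ.symm.toAlgHom
  have hφ : ∀ x, φ x = (ψ.symm x : F) := fun _ => rfl
  refine ⟨φ RatFunc.X, ?_, ?_, ?_⟩
  · refine transcendental_iff_injective.2 ?_
    intro p q hpq
    have : ∀ p : ℂ[X], aeval (φ RatFunc.X) p = φ (algebraMap ℂ[X] (RatFunc ℂ) p) := fun p => by
      rw [aeval_algHom_apply, ← RatFunc.algebraMap_X, aeval_algebraMap_apply, aeval_X_left_apply]
    rw [this, this] at hpq
    exact RatFunc.algebraMap_injective ℂ (φ.toRingHom.injective hpq)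
  · exact (mem_fixedField_iff ρ _).1 (ψ.symm RatFunc.X).2
  · intro x hx
    obtain ⟨r, hr⟩ : ∃ r, φ r = x :=
      ⟨ψ ⟨x, (mem_fixedField_iff ρ x).2 hx⟩, by rw [hφ, AlgEquiv.symm_apply_apply]⟩
    have htop : r ∈ IntermediateField.adjoin ℂ {(RatFunc.X : RatFunc ℂ)} := by
      rw [IntermediateField.mem_adjoin_simple_iff]
      refine ⟨r.num, r.denom, ?_⟩
      have : ∀ p : ℂ[X], aeval (RatFunc.X : RatFunc ℂ) p = algebraMap ℂ[X] (RatFunc ℂ) p :=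
        fun p => by
          rw [← RatFunc.algebraMap_X, aeval_algebraMap_apply, aeval_X_left_apply]
      rw [this, this, RatFunc.num_div_denom]
    rw [← hr, ← Set.image_singleton, ← IntermediateField.adjoin_map]
    exact ⟨r, htop, rfl⟩

namespace IsCoord

variable {t : F} (ht : IsCoord ρ t)
include ht

theorem aeval_ne_zero {p : ℂ[X]} (hp : p ≠ 0) : aeval t p ≠ 0 := fun h =>
  ht.transcendental ⟨p, hp, h⟩

theorem ne_zero : t ≠ 0 := by
  simpa using ht.aeval_ne_zero X_ne_zero

theorem aeval_fixed (p : ℂ[X]) : IsEigen ρ 0 (aeval t p) :=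
  isEigen_zero_iff.2 fun v => by
    rw [← aeval_algHom_apply]; erw [isEigen_zero_iff.1 ht.fixed]

theorem sub_const (a : ℂ) : IsCoord ρ (t - algebraMap ℂ F a) := by
  refine ⟨?_, ?_, fun x hx => ?_⟩
  · intro h
    have := h.add (isAlgebraic_algebraMap (R := ℂ) (A := F) a)
    rw [sub_add_cancel] at this
    exact ht.transcendental this
  · exact isEigen_zero_iff.2 fun v => by
      rw [map_sub, isEigen_zero_iff.1 ht.fixed, AlgEquiv.commutes]
  · refine IntermediateField.adjoin_le_iff.2 ?_ (ht.mem_adjoin x hx)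
    rw [Set.singleton_subset_iff]
    have := add_mem (IntermediateField.mem_adjoin_simple_self ℂ (t - algebraMap ℂ F a))
      (IntermediateField.algebraMap_mem _ a)
    rwa [sub_add_cancel] at this

theorem inv : IsCoord ρ t⁻¹ := by
  refine ⟨?_, ht.fixed.inv, fun x hx => ?_⟩
  · intro h
    have := h.inv
    rw [inv_inv] at this
    exact ht.transcendental this
  · refine IntermediateField.adjoin_le_iff.2 ?_ (ht.mem_adjoin x hx)
    rw [Set.singleton_subset_iff]
    have := inv_mem (IntermediateField.mem_adjoin_simple_self ℂ (t⁻¹))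
    rwa [inv_inv] at this

theorem exists_coprime {x : F} (hx : IsEigen ρ 0 x) :
    ∃ p q : ℂ[X], IsCoprime p q ∧ q ≠ 0 ∧ x = aeval t p / aeval t q := by
  obtain ⟨r, s, hrs⟩ := (IntermediateField.mem_adjoin_simple_iff ℂ x).1 (ht.mem_adjoin x hx)
  by_cases hs : s = 0
  -- Division by zero is zero, so a vanishing denominator represents the function `0 / 1`.
  · exact ⟨0, 1, isCoprime_zero_left.2 isUnit_one, one_ne_zero, by simp [hrs, hs]⟩
  have hg : EuclideanDomain.gcd r s ≠ 0 := fun h => hs (EuclideanDomain.gcd_eq_zero_iff.1 h).2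
  obtain ⟨p, hp⟩ := EuclideanDomain.gcd_dvd_left r s
  obtain ⟨q, hq⟩ := EuclideanDomain.gcd_dvd_right r s
  have hab := EuclideanDomain.gcd_eq_gcd_ab r s
  generalize EuclideanDomain.gcdA r s = a at hab
  generalize EuclideanDomain.gcdB r s = b at hab
  generalize EuclideanDomain.gcd r s = g at *
  subst hp hq
  refine ⟨p, q, ⟨a, b, mul_left_cancel₀ hg ?_⟩, right_ne_zero_of_mul hs, ?_⟩
  · rw [mul_one]; linear_combination -hab
  · rw [hrs, map_mul, map_mul, mul_div_mul_left _ _ (ht.aeval_ne_zero hg)]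

variable {P : Point F} (hP : P.val t < 1)
include hP

theorem exists_eq_div_of_val_le {x : F} (hx : IsEigen ρ 0 x) (h : P.val x ≤ 1) :
    ∃ p q : ℂ[X], q.eval 0 ≠ 0 ∧ x = aeval t p / aeval t q := by
  obtain ⟨p, q, hpq, hq, rfl⟩ := ht.exists_coprime hx
  refine ⟨p, q, fun hq0 => ?_, rfl⟩
  have hp0 : p.eval 0 ≠ 0 := by
    intro hp0
    obtain ⟨a, b, hab⟩ := hpq
    simpa [hp0, hq0] using congrArg (eval 0) hab
  have h1 := (P.val_aeval_le_of_eval_zero hP.le hq0).trans_lt hP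
  rw [map_div₀, P.val_aeval_eq_one hP hp0, one_div] at h
  have h2 := (inv_le_one₀ (zero_lt_iff.2 ((Valuation.ne_zero_iff _).2 (ht.aeval_ne_zero hq)))).1 h
  exact absurd h1 (not_lt.2 h2)

/-- At a point over `t = 0` the order of an invariant function is an integral multiple `n` of the
order of `t`. So `1 + 2n ≥ 0` already implies `n ≥ 0`. This and the next lemma replace
integer-valued orders throughout. -/
theorem val_le_of_val_mul_sq_le {x : F} (hx : IsEigen ρ 0 x) (h : P.val t * P.val x ^ 2 ≤ 1) :
    P.val x ≤ 1 := by
  obtain ⟨p, q, hpq, hq, rfl⟩ := ht.exists_coprime hx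
  by_cases hq0 : q.eval 0 = 0
  · exfalso
    have hp0 : p.eval 0 ≠ 0 := by
      intro hp0
      obtain ⟨a, b, hab⟩ := hpq
      simpa [hp0, hq0] using congrArg (eval 0) hab
    have h1 := P.val_aeval_le_of_eval_zero hP.le hq0
    have h0 : 0 < P.val (aeval t q) :=
      zero_lt_iff.2 ((Valuation.ne_zero_iff _).2 (ht.aeval_ne_zero hq))
    rw [map_div₀, P.val_aeval_eq_one hP hp0, one_div, inv_pow, ← div_eq_mul_inv,
      div_le_one₀ (pow_pos h0 2)] at h
    have h2 : P.val (aeval t q) ^ 2 < P.val (aeval t q) := by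
      rw [sq]
      exact mul_lt_of_lt_one_right h0 (h1.trans_lt hP)
    exact absurd (h.trans_lt h2) (not_lt.2 h1)
  · rw [map_div₀, P.val_aeval_eq_one hP hq0, div_one]
    exact P.val_aeval_le hP.le p

/-- The odd number `1 + 2n` is never zero; this is the source of all parity statements below. -/
theorem val_mul_sq_ne_one {x : F} (hx : IsEigen ρ 0 x) : P.val t * P.val x ^ 2 ≠ 1 := by
  intro h
  have h1 := ht.val_le_of_val_mul_sq_le hP hx h.le
  have h2 : P.val t * P.val x ^ 2 < 1 := mul_lt_one_of_lt_of_le hP (pow_le_one₀ zero_le h1)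
  exact h2.ne h

theorem exists_const_of_fixed {x : F} (hx : IsEigen ρ 0 x) (h : P.val x ≤ 1) :
    ∃ c : ℂ, P.val (x - algebraMap ℂ F c) < 1 := by
  obtain ⟨p, q, hq, rfl⟩ := ht.exists_eq_div_of_val_le hP hx h
  have hq1 := P.val_aeval_eq_one hP hq
  have hq0 : aeval t q ≠ 0 := by
    intro h0; rw [h0, map_zero] at hq1; exact zero_ne_one hq1
  refine ⟨p.eval 0 / q.eval 0, ?_⟩
  have := P.val_aeval_le_of_eval_zero hP.le (p := p - C (p.eval 0 / q.eval 0) * q)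
    (by simp [div_mul_cancel₀ _ hq])
  rw [map_sub, map_mul, aeval_C] at this
  rw [← mul_one (P.val _), ← hq1, ← map_mul, sub_mul, div_mul_cancel₀ _ hq0]
  exact (this.trans_lt hP).trans_eq hq1.symm

theorem val_deriv_le_of_fixed (D : Derivation ℂ F F) (hD : D t = 1) {x : F} (hx : IsEigen ρ 0 x)
    (h : P.val x ≤ 1) : P.val (D x) ≤ 1 := by
  obtain ⟨p, q, hq, rfl⟩ := ht.exists_eq_div_of_val_le hP hx h
  have hq1 := P.val_aeval_eq_one hP hq
  have hDp : ∀ p : ℂ[X], D (aeval t p) = aeval t (derivative p) := fun p => by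
    rw [Derivation.map_aeval, hD, smul_eq_mul, mul_one]
  rw [Derivation.leibniz_div, hDp, hDp]
  simp only [smul_eq_mul, map_mul, map_pow, map_inv₀, hq1, one_pow, inv_one, one_mul]
  exact P.val.map_sub_le
    (by rw [map_mul]; exact mul_le_one' (P.val_aeval_le hP.le _) (P.val_aeval_le hP.le _))
    (by rw [map_mul]; exact mul_le_one' (P.val_aeval_le hP.le _) (P.val_aeval_le hP.le _))

end IsCoord

end Coord

end

section

open Polynomial

/-! ### Local structure of the cover -/

section Local

variable {F : Type*} [Field F] [Algebra ℂ F] {ρ : G →* (F ≃ₐ[ℂ] F)} {t : F} {P : Point F}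
  {Y : E → F}

theorem Point.res_add {x y : F} {a b : ℂ} (hx : P.val (x - algebraMap ℂ F a) < 1)
    (hy : P.val (y - algebraMap ℂ F b) < 1) : P.val (x + y - algebraMap ℂ F (a + b)) < 1 := by
  have := P.val.map_add_lt hx hy
  rwa [show x - algebraMap ℂ F a + (y - algebraMap ℂ F b) = x + y - algebraMap ℂ F (a + b) by
    rw [map_add]; ring] at this

theorem Point.res_val_le {x : F} {a : ℂ} (hx : P.val (x - algebraMap ℂ F a) < 1) :
    P.val x ≤ 1 := by
  have := P.val.map_add_le hx.le (P.val_algebraMap_le a)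
  rwa [sub_add_cancel] at this

theorem Point.res_mul {x y : F} {a b : ℂ} (hx : P.val (x - algebraMap ℂ F a) < 1)
    (hy : P.val (y - algebraMap ℂ F b) < 1) : P.val (x * y - algebraMap ℂ F (a * b)) < 1 := by
  have h1 : P.val ((x - algebraMap ℂ F a) * y) < 1 := by
    rw [map_mul]; exact mul_lt_one_of_lt_of_le hx (Point.res_val_le hy)
  have h2 : P.val (algebraMap ℂ F a * (y - algebraMap ℂ F b)) < 1 := by
    rw [map_mul, mul_comm]; exact mul_lt_one_of_lt_of_le hy (P.val_algebraMap_le a)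
  have := P.val.map_add_lt h1 h2
  rwa [show (x - algebraMap ℂ F a) * y + algebraMap ℂ F a * (y - algebraMap ℂ F b) =
    x * y - algebraMap ℂ F (a * b) by rw [map_mul]; ring] at this

theorem Point.res_inv {x : F} {a : ℂ} (ha : a ≠ 0) (hx : P.val (x - algebraMap ℂ F a) < 1) :
    P.val (x⁻¹ - algebraMap ℂ F a⁻¹) < 1 := by
  have h1 := P.val_eq_one_of_val_sub_lt ha hx
  have hx0 : x ≠ 0 := by rintro rfl; simp at h1
  have ha0 : algebraMap ℂ F a ≠ 0 := by simpa using ha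
  rw [map_inv₀, inv_sub_inv hx0 ha0, map_div₀, map_mul, h1, P.val_algebraMap ha, mul_one, div_one,
    P.val.map_sub_swap]
  exact hx

variable (ρ t P Y) in
/-- A family of eigenfunctions, one for each character, of minimal order at the point `P` lying over
`t = 0`. -/
structure IsLocalFrame : Prop where
  coord : IsCoord ρ t
  val_lt : P.val t < 1
  isEigen : ∀ c, IsEigen ρ c (Y c)
  val_cases : ∀ c, P.val (Y c) = 1 ∨ P.val (Y c) ^ 2 = P.val t

variable (ρ P) in
/-- The functions which are regular on the whole orbit of `P`. -/
def orbitRing : Subring F where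
  carrier := {x | ∀ g, P.val (act ρ g x) ≤ 1}
  mul_mem' := fun hx hy g => by rw [map_mul, map_mul]; exact mul_le_one' (hx g) (hy g)
  one_mem' := fun g => by simp
  add_mem' := fun hx hy g => by rw [map_add]; exact P.val.map_add_le (hx g) (hy g)
  zero_mem' := fun g => by simp
  neg_mem' := fun hx g => by rw [map_neg, Valuation.map_neg]; exact hx g

theorem val_le_of_mem_orbitRing {x : F} (hx : x ∈ orbitRing ρ P) : P.val x ≤ 1 := by
  simpa using hx 0

theorem act_mem_orbitRing {x : F} (hx : x ∈ orbitRing ρ P) (g : E) :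
    act ρ g x ∈ orbitRing ρ P := fun h => by
  rw [← act_add]; exact hx _

theorem val_proj_le {x : F} (hx : x ∈ orbitRing ρ P) (c : E) : P.val (proj ρ c x) ≤ 1 := by
  refine (P.val_smul_le _ _).trans (P.val.map_sum_le fun v _ => ?_)
  exact (P.val_smul_le _ _).trans (hx v)

/-- Every regular function at `P` is, up to a constant, the inverse of a function which is regular on
the orbit of `P`. -/
theorem exists_eq_add_inv {x : F} (hx : P.val x ≤ 1) :
    ∃ (c : ℂ) (w : F), w ∈ orbitRing ρ P ∧ P.val w = 1 ∧ x = algebraMap ℂ F c + w⁻¹ := by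
  -- Each of the finitely many translates of `x` takes at most one finite value at `P`. For any
  -- other constant `c`, no translate of `x - c` vanishes at `P`, so the inverse of `x - c` is
  -- regular on the whole orbit.
  have hfin : (⋃ g : E, {c : ℂ | P.val (act ρ g x - algebraMap ℂ F c) < 1}).Finite :=
    Set.finite_iUnion fun g => Set.Subsingleton.finite fun a ha b hb => P.eq_of_val_sub_lt ha hb
  obtain ⟨c, hc⟩ := hfin.exists_notMem
  simp only [Set.mem_iUnion, Set.mem_ofPred_eq, not_exists, not_lt] at hc
  have hmem : (x - algebraMap ℂ F c)⁻¹ ∈ orbitRing ρ P := fun g => by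
    rw [map_inv₀, map_inv₀, map_sub, AlgEquiv.commutes]
    exact inv_le_one_of_one_le₀ (hc g)
  refine ⟨c, (x - algebraMap ℂ F c)⁻¹, hmem, ?_, by simp⟩
  have h0 : 1 ≤ P.val (x - algebraMap ℂ F c) := by simpa using hc 0
  have h1 : P.val (x - algebraMap ℂ F c) ≤ 1 := P.val.map_sub_le hx (P.val_algebraMap_le c)
  rw [map_inv₀, le_antisymm h1 h0, inv_one]

namespace IsLocalFrame

variable (h : IsLocalFrame ρ t P Y)
include h

theorem val_le (c : E) : P.val (Y c) ≤ 1 := by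
  rcases h.val_cases c with h1 | h1
  · exact h1.le
  · exact (pow_le_one_iff two_ne_zero).1 (h1.trans_le h.val_lt.le)

theorem ne_zero (c : E) : Y c ≠ 0 := by
  intro h0
  rcases h.val_cases c with h1 | h1
  · simp [h0] at h1
  · rw [h0, map_zero, zero_pow two_ne_zero] at h1
    exact h.coord.ne_zero ((Valuation.zero_iff _).1 h1.symm)

theorem val_lt_of_sq {c : E} (hc : P.val (Y c) ^ 2 = P.val t) : P.val (Y c) < 1 :=
  (pow_lt_one_iff two_ne_zero).1 (hc.trans_lt h.val_lt)

/-- If `Y c` is a unit there is nothing to do. Otherwise `Y c` behaves like a square root of `t`,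
and the invariant quotient `u = z / Y c` satisfies `v(t) v(u)² ≤ 1`, so the parity lemma applies.
Orbit-regular functions are thus combinations of the frame with coefficients in the local ring of
`ℂ(t)` at `0`. -/
theorem val_coeff_le {c : E} {z : F} (hz : IsEigen ρ c z) (hz1 : P.val z ≤ 1) :
    P.val (z / Y c) ≤ 1 := by
  rcases h.val_cases c with h1 | h1
  · rw [map_div₀, h1, div_one]; exact hz1
  · refine h.coord.val_le_of_val_mul_sq_le h.val_lt (hz.div_fixed (h.isEigen c)) ?_
    rw [← h1, ← mul_pow, ← map_mul, mul_div_cancel₀ _ (h.ne_zero c)]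
    exact pow_le_one₀ zero_le hz1

theorem sum_coeff (w : F) : ∑ c, proj ρ c w / Y c * Y c = w := by
  simp_rw [div_mul_cancel₀ _ (h.ne_zero _), sum_proj]

theorem exists_res_frame (c : E) : ∃ d : ℂ, P.val (Y c - algebraMap ℂ F d) < 1 := by
  have h1 : IsEigen ρ 0 (Y c ^ 2) := by
    rw [sq]; exact (h.isEigen c).mul_self_fixed (h.isEigen c)
  obtain ⟨a, ha⟩ := h.coord.exists_const_of_fixed h.val_lt h1
    (by rw [map_pow]; exact pow_le_one₀ zero_le (h.val_le c))
  obtain ⟨d, -, hd⟩ := P.exists_const_of_sq ha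
  exact ⟨d, hd⟩

/-- The residue field is `ℂ`: for orbit-regular functions this is read off from the frame expansion,
whose coefficients are rational in `t` and whose frame members have constant squares modulo the
maximal ideal. A general regular function is a constant plus the inverse of such a function. -/
theorem exists_res {x : F} (hx : P.val x ≤ 1) : ∃ d : ℂ, P.val (x - algebraMap ℂ F d) < 1 := by
  have key : ∀ w ∈ orbitRing ρ P, ∃ d : ℂ, P.val (w - algebraMap ℂ F d) < 1 := by
    intro w hw
    have h1 : ∀ c, ∃ d : ℂ, P.val (proj ρ c w / Y c * Y c - algebraMap ℂ F d) < 1 := fun c => by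
      obtain ⟨a, ha⟩ := h.coord.exists_const_of_fixed h.val_lt
        ((isEigen_proj c w).div_fixed (h.isEigen c))
        (h.val_coeff_le (isEigen_proj c w) (val_proj_le hw c))
      obtain ⟨b, hb⟩ := h.exists_res_frame c
      exact ⟨a * b, Point.res_mul ha hb⟩
    choose d hd using h1
    refine ⟨∑ c, d c, ?_⟩
    rw [← h.sum_coeff w, map_sum, ← Finset.sum_sub_distrib]
    exact P.val.map_sum_lt one_ne_zero fun c _ => hd c
  obtain ⟨c, w, hw, hw1, rfl⟩ := exists_eq_add_inv (ρ := ρ) hx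
  obtain ⟨d, hd⟩ := key w hw
  have hd0 : d ≠ 0 := by
    rintro rfl
    rw [map_zero, sub_zero, hw1] at hd
    exact lt_irrefl _ hd
  exact ⟨c + d⁻¹, Point.res_add (by simp) (Point.res_inv hd0 hd)⟩

/-- Let `ε c` be `0` or `1` according to whether `Y c` is a unit or a square root of `t` up to
units. Since `Y c * Y d / Y (c + d)` is invariant, its order is an integral multiple of that of `t`,
which makes `ε` additive. Hence `ε` is a linear form and is represented by a vector `g`, the local
monodromy. -/
theorem exists_dotProduct_eq :
    ∃ g : E, ∀ c : E, (c ⬝ᵥ g = 0 ∧ P.val (Y c) = 1) ∨ (c ⬝ᵥ g = 1 ∧ P.val (Y c) ^ 2 = P.val t) := by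
  classical
  have ht0 : P.val t ≠ 0 := (Valuation.ne_zero_iff _).2 h.coord.ne_zero
  let ε : E → ZMod 2 := fun c => if P.val (Y c) = 1 then 0 else 1
  have hone : ∀ x, IsEigen ρ 0 x → P.val x ^ 2 ≠ P.val t := fun x hx hx2 => by
    refine h.coord.val_mul_sq_ne_one h.val_lt hx.inv ?_
    rw [map_inv₀, inv_pow, hx2, mul_inv_cancel₀ ht0]
  have hadd : ∀ c d, ε (c + d) = ε c + ε d := fun c d => by
    have hfix : IsEigen ρ 0 (Y c * Y d / Y (c + d)) :=
      ((h.isEigen c).mul (h.isEigen d)).div_fixed (h.isEigen _)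
    have hsq := hone _ hfix
    have hsq' := h.coord.val_mul_sq_ne_one h.val_lt hfix
    rw [map_div₀, map_mul, div_pow, mul_pow] at hsq hsq'
    have hlt : ∀ c, P.val (Y c) ^ 2 = P.val t → P.val (Y c) ≠ 1 := fun c hc =>
      (h.val_lt_of_sq hc).ne
    have h11 : (1 : ZMod 2) + 1 = 0 := rfl
    rcases h.val_cases c with hc | hc <;> rcases h.val_cases d with hd | hd <;>
      rcases h.val_cases (c + d) with hcd | hcd
    · simp [ε, hc, hd, hcd]
    · exact absurd (by simp [hc, hd, hcd, ht0]) hsq'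
    · exact absurd (by simp [hc, hd, hcd]) hsq
    · simp [ε, hc, hlt _ hd, hlt _ hcd]
    · exact absurd (by simp [hc, hd, hcd]) hsq
    · simp [ε, hd, hlt _ hc, hlt _ hcd]
    · simp [ε, hcd, hlt _ hc, hlt _ hd, h11]
    · exact absurd (by simp [hc, hd, hcd, ht0]) hsq
  let εL : E →ₗ[ZMod 2] ZMod 2 := AddMonoidHom.toZModLinearMap 2 (AddMonoidHom.mk' ε hadd)
  refine ⟨(dotProductEquiv (ZMod 2) (Fin 3)).symm εL, fun c => ?_⟩
  have hdot : c ⬝ᵥ (dotProductEquiv (ZMod 2) (Fin 3)).symm εL = ε c := by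
    have := LinearMap.congr_fun ((dotProductEquiv (ZMod 2) (Fin 3)).apply_symm_apply εL) c
    rw [dotProduct_comm]
    exact this
  rw [hdot]
  by_cases h1 : P.val (Y c) = 1
  · exact Or.inl ⟨by simp [ε, h1], h1⟩
  · exact Or.inr ⟨by simp [ε, h1], (h.val_cases c).resolve_left h1⟩

/-- An element fixing `P` preserves values at `P`. If it negated `Y c`, the nonzero value `d` of `Y
c` would satisfy `d = -d`. -/
theorem dotProduct_eq_zero_of_mem_stab {g c : E} (hg : act ρ g • P = P) (hc : P.val (Y c) = 1) :
    c ⬝ᵥ g = 0 := by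
  rcases zmod_two_cases (c ⬝ᵥ g) with h0 | h1
  · exact h0
  exfalso
  obtain ⟨d, hd⟩ := h.exists_res_frame c
  have hd2 : P.val (act ρ g (Y c - algebraMap ℂ F d)) < 1 := by
    have := P.smul_val_lt_one_iff (act ρ g) (act ρ g (Y c - algebraMap ℂ F d))
    rw [AlgEquiv.symm_apply_apply] at this
    rw [hg] at this
    exact this.2 hd
  rw [map_sub, h.isEigen c g, h1, sgn_one, AlgEquiv.commutes, neg_one_smul, ← Valuation.map_neg,
    neg_sub, sub_neg_eq_add, add_comm, ← sub_neg_eq_add, ← map_neg] at hd2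
  have := P.eq_of_val_sub_lt hd hd2
  have hd0 : d = 0 := by
    have h2 : (2 : ℂ) * d = 0 := by linear_combination this
    simpa using h2
  rw [hd0, map_zero, sub_zero, hc] at hd
  exact lt_irrefl _ hd

/-- Such a `g` negates only isotypic components that are multiples of frame members vanishing at
`P`, so it acts trivially on orbit-regular functions modulo the maximal ideal. In particular it
preserves units among them, and with them the whole local ring. -/
theorem act_smul_eq {g : E} (hg : ∀ c, c ⬝ᵥ g = 1 → P.val (Y c) < 1) : act ρ g • P = P := by
  have key : ∀ w ∈ orbitRing ρ P, P.val (act ρ g w - w) < 1 := by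
    intro w hw
    conv_lhs => rw [← sum_proj (ρ := ρ) w]
    rw [map_sum, ← Finset.sum_sub_distrib]
    refine P.val.map_sum_lt one_ne_zero fun c _ => ?_
    rw [isEigen_proj c w g]
    rcases zmod_two_cases (c ⬝ᵥ g) with h0 | h1
    · simp [h0]
    · rw [h1, sgn_one, show (-1 : ℂ) • proj ρ c w - proj ρ c w = (-2 : ℂ) • proj ρ c w by module,
        P.val_smul (by norm_num), ← div_mul_cancel₀ (proj ρ c w) (h.ne_zero c), map_mul, mul_comm]
      exact mul_lt_one_of_lt_of_le (hg c h1)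
        (h.val_coeff_le (isEigen_proj c w) (val_proj_le hw c))
  have key2 : ∀ x, P.val x ≤ 1 → P.val (act ρ g x) ≤ 1 := by
    intro x hx
    obtain ⟨c, w, hw, hw1, rfl⟩ := exists_eq_add_inv (ρ := ρ) hx
    have h1 : P.val (act ρ g w) = 1 := by
      have := P.val.map_add_eq_of_lt_right (x := act ρ g w - w) (y := w) (by rw [hw1]; exact key w hw)
      rwa [sub_add_cancel, hw1] at this
    rw [map_add, map_inv₀, AlgEquiv.commutes]
    exact P.val.map_add_le (P.val_algebraMap_le c) (by rw [map_inv₀, h1, inv_one])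
  refine Point.ext (ValuationSubring.ext _ _ fun x => ?_)
  rw [P.smul_mem_iff, act_symm, P.mem_iff, P.mem_iff]
  exact ⟨fun hx => by simpa using key2 _ hx, key2 x⟩

theorem stab_eq {g : E} (hg : ∀ c : E, (c ⬝ᵥ g = 0 ∧ P.val (Y c) = 1) ∨
    (c ⬝ᵥ g = 1 ∧ P.val (Y c) ^ 2 = P.val t)) :
    stab ρ P = Subgroup.zpowers (Multiplicative.ofAdd g) := by
  have hdual : ∀ g v : E, (∀ c : E, c ⬝ᵥ g = 0 → c ⬝ᵥ v = 0) → v = 0 ∨ v = g := by decide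
  have hmem : ∀ v : E, Multiplicative.ofAdd v ∈ stab ρ P ↔ act ρ v • P = P := fun v => Iff.rfl
  refine le_antisymm ?_ ?_
  · intro v hv
    obtain ⟨v, rfl⟩ := Multiplicative.ofAdd.surjective v
    have hv' := (hmem v).1 hv
    have hv0 : ∀ c : E, c ⬝ᵥ g = 0 → c ⬝ᵥ v = 0 := fun c hc => by
      refine h.dotProduct_eq_zero_of_mem_stab hv' ?_
      rcases hg c with h1 | h1
      · exact h1.2
      · rw [hc] at h1; exact absurd h1.1 (by decide)
    rcases hdual g v hv0 with h0 | h0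
    · rw [h0]; exact Subgroup.one_mem _
    · rw [h0]; exact Subgroup.mem_zpowers _
  · rw [Subgroup.zpowers_le, hmem]
    refine h.act_smul_eq fun c hc => ?_
    rcases hg c with h1 | h1
    · rw [hc] at h1; exact absurd h1.1 (by decide)
    · exact h.val_lt_of_sq h1.2

/-- A bound for the derivative of a regular function. -/
theorem val_mul_deriv_le {D : Derivation ℂ F F} (hD : D t = 1) {z : F} (hz1 : P.val z ≤ 1)
    (hz : ∀ c, P.val z ≤ P.val (Y c)) {x : F} (hx : P.val x ≤ 1) : P.val (z * D x) ≤ 1 := by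
  -- From `2 Y c * D (Y c) = D (Y c ^ 2)`, which is regular because `Y c ^ 2` is invariant: `D (Y
  -- c)` has at most the pole of `1 / Y c`, and `z` cancels it.
  have hY : ∀ c, P.val (z * D (Y c)) ≤ 1 := fun c => by
    have h1 : IsEigen ρ 0 (Y c * Y c) := (h.isEigen c).mul_self_fixed (h.isEigen c)
    have h2 := h.coord.val_deriv_le_of_fixed h.val_lt D hD h1
      (by rw [map_mul]; exact mul_le_one' (h.val_le c) (h.val_le c))
    rw [Derivation.leibniz, smul_eq_mul, ← two_mul, ← map_ofNat (algebraMap ℂ F) 2,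
      map_mul, P.val_algebraMap two_ne_zero, one_mul, map_mul] at h2
    rw [map_mul]
    exact (mul_le_mul_left (hz c) _).trans h2
  have hw : ∀ w ∈ orbitRing ρ P, P.val (z * D w) ≤ 1 := fun w hw => by
    rw [← h.sum_coeff w, map_sum, Finset.mul_sum]
    refine P.val.map_sum_le fun c _ => ?_
    have hu := h.val_coeff_le (isEigen_proj c w) (val_proj_le hw c)
    have hDu := h.coord.val_deriv_le_of_fixed h.val_lt D hD
      ((isEigen_proj c w).div_fixed (h.isEigen c)) hu
    rw [Derivation.leibniz, smul_eq_mul, smul_eq_mul, mul_add, mul_left_comm]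
    refine P.val.map_add_le ?_ ?_
    · rw [map_mul]; exact mul_le_one' hu (hY c)
    · rw [map_mul, map_mul]; exact mul_le_one' hz1 (mul_le_one' (h.val_le c) hDu)
  obtain ⟨c, w, hw', hw1, rfl⟩ := exists_eq_add_inv (ρ := ρ) hx
  have hw0 : w ≠ 0 := by rintro rfl; simp at hw1
  rw [map_add, Derivation.map_algebraMap, zero_add, Derivation.leibniz_inv, smul_eq_mul,
    mul_left_comm, map_mul, Valuation.map_neg, map_pow, map_inv₀, hw1, inv_one, one_pow, one_mul]
  exact hw w hw'

/-- If `h dt` is regular at `P`, where `h` belongs to the isotypic component of `c`, then so is the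
function `h Y_c`. -/
theorem val_mul_le_of_regular {D : Derivation ℂ F F} (hD : D t = 1) {c : E} {x : F}
    (hx : IsEigen ρ c x)
    (hreg : x • KaehlerDifferential.D ℂ F t ∈ Submodule.span P.ring
      {η | ∃ a ∈ P.ring, η = KaehlerDifferential.D ℂ F a}) : P.val (x * Y c) ≤ 1 := by
  have main : ∀ z, P.val z ≤ 1 → (∀ c, P.val z ≤ P.val (Y c)) → P.val (z * x) ≤ 1 := by
    intro z hz1 hz
    have : ∀ ω ∈ Submodule.span P.ring {η | ∃ a ∈ P.ring, η = KaehlerDifferential.D ℂ F a},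
        P.val (z * D.liftKaehlerDifferential ω) ≤ 1 := by
      intro ω hω
      induction hω using Submodule.span_induction with
      | mem ω hω =>
        obtain ⟨a, ha, rfl⟩ := hω
        rw [Derivation.liftKaehlerDifferential_comp_D]
        exact h.val_mul_deriv_le hD hz1 hz (P.mem_iff.1 ha)
      | zero => simp
      | add ω η _ _ h1 h2 => rw [map_add, mul_add]; exact P.val.map_add_le h1 h2
      | smul r ω _ h1 =>
        change P.val (z * D.liftKaehlerDifferential ((r : F) • ω)) ≤ 1
        rw [map_smul, smul_eq_mul, mul_left_comm, map_mul]
        exact mul_le_one' (P.mem_iff.1 r.2) h1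
    have h2 := this _ hreg
    rwa [map_smul, Derivation.liftKaehlerDifferential_comp_D, hD, smul_eq_mul, mul_one] at h2
  -- At a ramified point all nonunit frame members have the same, smallest, value, so any of them
  -- may serve as the multiplier `z`.
  have main2 : ∀ c0, P.val (Y c0) ^ 2 = P.val t → P.val (Y c0 * x) ≤ 1 := fun c0 h0 =>
    main _ (h.val_le c0) fun c => by
      rcases h.val_cases c with h1 | h1
      · rw [h1]; exact h.val_le c0
      · exact ((pow_left_inj₀ zero_le zero_le two_ne_zero).1 (h0.trans h1.symm)).le
  rcases h.val_cases c with hc | hc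
  · by_cases hall : ∀ c, P.val (Y c) = 1
    · have := main 1 (by simp) (fun c => by simp [hall c])
      rwa [map_mul, hc, mul_one, ← one_mul x]
    · push Not at hall
      obtain ⟨c0, hc0⟩ := hall
      have h0 := (h.val_cases c0).resolve_left hc0
      -- Here `Y c` is a unit at a ramified point. The bound for `Y c0 * x` loses a factor `Y c0`,
      -- that is half the order of `t`; parity recovers it because `x * Y c` is invariant.
      refine h.coord.val_le_of_val_mul_sq_le h.val_lt (hx.mul_self_fixed (h.isEigen c)) ?_
      rw [← h0, ← mul_pow, map_mul, hc, mul_one, ← map_mul]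
      exact pow_le_one₀ zero_le (main2 c0 h0)
  · rw [mul_comm]; exact main2 c hc

/-- The frame describes the orbit ring as the sum of the `R * Y c`, where `R` is the local ring of
`ℂ(t)` at `0`. This description does not involve the chosen point over `t = 0`. -/
theorem orbitRing_le {Q : Point F} (hQ : IsLocalFrame ρ t Q Y) :
    orbitRing ρ P ≤ orbitRing ρ Q := by
  intro w hw
  rw [← h.sum_coeff w]
  refine Subring.sum_mem _ fun c _ => Subring.mul_mem _ ?_ ?_
  · intro g
    have hfix := (isEigen_proj c w).div_fixed (h.isEigen c)
    rw [isEigen_zero_iff.1 hfix]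
    obtain ⟨p, q, hq, heq⟩ := h.coord.exists_eq_div_of_val_le h.val_lt hfix
      (h.val_coeff_le (isEigen_proj c w) (val_proj_le hw c))
    rw [heq, map_div₀, Q.val_aeval_eq_one hQ.val_lt hq, div_one]
    exact Q.val_aeval_le hQ.val_lt.le p
  · intro g
    rw [h.isEigen c g]
    exact (Q.val_smul_le _ _).trans (hQ.val_le c)

/-- `G` acts transitively on the points over `t = 0`. -/
theorem exists_act_smul_eq {Q : Point F} (hQ : IsLocalFrame ρ t Q Y) :
    ∃ g, act ρ g • Q = P := by
  have hPQ : orbitRing ρ P = orbitRing ρ Q := le_antisymm (h.orbitRing_le hQ) (hQ.orbitRing_le h)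
  let φ : E → (orbitRing ρ P →+* P.ring) := fun g =>
    { toFun := fun w => ⟨act ρ g w, P.mem_iff.2 (w.2 g)⟩
      map_one' := Subtype.ext (map_one _)
      map_zero' := Subtype.ext (map_zero _)
      map_add' := fun x y => Subtype.ext (map_add _ _ _)
      map_mul' := fun x y => Subtype.ext (map_mul _ _ _) }
  let ψ : orbitRing ρ P →+* Q.ring :=
    { toFun := fun w => ⟨w, Q.mem_iff.2 (val_le_of_mem_orbitRing (ρ := ρ) (hPQ ▸ w.2))⟩
      map_one' := rfl
      map_zero' := rfl
      map_add' := fun x y => rfl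
      map_mul' := fun x y => rfl }
  let 𝔭 : E → Ideal (orbitRing ρ P) := fun g => (IsLocalRing.maximalIdeal P.ring).comap (φ g)
  let 𝔮 : Ideal (orbitRing ρ P) := (IsLocalRing.maximalIdeal Q.ring).comap ψ
  have h𝔭 : ∀ g w, w ∈ 𝔭 g ↔ P.val (act ρ g w) < 1 := fun g w =>
    P.ring.valuation_lt_one_iff _
  have h𝔮 : ∀ w, w ∈ 𝔮 ↔ Q.val w < 1 := fun w => Q.ring.valuation_lt_one_iff _
  -- If `w` vanished at `Q` but at no translate of `P`, its norm would be an invariant function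
  -- vanishing at `Q` and not at `P`. But the norm is rational in `t`, so whether it vanishes
  -- depends only on `t = 0`.
  have hcov : (𝔮 : Set (orbitRing ρ P)) ⊆ ⋃ g ∈ ((Finset.univ : Finset E) : Set E), 𝔭 g := by
    intro w hw
    have hw' := (h𝔮 w).1 hw
    by_contra hcon
    simp only [Finset.coe_univ, Set.mem_univ, Set.iUnion_true, Set.mem_iUnion, SetLike.mem_coe,
      not_exists, h𝔭, not_lt] at hcon
    have hcon' : ∀ g, P.val (act ρ g w) = 1 := fun g => le_antisymm (w.2 g) (hcon g)
    have hfix : IsEigen ρ 0 (∏ g : E, act ρ g (w : F)) := isEigen_zero_iff.2 fun v => by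
      rw [map_prod, ← Equiv.prod_comp (Equiv.addLeft v)]
      exact Finset.prod_congr rfl fun g _ => by rw [Equiv.coe_addLeft, act_add, act_act]
    have hP1 : P.val (∏ g : E, act ρ g (w : F)) = 1 := by
      rw [map_prod]; exact Finset.prod_eq_one fun g _ => hcon' g
    obtain ⟨p, q, hq, heq⟩ := h.coord.exists_eq_div_of_val_le h.val_lt hfix hP1.le
    have hQ1 : Q.val (∏ g : E, act ρ g (w : F)) < 1 := by
      rw [map_prod, ← Finset.mul_prod_erase _ _ (Finset.mem_univ 0), act_zero]
      refine mul_lt_one_of_lt_of_le hw' (Finset.prod_le_one' fun g _ => ?_)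
      have : (w : F) ∈ orbitRing ρ Q := hPQ ▸ w.2
      exact this g
    rw [heq] at hP1 hQ1
    rw [map_div₀, P.val_aeval_eq_one h.val_lt hq, div_one] at hP1
    rw [map_div₀, Q.val_aeval_eq_one hQ.val_lt hq, div_one] at hQ1
    by_cases hp : p.eval 0 = 0
    · exact absurd hP1 ((P.val_aeval_le_of_eval_zero h.val_lt.le hp).trans_lt h.val_lt).ne
    · exact absurd (Q.val_aeval_eq_one hQ.val_lt hp) hQ1.ne
  -- Prime avoidance selects one translate. The two indices `0` are those for which primality could
  -- have been waived.
  obtain ⟨g, -, hg⟩ := (Ideal.subset_union_prime 0 0 fun g _ _ _ =>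
    Ideal.IsPrime.comap (φ g)).1 hcov
  have hg' : ∀ w ∈ orbitRing ρ P, Q.val w < 1 → P.val (act ρ g w) < 1 := fun w hw hw' =>
    (h𝔭 g ⟨w, hw⟩).1 (hg ((h𝔮 ⟨w, hw⟩).2 hw'))
  refine ⟨g, Point.ext (ValuationSubring.ext _ _ fun x => ?_)⟩
  rw [Q.smul_mem_iff, act_symm, P.mem_iff, Q.mem_iff]
  constructor
  · intro hx
    obtain ⟨c, w, hw, hw1, hcw⟩ := exists_eq_add_inv (ρ := ρ) hx
    have hxw : x = algebraMap ℂ F c + (act ρ g w)⁻¹ := by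
      rw [← act_act ρ g x, hcw, map_add, AlgEquiv.commutes, map_inv₀]
    obtain ⟨d, hd⟩ := hQ.exists_res hw1.le
    have hd0 : d ≠ 0 := by
      rintro rfl
      rw [map_zero, sub_zero, hw1] at hd
      exact lt_irrefl _ hd
    have h1 := hg' (w - algebraMap ℂ F d)
      (Subring.sub_mem _ (hPQ ▸ hw) fun g => by
        rw [AlgEquiv.commutes]; exact P.val_algebraMap_le d) hd
    rw [map_sub, AlgEquiv.commutes] at h1
    rw [hxw]
    refine P.val.map_add_le (P.val_algebraMap_le c) ?_
    rw [map_inv₀, P.val_eq_one_of_val_sub_lt hd0 h1, inv_one]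
  · intro hx
    obtain ⟨c, w, hw, hw1, rfl⟩ := exists_eq_add_inv (ρ := ρ) hx
    rw [map_add, AlgEquiv.commutes, map_inv₀]
    refine Q.val.map_add_le (Q.val_algebraMap_le c) ?_
    have hle : Q.val (act ρ g w) ≤ 1 := (hPQ ▸ hw : w ∈ orbitRing ρ Q) g
    have heq : Q.val (act ρ g w) = 1 := by
      refine hle.eq_of_not_lt fun hlt => ?_
      have := hg' _ (act_mem_orbitRing hw g) hlt
      rw [act_act, hw1] at this
      exact lt_irrefl _ this
    rw [map_inv₀, heq, inv_one]

end IsLocalFrame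

end Local

end

section

open Polynomial

/-! ### Derivations -/

section Derivation

/-- Derivations extend uniquely along formally étale maps; here is existence. -/
theorem exists_derivation_extend {R S T : Type*} [CommRing R] [CommRing S] [CommRing T]
    [Algebra R S] [Algebra R T] [Algebra S T] [IsScalarTower R S T] [Algebra.FormallyEtale S T]
    (d : Derivation R S T) : ∃ D : Derivation R T T, ∀ s, D (algebraMap S T s) = d s := by
  let e := KaehlerDifferential.tensorKaehlerEquivOfFormallyEtale R S T
  let l : T ⊗[S] Ω[S⁄R] →ₗ[T] T := d.liftKaehlerDifferential.liftBaseChange T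
  refine ⟨(l ∘ₗ e.symm.toLinearMap).compDer (KaehlerDifferential.D R T), fun s => ?_⟩
  have : e.symm (KaehlerDifferential.D R T (algebraMap S T s)) = 1 ⊗ₜ KaehlerDifferential.D R S s :=
    KaehlerDifferential.tensorKaehlerEquivOfFormallyEtale_symm_D_algebraMap R S T s
  change l (e.symm (KaehlerDifferential.D R T (algebraMap S T s))) = d s
  rw [this, LinearMap.liftBaseChange_tmul, one_smul, Derivation.liftKaehlerDifferential_comp_D]

/-- A derivation of a field of characteristic zero which vanishes on a subring vanishes on all
elements algebraic over the subring. -/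
theorem Derivation.eq_zero_of_isAlgebraic {R A K M : Type*} [CommRing R] [CommRing A] [Field K]
    [CharZero K] [Algebra R K] [Algebra A K] [FaithfulSMul A K] [AddCommGroup M] [Module K M]
    [Module R M] (D : Derivation R K M) (hD : ∀ a, D (algebraMap A K a) = 0) {x : K}
    (hx : IsAlgebraic A x) : D x = 0 := by
  classical
  have hder : ∀ p : A[X], D (aeval x p) = aeval x (derivative p) • D x := fun p => by
    induction p using Polynomial.induction_on' with
    | add p q hp hq => simp only [map_add, hp, hq, add_smul]
    | monomial n a =>
      rw [aeval_monomial, Derivation.leibniz, hD, smul_zero, add_zero, Derivation.leibniz_pow,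
        derivative_monomial, aeval_monomial, map_mul, map_natCast, mul_smul,
        ← Nat.cast_smul_eq_nsmul K, smul_smul, smul_smul]
  -- A relation of least degree stands in for the minimal polynomial, as `A` is only a ring. By
  -- minimality its derivative does not vanish at `x`.
  have hex : ∃ n, ∃ p : A[X], p ≠ 0 ∧ aeval x p = 0 ∧ p.natDegree = n := by
    obtain ⟨p, hp, hp0⟩ := hx
    exact ⟨_, p, hp, hp0, rfl⟩
  obtain ⟨p, hp, hp0, hpn⟩ := Nat.find_spec hex
  have hinj := FaithfulSMul.algebraMap_injective A K
  have : CharZero A := ⟨fun m n hmn => by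
    have := congrArg (algebraMap A K) hmn
    simpa using this⟩
  have : NoZeroDivisors A := hinj.noZeroDivisors _ (map_zero _) (map_mul _)
  have hdeg : p.natDegree ≠ 0 := fun h0 => by
    rw [eq_C_of_natDegree_eq_zero h0] at hp hp0
    rw [aeval_C] at hp0
    exact hp (by rw [(map_eq_zero_iff _ hinj).1 hp0, C_0])
  have hne : aeval x (derivative p) ≠ 0 := fun h0 => by
    refine Nat.find_min hex (m := (derivative p).natDegree) ?_ ⟨_, ?_, h0, rfl⟩
    · rw [← hpn]; exact natDegree_derivative_lt hdeg
    · intro h; exact hdeg (derivative_eq_zero.1 h)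
  have := hder p
  rw [hp0, map_zero, eq_comm, smul_eq_zero] at this
  exact this.resolve_left hne

open scoped IntermediateField.algebraAdjoinAdjoin in
-- The derivation `d/dt` of `ℂ[t]` extends because `ℂ[t] → ℂ(t)` is a localization and `ℂ(t) → F` is
-- algebraic, hence separable, in characteristic zero; both steps are formally étale.
theorem exists_derivation_of_transcendental {F : Type*} [Field F] [Algebra ℂ F] {t : F}
    (ht : Transcendental ℂ t)
    [Algebra.IsAlgebraic (IntermediateField.adjoin ℂ {t}) F] :
    ∃ D : Derivation ℂ F F, D t = 1 := by
  let e : ℂ[X] ≃ₐ[ℂ] Algebra.adjoin ℂ {t} :=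
    (AlgEquiv.ofInjective (aeval t) (transcendental_iff_injective.1 ht)).trans
      (Subalgebra.equivOfEq _ _ (Algebra.adjoin_singleton_eq_range_aeval ℂ t).symm)
  have he : ∀ p, (e p : F) = aeval t p := fun p => rfl
  have : CharZero F := charZero_of_injective_algebraMap (algebraMap ℂ F).injective
  have : Algebra.FormallyEtale (Algebra.adjoin ℂ {t}) F := by
    have h1 : Algebra.FormallyEtale (Algebra.adjoin ℂ {t}) (IntermediateField.adjoin ℂ {t}) :=
      .of_isLocalization (nonZeroDivisors _)
    have h2 : Algebra.FormallyEtale (IntermediateField.adjoin ℂ {t}) F := .of_isSeparable _ F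
    exact .comp _ (IntermediateField.adjoin ℂ {t}) _
  let d : Derivation ℂ (Algebra.adjoin ℂ {t}) F := Derivation.mk'
    ((aeval t).toLinearMap ∘ₗ derivative ∘ₗ e.symm.toLinearMap) (fun a b => by
      obtain ⟨p, rfl⟩ := e.surjective a
      obtain ⟨q, rfl⟩ := e.surjective b
      simp only [LinearMap.comp_apply, AlgEquiv.toLinearMap_apply, AlgHom.toLinearMap_apply,
        ← map_mul, AlgEquiv.symm_apply_apply, derivative_mul, Algebra.smul_def]
      simp only [Subalgebra.algebraMap_def, he, map_add, map_mul, Algebra.algebraMap_self,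
        RingHom.id_apply]
      ring)
  obtain ⟨D, hD⟩ := exists_derivation_extend d
  refine ⟨D, ?_⟩
  have h1 := hD (e X)
  have h2 : d (e X) = 1 := by
    change aeval t (derivative (e.symm (e X))) = 1
    rw [AlgEquiv.symm_apply_apply]; simp
  rwa [h2, Subalgebra.algebraMap_def, he, aeval_X] at h1

end Derivation

/-! ### Global structure of the cover -/

section Frame

variable {F : Type*} [Field F] [Algebra ℂ F] {ρ : G →* (F ≃ₐ[ℂ] F)} {t : F}

namespace IsCoord

variable (ht : IsCoord ρ t)
include ht

theorem exists_div {x : F} (hx : IsEigen ρ 0 x) :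
    ∃ p q : ℂ[X], q ≠ 0 ∧ x = aeval t p / aeval t q := by
  obtain ⟨p, q, -, h⟩ := ht.exists_coprime hx
  exact ⟨p, q, h⟩

theorem isAlgebraic : Algebra.IsAlgebraic (IntermediateField.adjoin ℂ {t}) F where
  isAlgebraic x := by
    rw [← sum_proj (ρ := ρ) x]
    refine (IsIntegral.sum _ fun c _ => (IsAlgebraic.of_pow two_pos ?_).isIntegral).isAlgebraic
    have := ht.mem_adjoin _ ((isEigen_proj c x).mul_self_fixed (isEigen_proj c x))
    rw [sq]
    exact isAlgebraic_algebraMap (⟨_, this⟩ : IntermediateField.adjoin ℂ {t})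

theorem exists_derivation : ∃ D : Derivation ℂ F F, D t = 1 :=
  have := ht.isAlgebraic
  exists_derivation_of_transcendental ht.transcendental

/-- The quotient rule gives the vanishing on `ℂ(t)`. An isotypic component `y` has `y² ∈ ℂ(t)`, so
`2 y • D y = 0` and `D y = 0`. -/
theorem derivation_eq_zero {M : Type*} [AddCommGroup M] [Module F M] [Module ℂ M]
    (D : Derivation ℂ F M) (hD : D t = 0) : D = 0 := by
  have hpoly : ∀ p : ℂ[X], D (aeval t p) = 0 := fun p => by
    induction p using Polynomial.induction_on' with
    | add p q hp hq => rw [map_add, map_add, hp, hq, add_zero]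
    | monomial n a =>
      rw [aeval_monomial, Derivation.leibniz, Derivation.leibniz_pow, hD, Derivation.map_algebraMap]
      simp
  have hfix : ∀ x, IsEigen ρ 0 x → D x = 0 := fun x hx => by
    obtain ⟨p, q, hq, rfl⟩ := ht.exists_div hx
    rw [Derivation.leibniz_div, hpoly, hpoly]
    simp
  have : CharZero F := charZero_of_injective_algebraMap (algebraMap ℂ F).injective
  ext x
  rw [← sum_proj (ρ := ρ) x, map_sum]
  refine Finset.sum_eq_zero fun c _ => ?_
  by_cases h0 : proj ρ c x = 0
  · rw [h0, map_zero]
  have h := hfix _ ((isEigen_proj c x).mul_self_fixed (isEigen_proj c x))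
  rw [Derivation.leibniz, ← two_smul F, smul_smul, smul_eq_zero] at h
  exact h.resolve_left (mul_ne_zero two_ne_zero h0)

theorem D_eq_smul (D : Derivation ℂ F F) (hD : D t = 1) (x : F) :
    KaehlerDifferential.D ℂ F x = D x • KaehlerDifferential.D ℂ F t := by
  have := ht.derivation_eq_zero (KaehlerDifferential.D ℂ F -
    (LinearMap.toSpanSingleton F _ (KaehlerDifferential.D ℂ F t)).compDer D) (by simp [hD])
  have := DFunLike.congr_fun this x
  simpa [sub_eq_zero] using this

theorem exists_eq_smul (ω : Ω[F⁄ℂ]) : ∃ x : F, ω = x • KaehlerDifferential.D ℂ F t := by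
  obtain ⟨D, hD⟩ := ht.exists_derivation
  have : ω ∈ Submodule.span F (Set.range (KaehlerDifferential.D ℂ F)) := by
    rw [KaehlerDifferential.span_range_derivation]; trivial
  induction this using Submodule.span_induction with
  | mem ω h => obtain ⟨x, rfl⟩ := h; exact ⟨_, ht.D_eq_smul D hD x⟩
  | zero => exact ⟨0, by simp⟩
  | add ω η _ _ h1 h2 =>
    obtain ⟨x, rfl⟩ := h1
    obtain ⟨y, rfl⟩ := h2
    exact ⟨x + y, by rw [add_smul]⟩
  | smul r ω _ h =>
    obtain ⟨x, rfl⟩ := h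
    exact ⟨r * x, by rw [mul_smul]⟩

theorem smul_D_injective {x y : F}
    (h : x • KaehlerDifferential.D ℂ F t = y • KaehlerDifferential.D ℂ F t) : x = y := by
  obtain ⟨D, hD⟩ := ht.exists_derivation
  simpa [hD] using congrArg D.liftKaehlerDifferential h

/-- Among the nonzero eigenfunctions whose square is a polynomial in `t`, take one with the square
of least degree: a nonconstant square factor `d²` could be removed by dividing the eigenfunction by
`d`. -/
theorem exists_frame_at (hρ : Function.Injective ρ) (c : E) :
    ∃ (y : F) (f : ℂ[X]), IsEigen ρ c y ∧ Squarefree f ∧ y ^ 2 = aeval t f := by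
  classical
  have hex : ∃ n, ∃ (y : F) (f : ℂ[X]), y ≠ 0 ∧ IsEigen ρ c y ∧ y ^ 2 = aeval t f ∧
      f.natDegree = n := by
    obtain ⟨x, hx0, hx⟩ := exists_isEigen_ne_zero hρ c
    obtain ⟨p, q, hq, hpq⟩ := ht.exists_div (hx.mul_self_fixed hx)
    have hq0 := ht.aeval_ne_zero hq
    -- If `x² = p / q`, then `(q x)² = p q` is a polynomial.
    refine ⟨_, aeval t q * x, p * q, mul_ne_zero hq0 hx0, (ht.aeval_fixed q).fixed_mul hx, ?_, rfl⟩
    rw [eq_div_iff hq0] at hpq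
    rw [map_mul]
    linear_combination aeval t q * hpq
  obtain ⟨y, f, hy0, hy, hyf, hn⟩ := Nat.find_spec hex
  refine ⟨y, f, hy, fun d ⟨e, hde⟩ => ?_, hyf⟩
  have hf0 : f ≠ 0 := by
    rintro rfl
    rw [map_zero] at hyf
    exact hy0 (pow_eq_zero_iff two_ne_zero |>.1 hyf)
  have hd : d ≠ 0 := by rintro rfl; simp [hde] at hf0
  have he : e ≠ 0 := by rintro rfl; simp [hde] at hf0
  have hdt := ht.aeval_ne_zero hd
  have hmin := Nat.find_min' hex ⟨(aeval t d)⁻¹ * y, e, mul_ne_zero (inv_ne_zero hdt) hy0,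
    (ht.aeval_fixed d).inv.fixed_mul hy, by
      rw [mul_pow, hyf, hde]; simp only [map_mul]; field_simp, rfl⟩
  rw [← hn, hde, natDegree_mul (mul_ne_zero hd hd) he, natDegree_mul hd hd] at hmin
  exact isUnit_iff_degree_eq_zero.2 (by
    rw [degree_eq_natDegree hd, show d.natDegree = 0 by omega]; rfl)

end IsCoord

variable (ρ t) in
/-- Eigenfunctions whose squares are squarefree polynomials in the coordinate `t`. -/
structure IsFrame (Y : E → F) (f : E → ℂ[X]) : Prop where
  coord : IsCoord ρ t
  isEigen : ∀ c, IsEigen ρ c (Y c)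
  squarefree : ∀ c, Squarefree (f c)
  sq_eq : ∀ c, Y c ^ 2 = aeval t (f c)

theorem IsCoord.exists_isFrame (ht : IsCoord ρ t) (hρ : Function.Injective ρ) :
    ∃ Y f, IsFrame ρ t Y f := by
  choose Y f h using ht.exists_frame_at hρ
  exact ⟨Y, f, ht, fun c => (h c).1, fun c => (h c).2.1, fun c => (h c).2.2⟩

theorem Point.val_aeval_eq_one_of_eval_ne {P : Point F} {a : ℂ}
    (hP : P.val (t - algebraMap ℂ F a) < 1) {p : ℂ[X]} (hp : p.eval a ≠ 0) :
    P.val (aeval t p) = 1 := by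
  have := P.val_aeval_eq_one hP (p := p.comp (X + C a)) (by simpa [eval_comp] using hp)
  rwa [aeval_comp, map_add, aeval_X, aeval_C, sub_add_cancel] at this

theorem exists_eq_mul_of_isRoot {f : ℂ[X]} (hf : Squarefree f) {a : ℂ} (ha : f.eval a = 0) :
    ∃ h : ℂ[X], f = (X - C a) * h ∧ h.eval a ≠ 0 := by
  obtain ⟨h, rfl⟩ := dvd_iff_isRoot.2 ha
  refine ⟨h, rfl, fun h0 => ?_⟩
  obtain ⟨k, rfl⟩ := dvd_iff_isRoot.2 h0
  exact not_isUnit_X_sub_C a (hf (X - C a) ⟨k, by ring⟩)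

namespace IsFrame

variable {Y : E → F} {f : E → ℂ[X]} (h : IsFrame ρ t Y f)
include h

theorem ne_zero (c : E) : Y c ≠ 0 := by
  intro h0
  have := h.sq_eq c
  rw [h0, zero_pow two_ne_zero] at this
  exact h.coord.aeval_ne_zero (h.squarefree c).ne_zero this.symm

theorem val_eq_one {P : Point F} {a : ℂ} (hP : P.val (t - algebraMap ℂ F a) < 1) {c : E}
    (hc : (f c).eval a ≠ 0) : P.val (Y c) = 1 := by
  have := Point.val_aeval_eq_one_of_eval_ne hP hc
  rw [← h.sq_eq, map_pow] at this
  exact (pow_eq_one_iff.1 this).resolve_right two_ne_zero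

theorem val_sq_eq {P : Point F} {a : ℂ} (hP : P.val (t - algebraMap ℂ F a) < 1) {c : E}
    (hc : (f c).eval a = 0) : P.val (Y c) ^ 2 = P.val (t - algebraMap ℂ F a) := by
  obtain ⟨k, hk, hka⟩ := exists_eq_mul_of_isRoot (h.squarefree c) hc
  rw [← map_pow, h.sq_eq, hk, map_mul, map_mul, Point.val_aeval_eq_one_of_eval_ne hP hka, mul_one,
    map_sub, aeval_X, aeval_C]

theorem isLocalFrame {P : Point F} {a : ℂ} (hP : P.val (t - algebraMap ℂ F a) < 1) :
    IsLocalFrame ρ (t - algebraMap ℂ F a) P Y where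
  coord := h.coord.sub_const a
  val_lt := hP
  isEigen := h.isEigen
  val_cases c := by
    by_cases hc : (f c).eval a = 0
    · exact Or.inr (h.val_sq_eq hP hc)
    · exact Or.inl (h.val_eq_one hP hc)

/-- The frame is global, and whether `Y c` vanishes over `t = a` depends only on whether `a` is a
root of `f c`. So the vector found at one point over `a` serves for all of them. -/
theorem exists_monodromy (a : ℂ) : ∃ g : E,
    (∀ c : E, c ⬝ᵥ g = 1 ↔ (f c).eval a = 0) ∧
    ∀ P : Point F, P.val (t - algebraMap ℂ F a) < 1 →
      stab ρ P = Subgroup.zpowers (Multiplicative.ofAdd g) := by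
  obtain ⟨P, hP⟩ := Point.exists_val_lt_one (h.coord.sub_const a).transcendental
  obtain ⟨g, hg⟩ := (h.isLocalFrame hP).exists_dotProduct_eq
  have hg' : ∀ c : E, c ⬝ᵥ g = 1 ↔ (f c).eval a = 0 := fun c => by
    rcases hg c with ⟨h0, h1⟩ | ⟨h0, h1⟩
    · rw [h0]
      refine ⟨fun h => absurd h (by decide), fun hc => ?_⟩
      exact absurd h1 ((h.isLocalFrame hP).val_lt_of_sq (h.val_sq_eq hP hc)).ne
    · refine ⟨fun _ => ?_, fun _ => h0⟩
      by_contra hc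
      exact ((h.isLocalFrame hP).val_lt_of_sq h1).ne (h.val_eq_one hP hc)
  refine ⟨g, hg', fun Q hQ => (h.isLocalFrame hQ).stab_eq fun c => ?_⟩
  by_cases hc : (f c).eval a = 0
  · exact Or.inr ⟨(hg' c).2 hc, h.val_sq_eq hQ hc⟩
  · exact Or.inl ⟨(zmod_two_cases _).resolve_right (fun h1 => hc ((hg' c).1 h1)),
      h.val_eq_one hQ hc⟩

/-- If `t` had no value in `ℂ`, every `t - a`, hence every nonzero polynomial in `t`, would be a
unit. Then `ℂ(t)` would consist of regular functions, and so would `F`, whose isotypic components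
have squares in `ℂ(t)`; but the valuation ring of a point is proper. -/
theorem exists_val_sub_lt {P : Point F} (hP : P.val t ≤ 1) :
    ∃ a : ℂ, P.val (t - algebraMap ℂ F a) < 1 := by
  by_contra! hcon
  have h1 : ∀ a, P.val (t - algebraMap ℂ F a) = 1 := fun a =>
    le_antisymm (P.val.map_sub_le hP (P.val_algebraMap_le a)) (hcon a)
  have h2 : ∀ p : ℂ[X], p ≠ 0 → P.val (aeval t p) = 1 := fun p hp => by
    rw [(IsAlgClosed.splits p).eq_prod_roots, map_mul, aeval_C, map_mul,
      P.val_algebraMap (leadingCoeff_ne_zero.2 hp), one_mul, map_multiset_prod, map_multiset_prod,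
      Multiset.map_map, Multiset.map_map]
    refine Multiset.prod_eq_one fun x hx => ?_
    obtain ⟨a, -, rfl⟩ := Multiset.mem_map.1 hx
    simpa using h1 a
  have h3 : ∀ x, IsEigen ρ 0 x → P.val x ≤ 1 := fun x hx => by
    obtain ⟨p, q, hq, rfl⟩ := h.coord.exists_div hx
    rw [map_div₀, h2 q hq, div_one]
    exact P.val_aeval_le hP p
  refine P.ne_top (eq_top_iff.2 fun x _ => P.mem_iff.2 ?_)
  rw [← sum_proj (ρ := ρ) x]
  refine P.val.map_sum_le fun c _ => ?_
  have := h3 _ ((isEigen_proj c x).mul_self_fixed (isEigen_proj c x))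
  rw [map_mul, ← sq] at this
  exact (pow_le_one_iff two_ne_zero).1 this

end IsFrame

end Frame

end

section

open Polynomial

/-! ### Branch points and differentials -/

section Global

variable {F : Type*} [Field F] [Algebra ℂ F] {ρ : G →* (F ≃ₐ[ℂ] F)} {t : F}

variable (ρ t) in
/-- A frame with respect to a coordinate `t` such that `t = ∞` is not a branch point; `Z` is a local
frame at infinity. -/
structure IsFrameUnramifiedAtInfty (Y : E → F) (f : E → ℂ[X]) (Z : E → F) : Prop
    extends IsFrame ρ t Y f where
  localFrame : ∀ P : Point F, P.val t⁻¹ < 1 → IsLocalFrame ρ t⁻¹ P Z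
  val_eq_one_infty : ∀ P : Point F, P.val t⁻¹ < 1 → ∀ c, P.val (Z c) = 1

/-- Take any coordinate `s`, a value `a` that is a root of none of the polynomials belonging to `s`,
and `t = 1 / (s - a)`. The frame for `s` then consists of units over `t = ∞`. -/
theorem IsGaloisCoverOfLine.exists_frame (h : IsGaloisCoverOfLine ρ) :
    ∃ t Y f Z, IsFrameUnramifiedAtInfty ρ t Y f Z := by
  obtain ⟨s, hs⟩ := h.exists_isCoord
  obtain ⟨Z, k, hZ⟩ := hs.exists_isFrame h.faithful
  have hfin : (⋃ c : E, {a : ℂ | (k c).IsRoot a}).Finite :=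
    Set.finite_iUnion fun c => finite_setOfPred_isRoot (hZ.squarefree c).ne_zero
  obtain ⟨a, ha⟩ := hfin.exists_notMem
  simp only [Set.mem_iUnion, Set.mem_ofPred_eq, not_exists] at ha
  have ht := (hs.sub_const a).inv
  obtain ⟨Y, f, hY⟩ := ht.exists_isFrame h.faithful
  refine ⟨_, Y, f, Z, hY, fun P hP => ?_, fun P hP c => ?_⟩
  · rw [inv_inv] at hP ⊢
    exact hZ.isLocalFrame hP
  · rw [inv_inv] at hP
    exact hZ.val_eq_one hP (ha c)

namespace IsFrameUnramifiedAtInfty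

variable {Y Z : E → F} {f : E → ℂ[X]} (h : IsFrameUnramifiedAtInfty ρ t Y f Z)
include h

theorem stab_eq_bot {P : Point F} (hP : P.val t⁻¹ < 1) : stab ρ P = ⊥ := by
  rw [(h.localFrame P hP).stab_eq (g := 0) fun c => Or.inl ⟨by simp, h.val_eq_one_infty P hP c⟩]
  simp

theorem exists_point_infty : ∃ P : Point F, P.val t⁻¹ < 1 :=
  Point.exists_val_lt_one h.coord.inv.transcendental

theorem val_inv_lt_or (P : Point F) :
    P.val t⁻¹ < 1 ∨ ∃ a : ℂ, P.val (t - algebraMap ℂ F a) < 1 := by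
  rcases le_or_gt (P.val t) 1 with h1 | h1
  · exact Or.inr (h.exists_val_sub_lt h1)
  · left
    rw [map_inv₀]
    exact inv_lt_one_of_one_lt₀ h1

omit h in
theorem one_lt_val {P : Point F} (hP : P.val t⁻¹ < 1) (ht : t ≠ 0) : 1 < P.val t := by
  rw [map_inv₀] at hP
  exact (inv_lt_one₀ (zero_lt_iff.2 ((Valuation.ne_zero_iff _).2 ht))).1 hP

/-- Up to the factor `t ^ natDegree`, the polynomial is its reverse evaluated at `t⁻¹`, with the
leading coefficient as nonzero value. -/
theorem val_aeval_infty {P : Point F} (hP : P.val t⁻¹ < 1) {p : ℂ[X]} (hp : p ≠ 0) :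
    P.val (aeval t p) = P.val t ^ p.natDegree := by
  have ht := h.coord.ne_zero
  have h1 : P.val (aeval t⁻¹ p.reverse) = 1 := P.val_aeval_eq_one hP (by
    rw [← coeff_zero_eq_eval_zero, coeff_zero_reverse]
    exact leadingCoeff_ne_zero.2 hp)
  let := invertibleOfNonzero ht
  have h2 := eval₂_reverse_mul_pow (algebraMap ℂ F) t p
  rw [invOf_eq_inv, ← aeval_def, ← aeval_def] at h2
  rw [← h2, map_mul, h1, one_mul, map_pow]

/-- As `∞` is not a branch point, the order of `Y c` there is that of the invariant function `Y c /
Z c`, an integral multiple of the order of `t`. But `Y c ^ 2` has order `deg f c` times that of `t`.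
-/
theorem even_natDegree (c : E) : Even (f c).natDegree := by
  obtain ⟨P, hP⟩ := h.exists_point_infty
  rw [← Nat.not_odd_iff_even]
  rintro ⟨m, hm⟩
  have hfix : IsEigen ρ 0 (t⁻¹ ^ m * (Y c / Z c)) := by
    have h1 := h.coord.inv.aeval_fixed (X ^ m)
    rw [map_pow, aeval_X] at h1
    exact h1.fixed_mul ((h.isEigen c).div_fixed ((h.localFrame P hP).isEigen c))
  refine (h.localFrame P hP).coord.val_mul_sq_ne_one hP hfix ?_
  have ht0 : P.val t ≠ 0 := (Valuation.ne_zero_iff _).2 h.coord.ne_zero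
  have h2 : P.val (Y c) ^ 2 = P.val t ^ (2 * m + 1) := by
    rw [← map_pow, h.sq_eq, h.val_aeval_infty hP (h.squarefree c).ne_zero, hm]
  rw [map_mul, map_div₀, h.val_eq_one_infty P hP, div_one, mul_pow, h2, map_pow, map_inv₀]
  rw [inv_pow, inv_pow, ← pow_mul, mul_comm m 2, pow_succ,
    inv_mul_cancel_left₀ (pow_ne_zero _ ht0), inv_mul_cancel₀ ht0]

/-- The order of the eigenfunction `Y c` at infinity. -/
theorem val_frame_infty {P : Point F} (hP : P.val t⁻¹ < 1) (c : E) :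
    P.val (Y c) = P.val t ^ ((f c).natDegree / 2) := by
  have h2 : P.val (Y c) ^ 2 = (P.val t ^ ((f c).natDegree / 2)) ^ 2 := by
    rw [← map_pow, h.sq_eq, h.val_aeval_infty hP (h.squarefree c).ne_zero, ← pow_mul,
      Nat.div_mul_cancel (h.even_natDegree c).two_dvd]
  exact (pow_left_inj₀ zero_le zero_le two_ne_zero).1 h2

theorem D_inv : KaehlerDifferential.D ℂ F t =
    (-t ^ 2) • KaehlerDifferential.D ℂ F t⁻¹ := by
  rw [Derivation.leibniz_inv, smul_smul]
  have := h.coord.ne_zero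
  rw [show -t ^ 2 * -t⁻¹ ^ 2 = 1 by field_simp, one_smul]

/-- The product `x * Y c` is rational in `t`. Regularity at the finite points removes all its poles,
so it is a polynomial `p`. At infinity `dt = -t² d(1/t)`, and regularity of `t² p / Y c` means `deg
p + 2 ≤ deg f c / 2`. The truncated subtraction is harmless: it gives the zero space when no degree
is allowed. -/
theorem exists_polynomial_of_regular {c : E} {x : F} (hx : IsEigen ρ c x)
    (hreg : x • KaehlerDifferential.D ℂ F t ∈ regularDiff F) :
    ∃ p ∈ degreeLT ℂ ((f c).natDegree / 2 - 1), x = aeval t p / Y c := by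
  obtain ⟨D, hD⟩ := h.coord.exists_derivation
  have hfix : IsEigen ρ 0 (x * Y c) := hx.mul_self_fixed (h.isEigen c)
  obtain ⟨p, q, hpq, hq, hpq'⟩ := h.coord.exists_coprime hfix
  have hroot : ∀ a, q.eval a ≠ 0 := fun a hqa => by
    obtain ⟨P, hP⟩ := Point.exists_val_lt_one (h.coord.sub_const a).transcendental
    have hpa : p.eval a ≠ 0 := fun hpa => by
      obtain ⟨u, v, huv⟩ := hpq
      simpa [hpa, hqa] using congrArg (eval a) huv
    have h1 := (h.isLocalFrame hP).val_mul_le_of_regular (D := D) (by simp [hD]) hx (by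
      rw [map_sub, Derivation.map_algebraMap, sub_zero]; exact hreg P)
    obtain ⟨r, rfl⟩ := dvd_iff_isRoot.2 hqa
    rw [hpq', map_div₀, Point.val_aeval_eq_one_of_eval_ne hP hpa, one_div,
      inv_le_one₀ (zero_lt_iff.2 ((Valuation.ne_zero_iff _).2 (h.coord.aeval_ne_zero hq))),
      map_mul, map_mul] at h1
    have h2 : P.val (aeval t (X - C a)) < 1 := by simpa using hP
    have h3 : P.val (aeval t r) ≤ 1 := P.val_aeval_le (Point.res_val_le hP) r
    exact absurd h1 (not_le.2 (mul_lt_one_of_lt_of_le h2 h3))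
  have hq0 : q.degree = 0 := by
    by_contra hdeg
    obtain ⟨a, ha⟩ := IsAlgClosed.exists_root q hdeg
    exact hroot a ha
  obtain ⟨u, rfl⟩ : ∃ u, q = C u := ⟨_, eq_C_of_degree_eq_zero hq0⟩
  have hu : u ≠ 0 := by rintro rfl; simp at hq
  have hxY : x * Y c = aeval t (C u⁻¹ * p) := by
    rw [hpq', map_mul, aeval_C, aeval_C, map_inv₀, div_eq_inv_mul]
  generalize C u⁻¹ * p = r at hxY
  have hxr : x = aeval t r / Y c := by rw [← hxY, mul_div_cancel_right₀ _ (h.ne_zero c)]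
  refine ⟨r, ?_, hxr⟩
  by_cases hr : r = 0
  · rw [hr]; exact Submodule.zero_mem _
  rw [mem_degreeLT, degree_eq_natDegree hr, Nat.cast_lt]
  obtain ⟨P, hP⟩ := h.exists_point_infty
  have ht1 := one_lt_val hP h.coord.ne_zero
  have ht0 := h.coord.ne_zero
  have hreg' := hreg P
  rw [h.D_inv, smul_smul] at hreg'
  have heig : IsEigen ρ c (x * -t ^ 2) := by
    have h1 := h.coord.aeval_fixed (-X ^ 2)
    rw [map_neg, map_pow, aeval_X] at h1
    rw [mul_comm]
    exact h1.fixed_mul hx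
  -- The derivation normalized by the coordinate `t⁻¹` is `-t² D`.
  have hle := (h.localFrame P hP).val_mul_le_of_regular (D := (-t ^ 2) • D)
    (by rw [Derivation.smul_apply, Derivation.leibniz_inv, hD, smul_smul, smul_eq_mul, mul_one]
        field_simp) heig hreg'
  rw [map_mul, h.val_eq_one_infty P hP, mul_one, map_mul, Valuation.map_neg, map_pow, hxr,
    map_div₀, h.val_frame_infty hP, h.val_aeval_infty hP hr, div_mul_eq_mul_div,
    div_le_one₀ (pow_pos (zero_lt_one.trans ht1) _), ← pow_add] at hle
  have := (pow_le_pow_iff_right₀ ht1).1 hle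
  omega

/-- At a root of `f c`, use `Y c` in place of `t`: from `2 Y dY = f' dt` one gets `p dt / Y = (2p /
f') dY`, and `f'` does not vanish there because the root is simple. At the other finite points `Y c`
is a unit; at infinity the degree bound is used. -/
theorem regular_of_mem_degreeLT {c : E} {p : ℂ[X]}
    (hp : p ∈ degreeLT ℂ ((f c).natDegree / 2 - 1)) :
    (aeval t p / Y c) • KaehlerDifferential.D ℂ F t ∈ regularDiff F := by
  intro P
  have mem : ∀ x a : F, P.val x ≤ 1 → P.val a ≤ 1 → x • KaehlerDifferential.D ℂ F a ∈
      Submodule.span P.ring {η | ∃ a ∈ P.ring, η = KaehlerDifferential.D ℂ F a} :=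
    fun x a hx ha => Submodule.smul_mem _ (⟨x, P.mem_iff.2 hx⟩ : P.ring)
      (Submodule.subset_span ⟨a, P.mem_iff.2 ha, rfl⟩)
  by_cases hp0 : p = 0
  · simp [hp0]
  rcases h.val_inv_lt_or P with hP | ⟨a, hP⟩
  · have ht1 := one_lt_val hP h.coord.ne_zero
    rw [h.D_inv, smul_smul]
    refine mem _ _ ?_ hP.le
    rw [map_mul, Valuation.map_neg, map_pow, map_div₀, h.val_frame_infty hP,
      h.val_aeval_infty hP hp0, div_mul_eq_mul_div, div_le_one₀ (pow_pos (zero_lt_one.trans ht1) _),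
      ← pow_add, pow_le_pow_iff_right₀ ht1]
    rw [mem_degreeLT, degree_eq_natDegree hp0, Nat.cast_lt] at hp
    omega
  · have ht1 : P.val t ≤ 1 := Point.res_val_le hP
    by_cases hc : (f c).eval a = 0
    · obtain ⟨k, hk, hka⟩ := exists_eq_mul_of_isRoot (h.squarefree c) hc
      have hd : (derivative (f c)).eval a ≠ 0 := by
        rw [hk, derivative_mul]; simpa using hka
      have hd1 := Point.val_aeval_eq_one_of_eval_ne hP hd
      have hd0 : aeval t (derivative (f c)) ≠ 0 := (Valuation.ne_zero_iff P.val).1 (by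
        rw [hd1]; exact one_ne_zero)
      have hY := h.ne_zero c
      have hdY : (2 * Y c) • KaehlerDifferential.D ℂ F (Y c) =
          aeval t (derivative (f c)) • KaehlerDifferential.D ℂ F t := by
        rw [← Derivation.map_aeval, ← h.sq_eq, Derivation.leibniz_pow, ← Nat.cast_smul_eq_nsmul F,
          smul_smul]
        simp
      have : (aeval t p / Y c) • KaehlerDifferential.D ℂ F t =
          (2 * aeval t p / aeval t (derivative (f c))) • KaehlerDifferential.D ℂ F (Y c) := by
        rw [show aeval t p / Y c = aeval t p / (Y c * aeval t (derivative (f c))) *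
          aeval t (derivative (f c)) by field_simp, mul_smul, ← hdY, smul_smul]
        congr 1
        field_simp
      rw [this]
      refine mem _ _ ?_ ((h.isLocalFrame hP).val_le c)
      rw [map_div₀, hd1, div_one, map_mul, ← map_ofNat (algebraMap ℂ F) 2,
        P.val_algebraMap two_ne_zero, one_mul]
      exact P.val_aeval_le ht1 p
    · refine mem _ _ ?_ ht1
      rw [map_div₀, h.val_eq_one hP hc, div_one]
      exact P.val_aeval_le ht1 p

theorem mem_eigenDiff_iff {c : E} {x : F} :
    x • KaehlerDifferential.D ℂ F t ∈ eigenDiff ρ (dotProductEquiv (ZMod 2) (Fin 3) c) ↔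
      x • KaehlerDifferential.D ℂ F t ∈ regularDiff F ∧ IsEigen ρ c x := by
  have hD : ∀ v, diffMap (act ρ v) (x • KaehlerDifferential.D ℂ F t) =
      act ρ v x • KaehlerDifferential.D ℂ F t := fun v => by
    rw [diffMap_smul_D, isEigen_zero_iff.1 h.coord.fixed]
  rw [eigenDiff, Submodule.mem_inf, Submodule.mem_iInf]
  refine and_congr_right fun _ => forall_congr' fun v => ?_
  rw [LinearMap.mem_ker, LinearMap.sub_apply, hD, sub_eq_zero, LinearMap.smul_apply,
    LinearMap.id_apply, ← smul_assoc]
  exact ⟨fun h1 => h.coord.smul_D_injective h1, fun h1 => by rw [h1]; rfl⟩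

/-- The isotypic components of `H⁰(C, K_C)` are spaces of polynomials. -/
theorem exists_eigenDiff_equiv (c : E) :
    Nonempty (degreeLT ℂ ((f c).natDegree / 2 - 1) ≃ₗ[ℂ]
      eigenDiff ρ (dotProductEquiv (ZMod 2) (Fin 3) c)) := by
  let Φ : degreeLT ℂ ((f c).natDegree / 2 - 1) →ₗ[ℂ] Ω[F⁄ℂ] :=
    { toFun := fun p => (aeval t (p : ℂ[X]) / Y c) • KaehlerDifferential.D ℂ F t
      map_add' := fun p q => by
        rw [Submodule.coe_add, map_add, add_div, add_smul]
      map_smul' := fun r p => by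
        rw [Submodule.coe_smul, map_smul, RingHom.id_apply, smul_div_assoc, smul_assoc] }
  have hΦ : ∀ p, Φ p = (aeval t (p : ℂ[X]) / Y c) • KaehlerDifferential.D ℂ F t := fun _ => rfl
  have hinj : Function.Injective Φ := fun p q hpq => by
    have h1 := h.coord.smul_D_injective hpq
    rw [div_left_inj' (h.ne_zero c)] at h1
    exact Subtype.ext (transcendental_iff_injective.1 h.coord.transcendental h1)
  have hrange : LinearMap.range Φ = eigenDiff ρ (dotProductEquiv (ZMod 2) (Fin 3) c) := by
    ext ω
    constructor
    · rintro ⟨p, rfl⟩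
      rw [hΦ, h.mem_eigenDiff_iff]
      refine ⟨h.regular_of_mem_degreeLT p.2, ?_⟩
      rw [div_eq_mul_inv]
      exact (h.coord.aeval_fixed _).fixed_mul (h.isEigen c).inv
    · intro hω
      obtain ⟨x, rfl⟩ := h.coord.exists_eq_smul ω
      obtain ⟨h1, h2⟩ := h.mem_eigenDiff_iff.1 hω
      obtain ⟨p, hp, rfl⟩ := h.exists_polynomial_of_regular h2 h1
      exact ⟨⟨p, hp⟩, rfl⟩
  exact ⟨(LinearEquiv.ofInjective Φ hinj).trans (LinearEquiv.ofEq _ _ hrange)⟩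

theorem finrank_eigenDiff (c : E) :
    Module.finrank ℂ (eigenDiff ρ (dotProductEquiv (ZMod 2) (Fin 3) c)) =
      (f c).natDegree / 2 - 1 := by
  obtain ⟨e⟩ := h.exists_eigenDiff_equiv c
  rw [← e.finrank_eq, (degreeLTEquiv ℂ _).finrank_eq, Module.finrank_fin_fun]

theorem finite_eigenDiff (c : E) :
    Module.Finite ℂ (eigenDiff ρ (dotProductEquiv (ZMod 2) (Fin 3) c)) := by
  obtain ⟨e⟩ := h.exists_eigenDiff_equiv c
  exact Module.Finite.equiv ((degreeLTEquiv ℂ _).symm.trans e)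

/-- If `f c` were constant, `Y c` would be a square root of a constant, hence itself a constant.
Then `G` would fix it, contrary to the nontriviality of the character. This is how connectedness of
the curve enters. -/
theorem natDegree_pos {c : E} (hc : c ≠ 0) : 0 < (f c).natDegree := by
  rw [Nat.pos_iff_ne_zero]
  intro h0
  have h1 := h.sq_eq c
  rw [eq_C_of_natDegree_eq_zero h0, aeval_C] at h1
  obtain ⟨d, hd⟩ := IsAlgClosed.exists_eq_mul_self ((f c).coeff 0)
  rw [hd, map_mul, ← sq, sq_eq_sq_iff_eq_or_eq_neg, ← map_neg] at h1
  obtain ⟨e, he⟩ : ∃ e, Y c = algebraMap ℂ F e := h1.elim (fun h => ⟨_, h⟩) fun h => ⟨_, h⟩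
  have hdual : ∀ c : E, c ≠ 0 → ∃ v : E, c ⬝ᵥ v = 1 := by decide
  obtain ⟨v, hv⟩ := hdual c hc
  have h2 := h.isEigen c v
  have hY := h.ne_zero c
  rw [hv, he, AlgEquiv.commutes, ← he, sgn_one, neg_one_smul] at h2
  have : CharZero F := charZero_of_injective_algebraMap (algebraMap ℂ F).injective
  exact hY (self_eq_neg.1 h2)

end IsFrameUnramifiedAtInfty

end Global

end

section

open Polynomial

/-! ### Counting branch points -/

section Count

variable {F : Type*} [Field F] [Algebra ℂ F] {ρ : G →* (F ≃ₐ[ℂ] F)} {t : F}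

theorem eq_zero_or_eq_of_mem_zpowers {v w : E}
    (h : Multiplicative.ofAdd v ∈ Subgroup.zpowers (Multiplicative.ofAdd w)) :
    v = 0 ∨ v = w := by
  obtain ⟨n, hn⟩ := h
  have hn' : n • w = v := hn
  rcases Int.even_or_odd' n with ⟨k, rfl | rfl⟩
  · left
    rw [← hn', mul_comm, mul_smul, two_smul, add_self_eq_zero_E, smul_zero]
  · right
    rw [← hn', add_smul, mul_comm, mul_smul, two_smul, add_self_eq_zero_E, smul_zero, zero_add,
      one_smul]

theorem zpowers_ofAdd_injective {v w : E} (h : Subgroup.zpowers (Multiplicative.ofAdd v) =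
    Subgroup.zpowers (Multiplicative.ofAdd w)) : v = w := by
  rcases eq_zero_or_eq_of_mem_zpowers (h ▸ Subgroup.mem_zpowers (Multiplicative.ofAdd v))
    with h1 | h1
  · rcases eq_zero_or_eq_of_mem_zpowers (h ▸ Subgroup.mem_zpowers (Multiplicative.ofAdd w))
      with h2 | h2
    · rw [h1, h2]
    · exact h2.symm
  · exact h1

namespace IsFrameUnramifiedAtInfty

variable {Y Z : E → F} {f : E → ℂ[X]} (h : IsFrameUnramifiedAtInfty ρ t Y f Z)

/-- The local monodromy of the cover at the point `t = a`. -/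
def mon (a : ℂ) : E := (h.exists_monodromy a).choose

theorem dotProduct_mon_eq_one_iff (a : ℂ) (c : E) : c ⬝ᵥ h.mon a = 1 ↔ (f c).eval a = 0 :=
  (h.exists_monodromy a).choose_spec.1 c

theorem stab_eq_zpowers {P : Point F} {a : ℂ} (hP : P.val (t - algebraMap ℂ F a) < 1) :
    stab ρ P = Subgroup.zpowers (Multiplicative.ofAdd (h.mon a)) :=
  (h.exists_monodromy a).choose_spec.2 P hP

include h in
theorem act_smul_val_sub_lt {P : Point F} {a : ℂ} (g : E)
    (hP : P.val (t - algebraMap ℂ F a) < 1) : (act ρ g • P).val (t - algebraMap ℂ F a) < 1 := by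
  rw [P.smul_val_lt_one_iff, act_symm, map_sub, AlgEquiv.commutes,
    isEigen_zero_iff.1 h.coord.fixed]
  exact hP

/-- Branch points, distinguished by a property of their stabilizer, correspond to values of `t`. -/
theorem card_quotientPoint (S : Subgroup G → Prop) (hS : ¬ S ⊥) :
    Nat.card {Q : QuotientPoint ρ // ∃ P : Point F, Quotient.mk _ P = Q ∧ S (stab ρ P)} =
      Nat.card {a : ℂ // S (Subgroup.zpowers (Multiplicative.ofAdd (h.mon a)))} := by
  have hex : ∀ a, ∃ P : Point F, P.val (t - algebraMap ℂ F a) < 1 := fun a =>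
    Point.exists_val_lt_one (h.coord.sub_const a).transcendental
  choose pt hpt using hex
  refine (Nat.card_congr (Equiv.ofBijective
    (fun a => ⟨Quotient.mk _ (pt a.1), pt a.1, rfl, by
      rw [h.stab_eq_zpowers (hpt a.1)]; exact a.2⟩) ⟨?_, ?_⟩)).symm
  -- The value of `t` is constant on orbits.
  · rintro ⟨a, ha⟩ ⟨b, hb⟩ hab
    have h1 : Quotient.mk (MulAction.orbitRel ρ.range (Point F)) (pt a) = Quotient.mk _ (pt b) :=
      congrArg Subtype.val hab
    obtain ⟨⟨_, g, rfl⟩, hg⟩ := Quotient.exact h1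
    have h2 := h.act_smul_val_sub_lt (Multiplicative.toAdd g) (hpt b)
    have hg' : act ρ (Multiplicative.toAdd g) • pt b = pt a := hg
    rw [hg'] at h2
    exact Subtype.ext ((pt a).eq_of_val_sub_lt (hpt a) h2)
  -- Points at infinity have trivial stabilizer and are excluded by `hS`; over a finite value `G`
  -- acts transitively.
  · rintro ⟨Q, P, rfl, hP⟩
    rcases h.val_inv_lt_or P with h1 | ⟨a, ha⟩
    · rw [h.stab_eq_bot h1] at hP
      exact absurd hP hS
    · have hstab := hP
      rw [h.stab_eq_zpowers ha] at hstab
      refine ⟨⟨a, hstab⟩, Subtype.ext (Quotient.sound ?_)⟩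
      obtain ⟨g, hg⟩ := (h.isLocalFrame (hpt a)).exists_act_smul_eq (h.isLocalFrame ha)
      exact ⟨⟨act ρ g, _, rfl⟩, hg⟩

theorem finite_mon_ne_zero : {a : ℂ | h.mon a ≠ 0}.Finite := by
  have hdual : ∀ v : E, v ≠ 0 → ∃ c : E, c ⬝ᵥ v = 1 := by decide
  refine (Set.finite_iUnion fun c : E =>
    finite_setOfPred_isRoot (h.squarefree c).ne_zero).subset fun a ha => ?_
  obtain ⟨c, hc⟩ := hdual _ ha
  exact Set.mem_iUnion.2 ⟨c, (h.dotProduct_mon_eq_one_iff a c).1 hc⟩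

/-- The set of branch points. -/
def branch : Finset ℂ := h.finite_mon_ne_zero.toFinset

theorem mem_branch {a : ℂ} : a ∈ h.branch ↔ h.mon a ≠ 0 := by simp [branch]

theorem numBranch_eq : numBranch ρ = h.branch.card := by
  rw [numBranch, h.card_quotientPoint (fun H => H ≠ ⊥) (by simp)]
  refine Nat.subtype_card _ fun a => ?_
  rw [h.mem_branch, Ne, Ne, Subgroup.zpowers_eq_bot, ofAdd_eq_one]

theorem mult_eq {v : E} (hv : v ≠ 0) :
    mult ρ v = (h.branch.filter fun a => h.mon a = v).card := by
  rw [mult, h.card_quotientPoint (fun H => H = Subgroup.zpowers (Multiplicative.ofAdd v))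
    (fun h0 => hv (zpowers_ofAdd_injective (v := v) (w := 0) (by simp [← h0])))]
  refine Nat.subtype_card _ fun a => ?_
  rw [Finset.mem_filter, h.mem_branch]
  constructor
  · rintro ⟨-, h1⟩; rw [h1]
  · intro h1
    have := zpowers_ofAdd_injective h1
    exact ⟨this ▸ hv, this⟩

theorem sum_mult_eq_card {p : E → Prop} [DecidablePred p] (hp : ¬ p 0) :
    ∑ v ∈ Finset.univ.filter p, mult ρ v = (h.branch.filter fun a => p (h.mon a)).card := by
  rw [Finset.card_eq_sum_card_fiberwise (f := h.mon) (t := Finset.univ.filter p)]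
  · refine Finset.sum_congr rfl fun v hv => ?_
    have hv' := (Finset.mem_filter.1 hv).2
    rw [h.mult_eq (fun h0 => hp (h0 ▸ hv')), Finset.filter_filter]
    congr 1
    refine Finset.filter_congr fun a _ => ⟨fun h1 => ⟨by rwa [h1], h1⟩, fun h1 => h1.2⟩
  · intro a ha
    exact Finset.mem_filter.2 ⟨Finset.mem_univ _, (Finset.mem_filter.1 ha).2⟩

include h in
-- The roots of `f c` are the `a` with `c ⬝ᵥ mon a = 1`. They are simple, so the degree counts them.
theorem sum_mult_eq_natDegree (c : E) :
    ∑ v ∈ Finset.univ.filter (fun v : E => c ⬝ᵥ v = 1), mult ρ v = (f c).natDegree := by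
  classical
  rw [h.sum_mult_eq_card (by simp), (IsAlgClosed.splits (f c)).natDegree_eq_card_roots,
    ← Multiset.toFinset_card_of_nodup
      (nodup_roots (PerfectField.separable_iff_squarefree.2 (h.squarefree c)))]
  congr 1
  ext a
  rw [Finset.mem_filter, h.mem_branch, h.dotProduct_mon_eq_one_iff, Multiset.mem_toFinset,
    mem_roots (h.squarefree c).ne_zero, IsRoot.def]
  refine ⟨fun h1 => h1.2, fun h1 => ⟨fun h0 => ?_, h1⟩⟩
  have := (h.dotProduct_mon_eq_one_iff a c).2 h1
  rw [h0, dotProduct_zero] at this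
  exact absurd this (by decide)

include h in
theorem numBranch_eq_sum :
    numBranch ρ = ∑ v ∈ Finset.univ.filter (fun v : E => v ≠ 0), mult ρ v := by
  rw [h.sum_mult_eq_card (by simp), h.numBranch_eq, Finset.filter_true_of_mem]
  exact fun a ha => h.mem_branch.1 ha

include h in
theorem mem_stabSet_iff {v : E} : v ∈ stabSet ρ ↔ v ≠ 0 ∧ mult ρ v ≠ 0 := by
  refine and_congr_right fun hv => ?_
  rw [h.mult_eq hv, Finset.card_ne_zero]
  constructor
  · rintro ⟨P, hP⟩
    rcases h.val_inv_lt_or P with h1 | ⟨a, ha⟩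
    · rw [h.stab_eq_bot h1, Subgroup.mem_bot, ofAdd_eq_one] at hP
      exact absurd hP hv
    · rw [h.stab_eq_zpowers ha] at hP
      have := (eq_zero_or_eq_of_mem_zpowers hP).resolve_left hv
      exact ⟨a, Finset.mem_filter.2 ⟨h.mem_branch.2 (this ▸ hv), this.symm⟩⟩
  · rintro ⟨a, ha⟩
    obtain ⟨P, hP⟩ := Point.exists_val_lt_one (h.coord.sub_const a).transcendental
    refine ⟨P, ?_⟩
    rw [h.stab_eq_zpowers hP, (Finset.mem_filter.1 ha).2]
    exact Subgroup.mem_zpowers _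

end IsFrameUnramifiedAtInfty

end Count

end

section

open Polynomial

/-! ### Restriction of rational functions to the fibres of a product of curves -/

section Restriction

/-- The local ring at a point, as an algebra. -/
def Point.alg {F : Type*} [Field F] [Algebra ℂ F] (P : Point F) : Subalgebra ℂ F :=
  { P.ring.toSubring with algebraMap_mem' := P.algebraMap_mem }

variable {F F' L : Type*} [Field F] [Field F'] [Field L] [Algebra ℂ F] [Algebra ℂ F'] [Algebra ℂ L]

theorem Point.mem_alg {P : Point F} {x : F} : x ∈ P.alg ↔ P.val x ≤ 1 := P.mem_iff

/-- The point `P` is rational: every regular function at `P` has a value in `ℂ`. -/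
def Point.IsRational (P : Point F) : Prop :=
  ∀ x, P.val x ≤ 1 → ∃ d : ℂ, P.val (x - algebraMap ℂ F d) < 1

namespace Point

variable {P : Point F} (hP : P.IsRational)

/-- Evaluation of regular functions at a rational point. -/
def evalFun (x : P.alg) : ℂ := (hP x (mem_alg.1 x.2)).choose

theorem evalFun_spec (x : P.alg) : P.val (x - algebraMap ℂ F (evalFun hP x)) < 1 :=
  (hP x (mem_alg.1 x.2)).choose_spec

theorem evalFun_eq {x : P.alg} {c : ℂ} (hc : P.val (x - algebraMap ℂ F c) < 1) :
    evalFun hP x = c :=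
  P.eq_of_val_sub_lt (evalFun_spec hP x) hc

/-- Evaluation of regular functions at a rational point, as an algebra homomorphism. -/
def ev : P.alg →ₐ[ℂ] ℂ where
  toFun := evalFun hP
  map_one' := evalFun_eq hP (by simp)
  map_zero' := evalFun_eq hP (by simp)
  map_add' x y := evalFun_eq hP (res_add (evalFun_spec hP x) (evalFun_spec hP y))
  map_mul' x y := evalFun_eq hP (res_mul (evalFun_spec hP x) (evalFun_spec hP y))
  commutes' c := evalFun_eq hP (by
    change P.val (algebraMap ℂ F c - algebraMap ℂ F c) < 1
    simp)

theorem ev_eq {x : P.alg} {c : ℂ} (hc : P.val (x - algebraMap ℂ F c) < 1) : ev hP x = c :=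
  evalFun_eq hP hc

end Point

variable (i : F →ₐ[ℂ] L) (j : F' →ₐ[ℂ] L)

/-- `L` is the field of fractions of `F ⊗ F'`. -/
structure IsProductField : Prop where
  injective : Function.Injective (Algebra.TensorProduct.productMap i j)
  exists_div : ∀ x : L, ∃ α β, β ≠ 0 ∧
    x = Algebra.TensorProduct.productMap i j α / Algebra.TensorProduct.productMap i j β

variable {i j}

theorem IsProductField.swap (h : IsProductField i j) : IsProductField j i := by
  have hcomm : ∀ α, Algebra.TensorProduct.productMap j i α =
      Algebra.TensorProduct.productMap i j (Algebra.TensorProduct.comm ℂ F' F α) := fun α => by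
    induction α with
    | zero => simp
    | add x y hx hy => simp only [map_add, hx, hy]
    | tmul a b => simp [mul_comm]
  constructor
  · intro α β hαβ
    rw [hcomm, hcomm] at hαβ
    exact (Algebra.TensorProduct.comm ℂ F' F).injective (h.injective hαβ)
  · intro x
    obtain ⟨α, β, hβ, rfl⟩ := h.exists_div x
    refine ⟨Algebra.TensorProduct.comm ℂ F F' α, Algebra.TensorProduct.comm ℂ F F' β, ?_, ?_⟩
    · simpa using hβ
    · rw [hcomm, hcomm]
      simp [← Algebra.TensorProduct.comm_symm ℂ F F']

variable {P' : Point F'} (hP' : P'.IsRational)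

variable (P') in
variable (i j) in
/-- The inclusion of `F ⊗ 𝒪_{P'}` in `L`. -/
def fibInc : F ⊗[ℂ] P'.alg →ₐ[ℂ] L := Algebra.TensorProduct.productMap i (j.comp P'.alg.val)

variable (F) in
/-- The restriction map `F ⊗ 𝒪_{P'} → F`. -/
def fibRes : F ⊗[ℂ] P'.alg →ₐ[ℂ] F :=
  Algebra.TensorProduct.productMap (AlgHom.id ℂ F) ((Algebra.ofId ℂ F).comp (Point.ev hP'))

@[simp] theorem fibInc_tmul (a : F) (b : P'.alg) : fibInc i j P' (a ⊗ₜ b) = i a * j b := rfl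

@[simp] theorem fibRes_tmul (a : F) (b : P'.alg) :
    fibRes F hP' (a ⊗ₜ b) = a * algebraMap ℂ F (Point.ev hP' b) := rfl

theorem IsProductField.fibInc_injective (h : IsProductField i j) :
    Function.Injective (fibInc i j P') := by
  have : ∀ α, fibInc i j P' α = Algebra.TensorProduct.productMap i j
      (P'.alg.val.toLinearMap.lTensor F α) := fun α => by
    induction α with
    | zero => simp
    | add x y hx hy => simp only [map_add, hx, hy]
    | tmul a b => simp
  intro α β hαβ
  rw [this, this] at hαβ
  exact Module.Flat.lTensor_preserves_injective_linearMap _ Subtype.val_injective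
    (h.injective hαβ)

variable (i j) in
/-- The rational function `x` on `C × C'` restricts to the rational function `u` on `C × {P'}`. -/
def RestrictsTo (x : L) (u : F) : Prop :=
  ∃ α β : F ⊗[ℂ] P'.alg, fibRes F hP' β ≠ 0 ∧ fibInc i j P' β * x = fibInc i j P' α ∧
    fibRes F hP' β * u = fibRes F hP' α

namespace RestrictsTo

variable {hP'}

theorem unique (h : IsProductField i j) {x : L} {u u' : F} (hx : RestrictsTo i j hP' x u)
    (hx' : RestrictsTo i j hP' x u') : u = u' := by
  obtain ⟨α, β, hβ, h1, h2⟩ := hx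
  obtain ⟨α', β', hβ', h1', h2'⟩ := hx'
  have h3 : α * β' = α' * β := h.fibInc_injective (P' := P') (by
    rw [map_mul, map_mul, ← h1, ← h1']; ring)
  have h4 := congrArg (fibRes F hP') h3
  rw [map_mul, map_mul, ← h2, ← h2'] at h4
  refine mul_left_cancel₀ (mul_ne_zero hβ hβ') ?_
  linear_combination h4

theorem add {x y : L} {u v : F} (hx : RestrictsTo i j hP' x u) (hy : RestrictsTo i j hP' y v) :
    RestrictsTo i j hP' (x + y) (u + v) := by
  obtain ⟨α, β, hβ, h1, h2⟩ := hx
  obtain ⟨α', β', hβ', h1', h2'⟩ := hy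
  refine ⟨α * β' + α' * β, β * β', by rw [map_mul]; exact mul_ne_zero hβ hβ', ?_, ?_⟩
  · simp only [map_add, map_mul, ← h1, ← h1']; ring
  · simp only [map_add, map_mul, ← h2, ← h2']; ring

theorem mul {x y : L} {u v : F} (hx : RestrictsTo i j hP' x u) (hy : RestrictsTo i j hP' y v) :
    RestrictsTo i j hP' (x * y) (u * v) := by
  obtain ⟨α, β, hβ, h1, h2⟩ := hx
  obtain ⟨α', β', hβ', h1', h2'⟩ := hy
  refine ⟨α * α', β * β', by rw [map_mul]; exact mul_ne_zero hβ hβ', ?_, ?_⟩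
  · simp only [map_mul, ← h1, ← h1']; ring
  · simp only [map_mul, ← h2, ← h2']; ring

theorem inv (h : IsProductField i j) {x : L} {u : F} (hx : RestrictsTo i j hP' x u) (hu : u ≠ 0) :
    RestrictsTo i j hP' x⁻¹ u⁻¹ := by
  obtain ⟨α, β, hβ, h1, h2⟩ := hx
  have hα : fibRes F hP' α ≠ 0 := h2 ▸ mul_ne_zero hβ hu
  have hx0 : x ≠ 0 := by
    rintro rfl
    rw [mul_zero, ← map_zero (fibInc i j P')] at h1
    rw [← h.fibInc_injective h1, map_zero] at hα
    exact hα rfl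
  refine ⟨β, α, hα, ?_, ?_⟩
  · rw [← h1, mul_assoc, mul_inv_cancel₀ hx0, mul_one]
  · rw [← h2, mul_assoc, mul_inv_cancel₀ hu, mul_one]

variable (hP') in
theorem of_fibInc (α : F ⊗[ℂ] P'.alg) :
    RestrictsTo i j hP' (fibInc i j P' α) (fibRes F hP' α) :=
  ⟨α, 1, by simp, by simp, by simp⟩

variable (hP') in
theorem left (a : F) : RestrictsTo i j hP' (i a) a := by
  have := of_fibInc (i := i) (j := j) hP' (a ⊗ₜ 1)
  simpa using this

variable (hP') in
theorem right {b : F'} {c : ℂ} (hc : P'.val (b - algebraMap ℂ F' c) < 1) :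
    RestrictsTo i j hP' (j b) (algebraMap ℂ F c) := by
  have := of_fibInc (F := F) (i := i) (j := j) hP' (1 ⊗ₜ ⟨b, Point.mem_alg.2 (Point.res_val_le hc)⟩)
  simpa [Point.ev_eq hP' (x := ⟨b, Point.mem_alg.2 (Point.res_val_le hc)⟩) hc] using this

variable (i j hP') in
theorem const (c : ℂ) : RestrictsTo i j hP' (algebraMap ℂ L c) (algebraMap ℂ F c) := by
  have := left (i := i) (j := j) hP' (algebraMap ℂ F c)
  rwa [AlgHom.commutes] at this

theorem smul {x : L} {u : F} (c : ℂ) (hx : RestrictsTo i j hP' x u) :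
    RestrictsTo i j hP' (c • x) (c • u) := by
  rw [Algebra.smul_def, Algebra.smul_def]
  exact (const i j hP' c).mul hx

variable (i j hP') in
theorem zero : RestrictsTo i j hP' 0 0 := by
  simpa using const i j hP' 0

theorem sub {x y : L} {u v : F} (hx : RestrictsTo i j hP' x u) (hy : RestrictsTo i j hP' y v) :
    RestrictsTo i j hP' (x - y) (u - v) := by
  have := hx.add (hy.smul (-1))
  simpa [sub_eq_add_neg] using this

theorem sum {ι : Type*} (s : Finset ι) {x : ι → L} {u : ι → F}
    (h : ∀ k ∈ s, RestrictsTo i j hP' (x k) (u k)) :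
    RestrictsTo i j hP' (∑ k ∈ s, x k) (∑ k ∈ s, u k) := by
  classical
  induction s using Finset.induction_on with
  | empty => simpa using zero i j hP'
  | insert k s hk ih =>
    rw [Finset.sum_insert hk, Finset.sum_insert hk]
    exact (h k (Finset.mem_insert_self _ _)).add (ih fun l hl => h l (Finset.mem_insert_of_mem hl))

/-- A derivation along `C` that is trivial along `C'` acts on numerator and denominator through the
first tensor factor, and so commutes with setting the second variable to `P'`; the quotient rule
does the rest. -/
theorem deriv {D : Derivation ℂ F F} {DL : Derivation ℂ L L} (h1 : ∀ a, DL (i a) = i (D a))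
    (h2 : ∀ b, DL (j b) = 0) {x : L} {u : F} (hx : RestrictsTo i j hP' x u) :
    RestrictsTo i j hP' (DL x) (D u) := by
  have key : ∀ α : F ⊗[ℂ] P'.alg, ∃ α', fibInc i j P' α' = DL (fibInc i j P' α) ∧
      fibRes F hP' α' = D (fibRes F hP' α) := fun α => by
    induction α with
    | zero => exact ⟨0, by simp, by simp⟩
    | add α β hα hβ =>
      obtain ⟨α', h3, h4⟩ := hα
      obtain ⟨β', h5, h6⟩ := hβ
      exact ⟨α' + β', by simp [h3, h5], by simp [h4, h6]⟩
    | tmul a b => exact ⟨D a ⊗ₜ b, by simp [h1, h2, mul_comm], by simp [mul_comm]⟩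
  obtain ⟨α, β, hβ, h3, h4⟩ := hx
  obtain ⟨α', hα1, hα2⟩ := key α
  obtain ⟨β', hβ1, hβ2⟩ := key β
  refine ⟨β * α' - α * β', β * β, by rw [map_mul]; exact mul_ne_zero hβ hβ, ?_, ?_⟩
  · have := congrArg DL h3
    rw [Derivation.leibniz, smul_eq_mul, smul_eq_mul] at this
    simp only [map_sub, map_mul, hα1, hβ1]
    linear_combination fibInc i j P' β * this - DL (fibInc i j P' β) * h3
  · have := congrArg D h4
    rw [Derivation.leibniz, smul_eq_mul, smul_eq_mul] at this
    simp only [map_sub, map_mul, hα2, hβ2]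
    linear_combination fibRes F hP' β * this - D (fibRes F hP' β) * h4

theorem map {σ : F ≃ₐ[ℂ] F} {σL : L ≃ₐ[ℂ] L} (h1 : ∀ a, σL (i a) = i (σ a))
    (h2 : ∀ b, σL (j b) = j b) {x : L} {u : F} (hx : RestrictsTo i j hP' x u) :
    RestrictsTo i j hP' (σL x) (σ u) := by
  have key : ∀ α : F ⊗[ℂ] P'.alg, ∃ α', fibInc i j P' α' = σL (fibInc i j P' α) ∧
      fibRes F hP' α' = σ (fibRes F hP' α) := fun α => by
    induction α with
    | zero => exact ⟨0, by simp, by simp⟩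
    | add α β hα hβ =>
      obtain ⟨α', h3, h4⟩ := hα
      obtain ⟨β', h5, h6⟩ := hβ
      exact ⟨α' + β', by simp [h3, h5], by simp [h4, h6]⟩
    | tmul a b => exact ⟨σ a ⊗ₜ b, by simp [h1, h2], by simp⟩
  obtain ⟨α, β, hβ, h3, h4⟩ := hx
  obtain ⟨α', hα1, hα2⟩ := key α
  obtain ⟨β', hβ1, hβ2⟩ := key β
  refine ⟨α', β', by rw [hβ2]; simpa using hβ, ?_, ?_⟩
  · rw [hα1, hβ1, ← map_mul, h3]
  · rw [hα2, hβ2, ← map_mul, h4]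

end RestrictsTo

/-! ### Local rings of the product -/

section LocalRing

variable {P : Point F} {T : Subalgebra ℂ L} {I : Ideal T}

/-- `T = 𝒪_P ⊗ 𝒪_{P'}`, and `I` is the ideal of functions vanishing at `(P, P')`. -/
structure IsTensorRing (i : F →ₐ[ℂ] L) (j : F' →ₐ[ℂ] L) (P : Point F) (P' : Point F')
    (T : Subalgebra ℂ L) (I : Ideal T) : Prop where
  ring_eq : T = Algebra.adjoin ℂ (i '' P.ring ∪ j '' P'.ring)
  ideal_eq : I = Ideal.span {f : T | (∃ a ∈ P.ring.nonunits, (f : L) = i a) ∨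
    ∃ a ∈ P'.ring.nonunits, (f : L) = j a}

theorem IsTensorRing.swap (hT : IsTensorRing i j P P' T I) : IsTensorRing j i P' P T I where
  ring_eq := by rw [hT.ring_eq, Set.union_comm]
  ideal_eq := by rw [hT.ideal_eq]; simp_rw [or_comm]

variable (T I) in
/-- The localization of `T` at `I`. -/
def localRing : Subalgebra ℂ L :=
  Algebra.adjoin ℂ (T ∪ {f | ∃ b : T, b ∉ I ∧ f = (b : L)⁻¹})

namespace IsTensorRing

variable (hT : IsTensorRing i j P P' T I)
include hT

theorem exists_restrictsTo_of_mem {x : L} (hx : x ∈ T) :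
    ∃ u, P.val u ≤ 1 ∧ RestrictsTo i j hP' x u := by
  rw [hT.ring_eq] at hx
  induction hx using Algebra.adjoin_induction with
  | mem x hx =>
    rcases hx with ⟨a, ha, rfl⟩ | ⟨b, hb, rfl⟩
    · exact ⟨a, P.mem_iff.1 ha, .left hP' a⟩
    · obtain ⟨c, hc⟩ := hP' b (P'.mem_iff.1 hb)
      exact ⟨_, P.val_algebraMap_le c, .right hP' hc⟩
  | algebraMap c => exact ⟨_, P.val_algebraMap_le c, .const i j hP' c⟩
  | add x y _ _ h1 h2 =>
    obtain ⟨u, hu, h1⟩ := h1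
    obtain ⟨v, hv, h2⟩ := h2
    exact ⟨_, P.val.map_add_le hu hv, h1.add h2⟩
  | mul x y _ _ h1 h2 =>
    obtain ⟨u, hu, h1⟩ := h1
    obtain ⟨v, hv, h2⟩ := h2
    exact ⟨_, by rw [map_mul]; exact mul_le_one' hu hv, h1.mul h2⟩

theorem exists_restrictsTo_of_mem_ideal {x : T} (hx : x ∈ I) :
    ∃ u, P.val u < 1 ∧ RestrictsTo i j hP' (x : L) u := by
  rw [hT.ideal_eq] at hx
  induction hx using Submodule.span_induction with
  | mem x hx =>
    rcases hx with ⟨a, ha, hxa⟩ | ⟨b, hb, hxb⟩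
    · rw [hxa]; exact ⟨a, ha, .left hP' a⟩
    · rw [hxb]
      refine ⟨algebraMap ℂ F 0, by simp, .right hP' ?_⟩
      rw [map_zero, sub_zero]; exact hb
  | zero => exact ⟨0, by simp, .zero i j hP'⟩
  | add x y _ _ h1 h2 =>
    obtain ⟨u, hu, h1⟩ := h1
    obtain ⟨v, hv, h2⟩ := h2
    exact ⟨_, P.val.map_add_lt hu hv, h1.add h2⟩
  | smul r x _ h1 =>
    obtain ⟨u, hu, h1⟩ := h1
    obtain ⟨v, hv, h2⟩ := hT.exists_restrictsTo_of_mem hP' r.2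
    exact ⟨v * u, by rw [map_mul, mul_comm]; exact mul_lt_one_of_lt_of_le hu hv, h2.mul h1⟩

include hP' in
-- Since both points are rational, `T / I` is spanned by the constants. An element outside `I` is
-- therefore a nonzero constant modulo `I`.
theorem exists_sub_const_mem (hP : P.IsRational) {x : L} (hx : x ∈ T) :
    ∃ c : ℂ, (⟨x, hx⟩ : T) - algebraMap ℂ T c ∈ I := by
  have hmem : ∀ y (hy : y ∈ T), ((∃ a ∈ P.ring.nonunits, y = i a) ∨
      ∃ a ∈ P'.ring.nonunits, y = j a) → (⟨y, hy⟩ : T) ∈ I := fun y hy h => by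
    rw [hT.ideal_eq]; exact Ideal.subset_span h
  suffices ∀ x (hx : x ∈ Algebra.adjoin ℂ (i '' P.ring ∪ j '' P'.ring)) (hx' : x ∈ T),
      ∃ c : ℂ, (⟨x, hx'⟩ : T) - algebraMap ℂ T c ∈ I from this x (hT.ring_eq ▸ hx) hx
  intro x hx
  have hTr := hT.ring_eq
  induction hx using Algebra.adjoin_induction with
  | mem x hx =>
    intro hx'
    rcases hx with ⟨a, ha, rfl⟩ | ⟨b, hb, rfl⟩
    · obtain ⟨c, hc⟩ := hP a (P.mem_iff.1 ha)
      refine ⟨c, hmem _ (Subalgebra.sub_mem _ hx' (Subalgebra.algebraMap_mem _ c))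
        (Or.inl ⟨_, hc, ?_⟩)⟩
      rw [map_sub, AlgHom.commutes]
    · obtain ⟨c, hc⟩ := hP' b (P'.mem_iff.1 hb)
      refine ⟨c, hmem _ (Subalgebra.sub_mem _ hx' (Subalgebra.algebraMap_mem _ c))
        (Or.inr ⟨_, hc, ?_⟩)⟩
      rw [map_sub, AlgHom.commutes]
  | algebraMap c =>
    intro hx'
    refine ⟨c, ?_⟩
    have : (⟨algebraMap ℂ L c, hx'⟩ : T) = algebraMap ℂ T c := rfl
    rw [this, sub_self]; exact I.zero_mem
  | add x y hx hy h1 h2 =>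
    intro hx'
    obtain ⟨c, hc⟩ := h1 (hTr ▸ hx)
    obtain ⟨d, hd⟩ := h2 (hTr ▸ hy)
    refine ⟨c + d, ?_⟩
    have := I.add_mem hc hd
    rwa [show (⟨x, hTr ▸ hx⟩ : T) - algebraMap ℂ T c + (⟨y, hTr ▸ hy⟩ - algebraMap ℂ T d) =
      ⟨x + y, hx'⟩ - algebraMap ℂ T (c + d) by
        rw [map_add]
        exact Subtype.ext (by simp only [Subalgebra.coe_add, Subalgebra.coe_sub]; ring)] at this
  | mul x y hx hy h1 h2 =>
    intro hx'
    obtain ⟨c, hc⟩ := h1 (hTr ▸ hx)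
    obtain ⟨d, hd⟩ := h2 (hTr ▸ hy)
    refine ⟨c * d, ?_⟩
    have := I.add_mem (I.mul_mem_left ⟨y, hTr ▸ hy⟩ hc) (I.mul_mem_left (algebraMap ℂ T c) hd)
    rwa [show (⟨y, hTr ▸ hy⟩ : T) * (⟨x, hTr ▸ hx⟩ - algebraMap ℂ T c) +
      algebraMap ℂ T c * (⟨y, hTr ▸ hy⟩ - algebraMap ℂ T d) =
      ⟨x * y, hx'⟩ - algebraMap ℂ T (c * d) by
        rw [map_mul]
        exact Subtype.ext (by
          simp only [Subalgebra.coe_add, Subalgebra.coe_sub, Subalgebra.coe_mul]; ring)] at this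

/-- An inverted element has the form `c + (element of I)` with `c ≠ 0`, so its restriction to the
fibre is a unit at `P`. -/
theorem exists_restrictsTo (h : IsProductField i j) (hP : P.IsRational) {x : L}
    (hx : x ∈ localRing T I) : ∃ u, P.val u ≤ 1 ∧ RestrictsTo i j hP' x u := by
  induction hx using Algebra.adjoin_induction with
  | mem x hx =>
    rcases hx with hx | ⟨b, hb, rfl⟩
    · exact hT.exists_restrictsTo_of_mem hP' hx
    · obtain ⟨c, hc⟩ := hT.exists_sub_const_mem hP' hP b.2
      obtain ⟨u, hu, hbu⟩ := hT.exists_restrictsTo_of_mem_ideal hP' hc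
      have hc0 : c ≠ 0 := by
        rintro rfl
        rw [map_zero, sub_zero] at hc
        exact hb hc
      have h1 := hbu.add (RestrictsTo.const i j hP' c)
      have h2 : ((⟨(b : L), b.2⟩ - algebraMap ℂ T c : T) : L) + algebraMap ℂ L c = b := by
        simp
      rw [h2] at h1
      have h3 : P.val (u + algebraMap ℂ F c) = 1 :=
        P.val_eq_one_of_val_sub_lt hc0 (by rwa [add_sub_cancel_right])
      refine ⟨_, ?_, h1.inv h ((Valuation.ne_zero_iff P.val).1 (by rw [h3]; exact one_ne_zero))⟩
      rw [map_inv₀, h3, inv_one]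
  | algebraMap c => exact ⟨_, P.val_algebraMap_le c, .const i j hP' c⟩
  | add x y _ _ h1 h2 =>
    obtain ⟨u, hu, h1⟩ := h1
    obtain ⟨v, hv, h2⟩ := h2
    exact ⟨_, P.val.map_add_le hu hv, h1.add h2⟩
  | mul x y _ _ h1 h2 =>
    obtain ⟨u, hu, h1⟩ := h1
    obtain ⟨v, hv, h2⟩ := h2
    exact ⟨_, by rw [map_mul]; exact mul_le_one' hu hv, h1.mul h2⟩

theorem deriv_mem {D' : Derivation ℂ F' F'} {DL' : Derivation ℂ L L} (h1 : ∀ a, DL' (i a) = 0)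
    (h2 : ∀ b, DL' (j b) = j (D' b)) (hD' : ∀ b, P'.val b ≤ 1 → P'.val (D' b) ≤ 1) {x : L}
    (hx : x ∈ localRing T I) : DL' x ∈ localRing T I := by
  have hsub : ∀ y ∈ T, y ∈ localRing T I := fun y hy => Algebra.subset_adjoin (Or.inl hy)
  have hderT : ∀ y ∈ T, DL' y ∈ T := by
    rw [hT.ring_eq]
    intro y hy
    induction hy using Algebra.adjoin_induction with
    | mem y hy =>
      rcases hy with ⟨a, ha, rfl⟩ | ⟨b, hb, rfl⟩
      · rw [h1]; exact Subalgebra.zero_mem _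
      · rw [h2]
        exact Algebra.subset_adjoin (Or.inr ⟨_, P'.mem_iff.2 (hD' b (P'.mem_iff.1 hb)), rfl⟩)
    | algebraMap c => rw [Derivation.map_algebraMap]; exact Subalgebra.zero_mem _
    | add x y _ _ h1 h2 => rw [map_add]; exact Subalgebra.add_mem _ h1 h2
    | mul x y hx hy h1 h2 =>
      rw [Derivation.leibniz]
      exact Subalgebra.add_mem _ (Subalgebra.mul_mem _ hx h2) (Subalgebra.mul_mem _ hy h1)
  induction hx using Algebra.adjoin_induction with
  | mem x hx =>
    rcases hx with hx | ⟨b, hb, rfl⟩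
    · exact hsub _ (hderT x hx)
    · rw [Derivation.leibniz_inv]
      have : (b : L)⁻¹ ∈ localRing T I := Algebra.subset_adjoin (Or.inr ⟨b, hb, rfl⟩)
      exact Subalgebra.mul_mem _ (Subalgebra.neg_mem _ (Subalgebra.pow_mem _ this 2))
        (hsub _ (hderT _ b.2))
  | algebraMap c => rw [Derivation.map_algebraMap]; exact Subalgebra.zero_mem _
  | add x y _ _ h1 h2 => rw [map_add]; exact Subalgebra.add_mem _ h1 h2
  | mul x y hx hy h1 h2 =>
    rw [Derivation.leibniz]
    exact Subalgebra.add_mem _ (Subalgebra.mul_mem _ hx h2) (Subalgebra.mul_mem _ hy h1)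

end IsTensorRing

end LocalRing

end Restriction

end

section

open Polynomial Filter

/-! ### Generic fibres -/

section Generic

variable {F : Type*} [Field F] [Algebra ℂ F] {ρ : G →* (F ≃ₐ[ℂ] F)} {t : F} {Y Z : E → F}
  {f : E → ℂ[X]}

theorem eventually_eval_ne_zero {p : ℂ[X]} (hp : p ≠ 0) : ∀ᶠ a in cofinite, p.eval a ≠ 0 := by
  have := finite_setOfPred_isRoot hp
  rw [eventually_cofinite]
  simpa [IsRoot] using this

namespace IsFrame

variable (h : IsFrame ρ t Y f)
include h

theorem eventually_val_le_one (x : F) :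
    ∀ᶠ a in cofinite, ∀ P : Point F, P.val (t - algebraMap ℂ F a) < 1 → P.val x ≤ 1 := by
  have hc : ∀ c : E, ∀ᶠ a in cofinite, ∀ P : Point F, P.val (t - algebraMap ℂ F a) < 1 →
      P.val (proj ρ c x) ≤ 1 := fun c => by
    obtain ⟨p, q, hq, hpq⟩ := h.coord.exists_div ((isEigen_proj c x).div_fixed (h.isEigen c))
    filter_upwards [eventually_eval_ne_zero hq] with a ha P hP
    rw [div_eq_iff (h.ne_zero c)] at hpq
    rw [hpq, map_mul, map_div₀, Point.val_aeval_eq_one_of_eval_ne hP ha, div_one]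
    exact mul_le_one' (P.val_aeval_le (Point.res_val_le hP) p) ((h.isLocalFrame hP).val_le c)
  filter_upwards [eventually_all.2 hc] with a ha P hP
  rw [← sum_proj (ρ := ρ) x]
  exact P.val.map_sum_le fun c _ => ha c P hP

theorem eventually_val_eq_one {x : F} (hx : x ≠ 0) :
    ∀ᶠ a in cofinite, ∀ P : Point F, P.val (t - algebraMap ℂ F a) < 1 → P.val x = 1 := by
  filter_upwards [h.eventually_val_le_one x, h.eventually_val_le_one x⁻¹] with a h1 h2 P hP
  have h3 := h2 P hP
  rw [map_inv₀, inv_le_one₀ (zero_lt_iff.2 ((Valuation.ne_zero_iff _).2 hx))] at h3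
  exact le_antisymm (h1 P hP) h3

/-- Away from the roots of the `f c` all frame members are units, and the derivative bound holds
with multiplier `1`. -/
theorem eventually_val_deriv_le {D : Derivation ℂ F F} (hD : D t = 1) :
    ∀ᶠ a in cofinite, ∀ P : Point F, P.val (t - algebraMap ℂ F a) < 1 →
      ∀ x, P.val x ≤ 1 → P.val (D x) ≤ 1 := by
  filter_upwards [eventually_all.2 fun c => eventually_eval_ne_zero (h.squarefree c).ne_zero]
    with a ha P hP x hx
  have := (h.isLocalFrame hP).val_mul_deriv_le (D := D) (by simp [hD]) (z := 1) (by simp)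
    (fun c => by rw [h.val_eq_one hP (ha c), map_one]) hx
  rwa [one_mul] at this

end IsFrame

theorem IsFrameUnramifiedAtInfty.isRational (h : IsFrameUnramifiedAtInfty ρ t Y f Z)
    (P : Point F) : P.IsRational := by
  rcases h.val_inv_lt_or P with hP | ⟨a, hP⟩
  · exact fun x hx => (h.localFrame P hP).exists_res hx
  · exact fun x hx => (h.isLocalFrame hP).exists_res hx

/-- The group acts on regular differentials. -/
theorem act_smul_regular (ht : IsCoord ρ t) {x : F}
    (hx : x • KaehlerDifferential.D ℂ F t ∈ regularDiff F) (g : E) :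
    act ρ g x • KaehlerDifferential.D ℂ F t ∈ regularDiff F := by
  obtain ⟨D, hD⟩ := ht.exists_derivation
  -- Conjugating `D` by the involution `σ` gives a derivation that again sends `t` to `1`, so it
  -- equals `D`.
  have hcomm : ∀ a, act ρ g (D a) = D (act ρ g a) := by
    let σ := act ρ g
    let δ : Derivation ℂ F F := Derivation.mk'
      (σ.toLinearMap ∘ₗ D.toLinearMap ∘ₗ σ.toLinearMap) (fun a b => by
        simp [σ])
    have h0 := ht.derivation_eq_zero (δ - D) (by
      have : δ t = σ (D (σ t)) := rfl
      rw [Derivation.sub_apply, this, isEigen_zero_iff.1 ht.fixed, hD, map_one, sub_self])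
    intro a
    have := DFunLike.congr_fun h0 (act ρ g a)
    have h2 : δ (act ρ g a) = act ρ g (D (act ρ g (act ρ g a))) := rfl
    rw [Derivation.sub_apply, h2, act_act, Derivation.zero_apply, sub_eq_zero] at this
    exact this
  intro P
  have key : ∀ ω ∈ Submodule.span (act ρ g • P).ring
      {η | ∃ a ∈ (act ρ g • P).ring, η = KaehlerDifferential.D ℂ F a},
      ∃ y : F, ω = y • KaehlerDifferential.D ℂ F t ∧ act ρ g y • KaehlerDifferential.D ℂ F t ∈
        Submodule.span P.ring {η | ∃ a ∈ P.ring, η = KaehlerDifferential.D ℂ F a} := by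
    intro ω hω
    induction hω using Submodule.span_induction with
    | mem ω hω =>
      obtain ⟨a, ha, rfl⟩ := hω
      refine ⟨D a, ht.D_eq_smul D hD a, ?_⟩
      rw [hcomm, ← ht.D_eq_smul D hD]
      rw [P.smul_mem_iff, act_symm] at ha
      exact Submodule.subset_span ⟨_, ha, rfl⟩
    | zero => exact ⟨0, by simp, by simp⟩
    | add ω η _ _ h1 h2 =>
      obtain ⟨y, rfl, hy⟩ := h1
      obtain ⟨z, rfl, hz⟩ := h2
      exact ⟨y + z, by rw [add_smul], by rw [map_add, add_smul]; exact Submodule.add_mem _ hy hz⟩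
    | smul r ω _ h1 =>
      obtain ⟨y, rfl, hy⟩ := h1
      have hr := r.2
      rw [P.smul_mem_iff, act_symm] at hr
      refine ⟨r * y, by rw [mul_smul]; rfl, ?_⟩
      rw [map_mul, mul_smul]
      exact Submodule.smul_mem _ (⟨_, hr⟩ : P.ring) hy
  obtain ⟨y, hy, hy'⟩ := key _ (hx (act ρ g • P))
  rwa [ht.smul_D_injective hy]

theorem IsFrameUnramifiedAtInfty.proj_smul_mem_eigenDiff (h : IsFrameUnramifiedAtInfty ρ t Y f Z)
    {x : F} (hx : x • KaehlerDifferential.D ℂ F t ∈ regularDiff F) (c : E) :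
    proj ρ c x • KaehlerDifferential.D ℂ F t ∈
      eigenDiff ρ (dotProductEquiv (ZMod 2) (Fin 3) c) := by
  refine h.mem_eigenDiff_iff.2 ⟨?_, isEigen_proj c x⟩
  rw [proj, smul_assoc, Finset.sum_smul]
  refine Submodule.smul_mem _ _ (Submodule.sum_mem _ fun v _ => ?_)
  rw [smul_assoc]
  exact Submodule.smul_mem _ _ (act_smul_regular h.coord hx v)

end Generic

/-! ### Two-forms on a product of curves and their restriction to generic fibres -/

section Product

variable {F F' L : Type*} [Field F] [Field F'] [Field L] [Algebra ℂ F] [Algebra ℂ F'] [Algebra ℂ L]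
  {i : F →ₐ[ℂ] L} {j : F' →ₐ[ℂ] L}
  {ρ : G →* (F ≃ₐ[ℂ] F)} {t : F} {Y Z : E → F} {f : E → ℂ[X]}
  {ρ' : G →* (F' ≃ₐ[ℂ] F')} {t' : F'} {Y' Z' : E → F'} {f' : E → ℂ[X]}

/-- Expand `α` in a basis of `F` over `ℂ`. Its finitely many nonzero coefficients in `F'` are units
at the points over almost every value of `t'`, and there the restriction is a nontrivial combination
of basis elements. -/
theorem eventually_exists_fibRes_ne_zero (h' : IsFrame ρ' t' Y' f') {α : F ⊗[ℂ] F'} (hα : α ≠ 0) :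
    ∀ᶠ a in cofinite, ∀ (P' : Point F') (hP' : P'.IsRational),
      P'.val (t' - algebraMap ℂ F' a) < 1 → ∃ α' : F ⊗[ℂ] P'.alg,
        fibInc i j P' α' = Algebra.TensorProduct.productMap i j α ∧ fibRes F hP' α' ≠ 0 := by
  let b := Module.Free.chooseBasis ℂ F
  let e := TensorProduct.equivFinsuppOfBasisLeft (N := F') b
  have hαe : α = ∑ k ∈ (e α).support, b k ⊗ₜ[ℂ] (e α k) := by
    have := e.symm_apply_apply α
    rw [TensorProduct.equivFinsuppOfBasisLeft_symm_apply] at this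
    exact this.symm
  have hne : e α ≠ 0 := fun h0 => hα (by simpa using h0)
  obtain ⟨k₀, hk₀⟩ := Finsupp.support_nonempty_iff.2 hne
  have hev : ∀ k ∈ (e α).support, ∀ᶠ a in cofinite, ∀ P' : Point F',
      P'.val (t' - algebraMap ℂ F' a) < 1 → P'.val (e α k) = 1 := fun k hk =>
    h'.eventually_val_eq_one (Finsupp.mem_support_iff.1 hk)
  filter_upwards [(Finset.eventually_all _).2 hev] with a ha P' hP' hval
  let w : (e α).support → P'.alg := fun k =>
    ⟨e α k, Point.mem_alg.2 (ha k k.2 P' hval).le⟩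
  refine ⟨∑ k : (e α).support, b k ⊗ₜ w k, ?_, ?_⟩
  · conv_rhs => rw [hαe, ← Finset.sum_coe_sort]
    simp [w]
  · intro h0
    have h1 : ∑ k : (e α).support, Point.ev hP' (w k) • b k = 0 := by
      rw [← h0, map_sum]
      exact Finset.sum_congr rfl fun k _ => by rw [fibRes_tmul, Algebra.smul_def, mul_comm]
    have h2 := (Fintype.linearIndependent_iff.1
      (b.linearIndependent.comp _ Subtype.val_injective)) _ h1 ⟨k₀, hk₀⟩
    have h3 := Point.evalFun_spec hP' (w ⟨k₀, hk₀⟩)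
    change P'.val ((w ⟨k₀, hk₀⟩ : F') - algebraMap ℂ F' (Point.ev hP' (w ⟨k₀, hk₀⟩))) < 1 at h3
    rw [h2, map_zero, sub_zero] at h3
    exact absurd (ha k₀ hk₀ P' hval) h3.ne

theorem IsProductField.eventually_restrictsTo (hL : IsProductField i j) (h' : IsFrame ρ' t' Y' f')
    {x : L} (hx : x ≠ 0) :
    ∀ᶠ a in cofinite, ∀ (P' : Point F') (hP' : P'.IsRational),
      P'.val (t' - algebraMap ℂ F' a) < 1 → ∃ u, u ≠ 0 ∧ RestrictsTo i j hP' x u := by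
  obtain ⟨α, β, hβ, rfl⟩ := hL.exists_div x
  have hα : α ≠ 0 := by rintro rfl; simp at hx
  filter_upwards [eventually_exists_fibRes_ne_zero (i := i) (j := j) h' hα,
    eventually_exists_fibRes_ne_zero (i := i) (j := j) h' hβ] with a h1 h2 P' hP' hval
  obtain ⟨α', h3, h4⟩ := h1 P' hP' hval
  obtain ⟨β', h5, h6⟩ := h2 P' hP' hval
  refine ⟨_, mul_ne_zero h4 (inv_ne_zero h6), ?_⟩
  rw [← h3, ← h5, div_eq_mul_inv]
  exact (RestrictsTo.of_fibInc hP' α').mul ((RestrictsTo.of_fibInc hP' β').inv hL h6)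

/-- The coefficients of the 2-forms which are regular with respect to the local ring `R`. -/
def formSpan (DL DL' : Derivation ℂ L L) (R : Subalgebra ℂ L) : Submodule R L :=
  Submodule.span R {x | ∃ a ∈ R, ∃ b ∈ R, x = DL a * DL' b - DL' a * DL b}

theorem formSpan_swap (DL DL' : Derivation ℂ L L) (R : Subalgebra ℂ L) :
    formSpan DL' DL R = formSpan DL DL' R := by
  unfold formSpan
  congr 1
  ext x
  constructor <;>
  · rintro ⟨a, ha, b, hb, rfl⟩
    exact ⟨b, hb, a, ha, by ring⟩

theorem exists_restrictsTo_of_mem_formSpan (hL : IsProductField i j)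
    (h : IsFrameUnramifiedAtInfty ρ t Y f Z) {D : Derivation ℂ F F} {DL DL' : Derivation ℂ L L}
    {D' : Derivation ℂ F' F'} (hD : D t = 1)
    (h1 : ∀ a, DL (i a) = i (D a)) (h2 : ∀ b, DL (j b) = 0) (h1' : ∀ a, DL' (i a) = 0)
    (h2' : ∀ b, DL' (j b) = j (D' b)) {P : Point F} {P' : Point F'} (hP' : P'.IsRational)
    (hD' : ∀ b, P'.val b ≤ 1 → P'.val (D' b) ≤ 1) {T : Subalgebra ℂ L} {I : Ideal T}
    (hT : IsTensorRing i j P P' T I) {x : L} (hx : x ∈ formSpan DL DL' (localRing T I)) :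
    ∃ u, RestrictsTo i j hP' x u ∧ u • KaehlerDifferential.D ℂ F t ∈
      Submodule.span P.ring {η | ∃ a ∈ P.ring, η = KaehlerDifferential.D ℂ F a} := by
  have hP := h.isRational P
  induction hx using Submodule.span_induction with
  | mem x hx =>
    obtain ⟨a, ha, b, hb, rfl⟩ := hx
    obtain ⟨u, hu, hau⟩ := hT.exists_restrictsTo hP' hL hP ha
    obtain ⟨v, hv, hbv⟩ := hT.exists_restrictsTo hP' hL hP hb
    obtain ⟨u', hu', hau'⟩ := hT.exists_restrictsTo hP' hL hP (hT.deriv_mem h1' h2' hD' ha)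
    obtain ⟨v', hv', hbv'⟩ := hT.exists_restrictsTo hP' hL hP (hT.deriv_mem h1' h2' hD' hb)
    -- For `da ∧ db`, the derivatives along `C'` restrict to regular functions `u'`, `v'`, and the
    -- coefficient restricts to that of the differential `v' du - u' dv`.
    refine ⟨D u * v' - u' * D v, ((hau.deriv h1 h2).mul hbv').sub (hau'.mul (hbv.deriv h1 h2)), ?_⟩
    rw [sub_smul, mul_comm (D u), mul_smul, mul_smul, ← h.coord.D_eq_smul D hD,
      ← h.coord.D_eq_smul D hD]
    exact Submodule.sub_mem _
      (Submodule.smul_mem _ (⟨v', P.mem_iff.2 hv'⟩ : P.ring)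
        (Submodule.subset_span ⟨u, P.mem_iff.2 hu, rfl⟩))
      (Submodule.smul_mem _ (⟨u', P.mem_iff.2 hu'⟩ : P.ring)
        (Submodule.subset_span ⟨v, P.mem_iff.2 hv, rfl⟩))
  | zero => exact ⟨0, .zero i j hP', by simp⟩
  | add x y _ _ hx hy =>
    obtain ⟨u, hu, hu'⟩ := hx
    obtain ⟨v, hv, hv'⟩ := hy
    exact ⟨u + v, hu.add hv, by rw [add_smul]; exact Submodule.add_mem _ hu' hv'⟩
  | smul r x _ hx =>
    obtain ⟨u, hu, hu'⟩ := hx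
    obtain ⟨v, hv, hrv⟩ := hT.exists_restrictsTo hP' hL hP r.2
    refine ⟨v * u, hrv.mul hu, ?_⟩
    rw [mul_smul]
    exact Submodule.smul_mem _ (⟨v, P.mem_iff.2 hv⟩ : P.ring) hu'

/-- If the isotypic component of a regular 2-form on `C × C'` does not vanish, then neither does the
corresponding isotypic component of the space of regular differentials on `C`. -/
theorem eigenDiff_ne_bot_of_proj_ne_zero (hL : IsProductField i j)
    (h : IsFrameUnramifiedAtInfty ρ t Y f Z) (h' : IsFrameUnramifiedAtInfty ρ' t' Y' f' Z')
    {D : Derivation ℂ F F} {DL DL' : Derivation ℂ L L} {D' : Derivation ℂ F' F'} (hD : D t = 1)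
    (hD' : D' t' = 1) (h1 : ∀ a, DL (i a) = i (D a)) (h2 : ∀ b, DL (j b) = 0)
    (h1' : ∀ a, DL' (i a) = 0) (h2' : ∀ b, DL' (j b) = j (D' b)) {ρL : G →* (L ≃ₐ[ℂ] L)}
    (hρ1 : ∀ v a, act ρL v (i a) = i (act ρ v a)) (hρ2 : ∀ v b, act ρL v (j b) = j b) {x : L}
    (hx : ∀ (P : Point F) (P' : Point F'), ∃ (T : Subalgebra ℂ L) (I : Ideal T),
      IsTensorRing i j P P' T I ∧ x ∈ formSpan DL DL' (localRing T I))
    {c : E} (hc : proj ρL c x ≠ 0) : eigenDiff ρ (dotProductEquiv (ZMod 2) (Fin 3) c) ≠ ⊥ := by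
  -- Choose a fibre on which the `c`-component stays nonzero and over which `d/dt'` preserves the
  -- local rings of `C'`; both hold for almost all values of `t'`.
  obtain ⟨a, ha1, ha2⟩ := ((hL.eventually_restrictsTo h'.toIsFrame hc).and
    (h'.eventually_val_deriv_le hD')).exists
  obtain ⟨P', hval⟩ := Point.exists_val_lt_one (h'.coord.sub_const a).transcendental
  have hP' := h'.isRational P'
  obtain ⟨w, hw0, hw⟩ := ha1 P' hP' hval
  have hloc : ∀ P : Point F, ∃ u, RestrictsTo i j hP' x u ∧ u • KaehlerDifferential.D ℂ F t ∈
      Submodule.span P.ring {η | ∃ a ∈ P.ring, η = KaehlerDifferential.D ℂ F a} := fun P => by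
    obtain ⟨T, I, hT, hxT⟩ := hx P P'
    exact exists_restrictsTo_of_mem_formSpan hL h hD h1 h2 h1' h2' hP' (ha2 P' hval) hT hxT
  obtain ⟨P₀, -⟩ := h.exists_point_infty
  obtain ⟨u, hu, -⟩ := hloc P₀
  have hreg : u • KaehlerDifferential.D ℂ F t ∈ regularDiff F := fun P => by
    obtain ⟨v, hv, hv'⟩ := hloc P
    rwa [hu.unique hL hv]
  have hproj : RestrictsTo i j hP' (proj ρL c x) (proj ρ c u) :=
    (RestrictsTo.sum _ fun v _ => (hu.map (hρ1 v) (hρ2 v)).smul _).smul _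
  rw [hw.unique hL hproj] at hw0
  have hmem := h.proj_smul_mem_eigenDiff hreg c
  intro hbot
  rw [hbot, Submodule.mem_bot] at hmem
  exact hw0 (h.coord.smul_D_injective (hmem.trans (zero_smul _ _).symm))

/-- `D ⊗ 1` is a derivation of `F ⊗ F'`, and it extends to the field of fractions because
localization is formally étale. -/
theorem IsProductField.exists_derivation (hL : IsProductField i j) (D : Derivation ℂ F F) :
    ∃ DL : Derivation ℂ L L, (∀ a, DL (i a) = i (D a)) ∧ ∀ b, DL (j b) = 0 := by
  let μ := Algebra.TensorProduct.productMap i j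
  let _ : Algebra (F ⊗[ℂ] F') L := μ.toAlgebra
  have hμ : ∀ α, algebraMap (F ⊗[ℂ] F') L α = μ α := fun _ => rfl
  have : IsScalarTower ℂ (F ⊗[ℂ] F') L := IsScalarTower.of_algebraMap_eq fun c => by
    rw [hμ, AlgHom.commutes]
  have : FaithfulSMul (F ⊗[ℂ] F') L := (faithfulSMul_iff_algebraMap_injective _ _).2 hL.injective
  have : IsFractionRing (F ⊗[ℂ] F') L := .of_field _ _ fun x => by
    obtain ⟨α, β, -, h⟩ := hL.exists_div x
    exact ⟨α, β, h⟩
  have : Algebra.FormallyEtale (F ⊗[ℂ] F') L := .of_isLocalization (nonZeroDivisors _)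
  let δ : F ⊗[ℂ] F' →ₗ[ℂ] L := μ.toLinearMap ∘ₗ (D.toLinearMap.rTensor F')
  have hδ : ∀ a b, δ (a ⊗ₜ b) = i (D a) * j b := fun a b => rfl
  let d : Derivation ℂ (F ⊗[ℂ] F') L := Derivation.mk' δ fun α β => by
    simp only [Algebra.smul_def, hμ]
    induction α with
    | zero => simp
    | add x y hx hy => rw [add_mul, map_add, hx, hy]; simp only [map_add]; ring
    | tmul a b =>
      induction β with
      | zero => simp
      | add x y hx hy => rw [mul_add, map_add, hx, hy]; simp only [map_add]; ring
      | tmul a' b' =>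
        rw [Algebra.TensorProduct.tmul_mul_tmul, hδ, hδ, hδ, Derivation.leibniz]
        simp only [μ, Algebra.TensorProduct.productMap_apply_tmul, smul_eq_mul, map_add, map_mul]
        ring
  obtain ⟨DL, hDL⟩ := exists_derivation_extend d
  refine ⟨DL, fun a => ?_, fun b => ?_⟩
  · have := hDL (a ⊗ₜ 1)
    have h2 : d (a ⊗ₜ 1) = i (D a) * j 1 := rfl
    rw [h2, hμ] at this
    simpa [μ] using this
  · have := hDL (1 ⊗ₜ b)
    have h2 : d (1 ⊗ₜ b) = i (D 1) * j b := rfl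
    rw [h2, hμ] at this
    simpa [μ] using this

end Product

end

section

open Polynomial Filter

/-! ### The canonical map -/

section Jacobian

variable {K L M : Type*} [Field K] [Field L] [Algebra K L] [AddCommGroup M] [Module K M]

/-- The determinant of a pair of linear forms, as an alternating map. -/
def pairDet (l₁ l₂ : M →ₗ[K] L) : M [⋀^Fin 2]→ₗ[K] L where
  toFun m := l₁ (m 0) * l₂ (m 1) - l₂ (m 0) * l₁ (m 1)
  map_update_add' m k x y := by
    fin_cases k <;> simp <;> ring
  map_update_smul' m k r x := by
    fin_cases k <;> simp [Algebra.smul_def] <;> ring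
  map_eq_zero_of_eq' m k l hkl hne := by
    have h : m 0 = m 1 := by
      fin_cases k <;> fin_cases l <;> simp_all
    simp only [h]; ring

theorem pairDet_apply (l₁ l₂ : M →ₗ[K] L) (m : Fin 2 → M) :
    pairDet l₁ l₂ m = l₁ (m 0) * l₂ (m 1) - l₂ (m 0) * l₁ (m 1) := rfl

theorem exists_eq_smul_ιMulti {x y : M} (hxy : ∀ m : M, ∃ a b : K, m = a • x + b • y)
    (η : ⋀[K]^2 M) : ∃ a : K, η = a • exteriorPower.ιMulti K 2 ![x, y] := by
  have hη : η ∈ Submodule.span K (Set.range (exteriorPower.ιMulti K 2 (M := M))) := by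
    rw [exteriorPower.ιMulti_span]; trivial
  induction hη using Submodule.span_induction with
  | mem η hη =>
    obtain ⟨m, rfl⟩ := hη
    obtain ⟨a, b, hab⟩ := hxy (m 0)
    obtain ⟨c, d, hcd⟩ := hxy (m 1)
    refine ⟨a * d - b * c, Subtype.ext ?_⟩
    rw [Submodule.coe_smul, exteriorPower.ιMulti_apply_coe, exteriorPower.ιMulti_apply_coe,
      ExteriorAlgebra.ιMulti_apply, ExteriorAlgebra.ιMulti_apply]
    have hyx : ExteriorAlgebra.ι K y * ExteriorAlgebra.ι K x =
        -(ExteriorAlgebra.ι K x * ExteriorAlgebra.ι K y) :=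
      eq_neg_of_add_eq_zero_left (ExteriorAlgebra.ι_add_mul_swap y x)
    simp only [List.ofFn_succ, List.ofFn_zero, List.prod_cons, List.prod_nil, mul_one,
      Fin.succ_zero_eq_one, hab, hcd, map_add, map_smul, add_mul, mul_add, smul_mul_smul_comm,
      ExteriorAlgebra.ι_sq_zero, smul_zero, hyx, Matrix.cons_val_zero, Matrix.cons_val_one]
    module
  | zero => exact ⟨0, by simp⟩
  | add η θ _ _ h1 h2 =>
    obtain ⟨a, rfl⟩ := h1
    obtain ⟨b, rfl⟩ := h2
    exact ⟨a + b, by rw [add_smul]⟩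
  | smul r η _ h1 =>
    obtain ⟨a, rfl⟩ := h1
    exact ⟨r * a, by rw [mul_smul]⟩

end Jacobian

/-! ### The function field of the surface and its differentials -/

section Surface

variable {F₁ F₂ : Type*} [Field F₁] [Field F₂] [Algebra ℂ F₁] [Algebra ℂ F₂]
  {ρ₁ : G →* (F₁ ≃ₐ[ℂ] F₁)} {ρ₂ : G →* (F₂ ≃ₐ[ℂ] F₂)}
  (L : Type*) [Field L] [Algebra ℂ L] [Algebra (F₁ ⊗[ℂ] F₂) L]
  [IsScalarTower ℂ (F₁ ⊗[ℂ] F₂) L] [IsFractionRing (F₁ ⊗[ℂ] F₂) L]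

omit [IsFractionRing (F₁ ⊗[ℂ] F₂) L] in
theorem productMap_pull (α : F₁ ⊗[ℂ] F₂) :
    Algebra.TensorProduct.productMap (pull₁ F₁ F₂ L) (pull₂ F₁ F₂ L) α =
      algebraMap (F₁ ⊗[ℂ] F₂) L α := by
  induction α with
  | zero => simp
  | add x y hx hy => simp only [map_add, hx, hy]
  | tmul a b => simp [pull₁, pull₂, ← map_mul]

theorem isProductField_pull : IsProductField (pull₁ F₁ F₂ L) (pull₂ F₁ F₂ L) where
  injective α β h := by
    rw [productMap_pull, productMap_pull] at h
    exact IsFractionRing.injective _ L h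
  exists_div x := by
    obtain ⟨α, β, hβ, rfl⟩ := IsFractionRing.div_surjective (A := F₁ ⊗[ℂ] F₂) x
    have : Nontrivial (F₁ ⊗[ℂ] F₂) := (algebraMap (F₁ ⊗[ℂ] F₂) L).domain_nontrivial
    exact ⟨α, β, nonZeroDivisors.ne_zero hβ, by rw [productMap_pull, productMap_pull]⟩

theorem act_prodAction_algebraMap (v : E) (α : F₁ ⊗[ℂ] F₂) :
    act (prodAction ρ₁ ρ₂ L) v (algebraMap _ L α) =
      algebraMap _ L (Algebra.TensorProduct.congr (act ρ₁ v) (act ρ₂ v) α) := by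
  simp only [act, prodAction, MonoidHom.comp_apply, IsFractionRing.fieldEquivOfAlgEquivHom_apply]
  exact IsFractionRing.fieldEquivOfAlgEquiv_algebraMap ℂ L L _ α

theorem act_prodAction_pull₁ (v : E) (a : F₁) :
    act (prodAction ρ₁ ρ₂ L) v (pull₁ F₁ F₂ L a) = pull₁ F₁ F₂ L (act ρ₁ v a) := by
  have := act_prodAction_algebraMap (ρ₁ := ρ₁) (ρ₂ := ρ₂) L v (a ⊗ₜ 1)
  simpa [pull₁] using this

theorem act_prodAction_pull₂ (v : E) (b : F₂) :
    act (prodAction ρ₁ ρ₂ L) v (pull₂ F₁ F₂ L b) = pull₂ F₁ F₂ L (act ρ₂ v b) := by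
  have := act_prodAction_algebraMap (ρ₁ := ρ₁) (ρ₂ := ρ₂) L v (1 ⊗ₜ b)
  simpa [pull₂] using this

variable {L} in
theorem algEquiv_ext_pull {σ τ : L ≃ₐ[ℂ] L}
    (h1 : ∀ a, σ (pull₁ F₁ F₂ L a) = τ (pull₁ F₁ F₂ L a))
    (h2 : ∀ b, σ (pull₂ F₁ F₂ L b) = τ (pull₂ F₁ F₂ L b)) (x : L) : σ x = τ x := by
  have key : ∀ α, σ (Algebra.TensorProduct.productMap (pull₁ F₁ F₂ L) (pull₂ F₁ F₂ L) α) =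
      τ (Algebra.TensorProduct.productMap (pull₁ F₁ F₂ L) (pull₂ F₁ F₂ L) α) := fun α => by
    induction α with
    | zero => simp
    | add x y hx hy => simp only [map_add, hx, hy]
    | tmul a b => simp [h1, h2]
  obtain ⟨α, β, -, rfl⟩ := (isProductField_pull (F₁ := F₁) (F₂ := F₂) L).exists_div x
  rw [map_div₀, map_div₀, key, key]

/-- On invariant functions, the actions of `G` through the two factors agree. -/
theorem act_left_eq_act_right {x : L} (hx : IsEigen (prodAction ρ₁ ρ₂ L) 0 x) (v : E) :
    act (prodAction ρ₁ (1 : G →* (F₂ ≃ₐ[ℂ] F₂)) L) v x =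
      act (prodAction (1 : G →* (F₁ ≃ₐ[ℂ] F₁)) ρ₂ L) v x := by
  have h : act (prodAction ρ₁ ρ₂ L) v x =
      ((act (prodAction (1 : G →* (F₁ ≃ₐ[ℂ] F₁)) ρ₂ L) v).trans
        (act (prodAction ρ₁ (1 : G →* (F₂ ≃ₐ[ℂ] F₂)) L) v)) x :=
    algEquiv_ext_pull (F₁ := F₁) (F₂ := F₂)
      (fun a => by rw [AlgEquiv.trans_apply]; simp only [act_prodAction_pull₁]; simp [act])
      (fun b => by rw [AlgEquiv.trans_apply]; simp only [act_prodAction_pull₂]; simp [act]) x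
  rw [isEigen_zero_iff.1 hx, AlgEquiv.trans_apply] at h
  conv_lhs => rw [h]
  rw [act_act]

theorem mem_surfaceField_iff {x : L} :
    x ∈ SurfaceField ρ₁ ρ₂ L ↔ IsEigen (prodAction ρ₁ ρ₂ L) 0 x :=
  mem_fixedField_iff _ x

variable {t₁ : F₁} {t₂ : F₂}

theorem pull₁_mem_surfaceField {a : F₁} (ha : IsEigen ρ₁ 0 a) :
    pull₁ F₁ F₂ L a ∈ SurfaceField ρ₁ ρ₂ L := by
  rw [mem_surfaceField_iff, isEigen_zero_iff]
  intro v
  rw [act_prodAction_pull₁, isEigen_zero_iff.1 ha]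

theorem pull₂_mem_surfaceField {b : F₂} (hb : IsEigen ρ₂ 0 b) :
    pull₂ F₁ F₂ L b ∈ SurfaceField ρ₁ ρ₂ L := by
  rw [mem_surfaceField_iff, isEigen_zero_iff]
  intro v
  rw [act_prodAction_pull₂, isEigen_zero_iff.1 hb]

/-- Functions on a curve are algebraic over any ring containing the coordinate. -/
theorem IsCoord.isAlgebraic_map {F : Type*} [Field F] [Algebra ℂ F] {ρ : G →* (F ≃ₐ[ℂ] F)} {t : F}
    (ht : IsCoord ρ t) {A L : Type*} [CommRing A] [IsDomain A] [Field L] [Algebra ℂ L] [Algebra ℂ A]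
    [Algebra A L] [IsScalarTower ℂ A L] [FaithfulSMul A L] (i : F →ₐ[ℂ] L) {s : A}
    (hs : algebraMap A L s = i t) (x : F) : IsAlgebraic A (i x) := by
  have hpoly : ∀ p : ℂ[X], IsAlgebraic A (i (aeval t p)) := fun p => by
    rw [← aeval_algHom_apply, ← hs, aeval_algebraMap_apply]
    exact isAlgebraic_algebraMap _
  have hsum : ∀ s : Finset E, IsAlgebraic A (∑ c ∈ s, i (proj ρ c x)) := fun s => by
    classical
    induction s using Finset.induction_on with
    | empty => rw [Finset.sum_empty]; exact isAlgebraic_zero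
    | insert c s hc ih =>
      rw [Finset.sum_insert hc]
      refine IsAlgebraic.add (IsAlgebraic.of_pow two_pos ?_) ih
      obtain ⟨p, q, -, hpq⟩ := ht.exists_div ((isEigen_proj c x).mul_self_fixed (isEigen_proj c x))
      rw [← map_pow, sq, hpq, map_div₀, div_eq_mul_inv]
      exact (hpoly p).mul (hpoly q).inv
  rw [← sum_proj (ρ := ρ) x, map_sum]
  exact hsum Finset.univ

/-- All of `L` is algebraic over the ring `ℂ[s₁, s₂]` generated by the two coordinates, on which `D`
vanishes. -/
theorem derivation_surfaceField_eq_zero (h₁ : IsCoord ρ₁ t₁) (h₂ : IsCoord ρ₂ t₂) {M : Type*}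
    [AddCommGroup M] [Module (SurfaceField ρ₁ ρ₂ L) M] [Module ℂ M]
    (D : Derivation ℂ (SurfaceField ρ₁ ρ₂ L) M)
    (hD₁ : D ⟨_, pull₁_mem_surfaceField L h₁.fixed⟩ = 0)
    (hD₂ : D ⟨_, pull₂_mem_surfaceField L h₂.fixed⟩ = 0) : D = 0 := by
  set s₁ : SurfaceField ρ₁ ρ₂ L := ⟨_, pull₁_mem_surfaceField L h₁.fixed⟩
  set s₂ : SurfaceField ρ₁ ρ₂ L := ⟨_, pull₂_mem_surfaceField L h₂.fixed⟩
  let A := Algebra.adjoin ℂ {s₁, s₂}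
  have hA : ∀ a : A, D (algebraMap A (SurfaceField ρ₁ ρ₂ L) a) = 0 := by
    rintro ⟨a, ha⟩
    change D a = 0
    induction ha using Algebra.adjoin_induction with
    | mem x hx =>
      rcases hx with rfl | rfl
      · exact hD₁
      · exact hD₂
    | algebraMap c => exact Derivation.map_algebraMap _ _
    | add x y _ _ h1 h2 => rw [map_add, h1, h2, add_zero]
    | mul x y _ _ h1 h2 => rw [Derivation.leibniz, h1, h2, smul_zero, smul_zero, add_zero]
  have : FaithfulSMul A L := (faithfulSMul_iff_algebraMap_injective _ _).2 (by
    intro a b hab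
    exact Subtype.ext (Subtype.ext hab))
  have hi : ∀ a, IsAlgebraic A (pull₁ F₁ F₂ L a) := h₁.isAlgebraic_map (A := A) (pull₁ F₁ F₂ L)
    (s := ⟨s₁, Algebra.subset_adjoin (by simp)⟩) rfl
  have hj : ∀ a, IsAlgebraic A (pull₂ F₁ F₂ L a) := h₂.isAlgebraic_map (A := A) (pull₂ F₁ F₂ L)
    (s := ⟨s₂, Algebra.subset_adjoin (by simp)⟩) rfl
  have hprod : ∀ α, IsAlgebraic A
      (Algebra.TensorProduct.productMap (pull₁ F₁ F₂ L) (pull₂ F₁ F₂ L) α) := fun α => by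
    induction α with
    | zero => rw [map_zero]; exact isAlgebraic_zero
    | add x y hx hy => rw [map_add]; exact hx.add hy
    | tmul a b => rw [Algebra.TensorProduct.productMap_apply_tmul]; exact (hi a).mul (hj b)
  have hL : ∀ x : L, IsAlgebraic A x := fun x => by
    obtain ⟨α, β, -, rfl⟩ := (isProductField_pull (F₁ := F₁) (F₂ := F₂) L).exists_div x
    rw [div_eq_mul_inv]
    exact (hprod α).mul (hprod β).inv
  have : CharZero (SurfaceField ρ₁ ρ₂ L) :=
    charZero_of_injective_algebraMap (algebraMap ℂ (SurfaceField ρ₁ ρ₂ L)).injective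
  ext x
  refine Derivation.eq_zero_of_isAlgebraic D hA ?_
  exact (isAlgebraic_algebraMap_iff (algebraMap (SurfaceField ρ₁ ρ₂ L) L).injective).1
    (hL (x : L))

/-- The universal derivation, taken modulo the span `W` of `ds₁` and `ds₂`, kills both coordinates
and hence vanishes. So `ds₁ ∧ ds₂` will span the 2-forms. -/
theorem exists_eq_smul_add_smul (h₁ : IsCoord ρ₁ t₁) (h₂ : IsCoord ρ₂ t₂)
    (ω : Ω[SurfaceField ρ₁ ρ₂ L⁄ℂ]) : ∃ a b : SurfaceField ρ₁ ρ₂ L, ω =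
      a • KaehlerDifferential.D ℂ _ (⟨_, pull₁_mem_surfaceField L h₁.fixed⟩ : SurfaceField ρ₁ ρ₂ L) +
      b • KaehlerDifferential.D ℂ _ (⟨_, pull₂_mem_surfaceField L h₂.fixed⟩ : SurfaceField ρ₁ ρ₂ L) := by
  set s₁ : SurfaceField ρ₁ ρ₂ L := ⟨_, pull₁_mem_surfaceField L h₁.fixed⟩
  set s₂ : SurfaceField ρ₁ ρ₂ L := ⟨_, pull₂_mem_surfaceField L h₂.fixed⟩
  let W : Submodule (SurfaceField ρ₁ ρ₂ L) Ω[SurfaceField ρ₁ ρ₂ L⁄ℂ] :=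
    Submodule.span _ {KaehlerDifferential.D ℂ _ s₁, KaehlerDifferential.D ℂ _ s₂}
  have h0 := derivation_surfaceField_eq_zero L h₁ h₂
    (W.mkQ.compDer (KaehlerDifferential.D ℂ (SurfaceField ρ₁ ρ₂ L)))
    ((Submodule.Quotient.mk_eq_zero W).2 (Submodule.subset_span (by simp [s₁])))
    ((Submodule.Quotient.mk_eq_zero W).2 (Submodule.subset_span (by simp [s₂])))
  have htop : W = ⊤ := by
    rw [eq_top_iff, ← KaehlerDifferential.span_range_derivation, Submodule.span_le]
    rintro _ ⟨x, rfl⟩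
    exact (Submodule.Quotient.mk_eq_zero W).1 (DFunLike.congr_fun h0 x)
  have hω : ω ∈ W := htop ▸ Submodule.mem_top
  obtain ⟨a, b, h⟩ := Submodule.mem_span_pair.1 hω
  exact ⟨a, b, h.symm⟩

end Surface

end

section

open Polynomial

/-! ### The symmetry obstruction to birationality -/

section Surface

variable {F₁ F₂ : Type*} [Field F₁] [Field F₂] [Algebra ℂ F₁] [Algebra ℂ F₂]
  {ρ₁ : G →* (F₁ ≃ₐ[ℂ] F₁)} {ρ₂ : G →* (F₂ ≃ₐ[ℂ] F₂)}
  (L : Type*) [Field L] [Algebra ℂ L] [Algebra (F₁ ⊗[ℂ] F₂) L]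
  [IsScalarTower ℂ (F₁ ⊗[ℂ] F₂) L] [IsFractionRing (F₁ ⊗[ℂ] F₂) L]
  {t₁ : F₁} {t₂ : F₂}

/-- The coefficient of a `2`-form with respect to a pair of derivations. -/
theorem exists_jacobian (K : IntermediateField ℂ L) (DL DL' : Derivation ℂ L L) :
    ∃ J : ⋀[K]^2 Ω[K⁄ℂ] →ₗ[K] L, ∀ a b : K, J (exteriorPower.ιMulti K 2
      ![KaehlerDifferential.D ℂ _ a, KaehlerDifferential.D ℂ _ b]) =
        DL (a : L) * DL' (b : L) - DL' (a : L) * DL (b : L) := by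
  refine ⟨exteriorPower.alternatingMapLinearEquiv
    (pairDet (DL.compAlgebraMap K).liftKaehlerDifferential
      (DL'.compAlgebraMap K).liftKaehlerDifferential), fun a b => ?_⟩
  rw [exteriorPower.alternatingMapLinearEquiv_apply_ιMulti, pairDet_apply]
  simp only [Matrix.cons_val_zero, Matrix.cons_val_one, Derivation.liftKaehlerDifferential_comp_D]
  rfl

variable {L} in
theorem jacobian_mem_formSpan {DL DL' : Derivation ℂ L L}
    {J : ⋀[SurfaceField ρ₁ ρ₂ L]^2 Ω[SurfaceField ρ₁ ρ₂ L⁄ℂ] →ₗ[SurfaceField ρ₁ ρ₂ L] L}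
    (hJ : ∀ a b : SurfaceField ρ₁ ρ₂ L, J (exteriorPower.ιMulti _ 2
      ![KaehlerDifferential.D ℂ _ a, KaehlerDifferential.D ℂ _ b]) =
        DL (a : L) * DL' (b : L) - DL' (a : L) * DL (b : L))
    {ω : ⋀[SurfaceField ρ₁ ρ₂ L]^2 Ω[SurfaceField ρ₁ ρ₂ L⁄ℂ]}
    (hω : ω ∈ canonicalForms ρ₁ ρ₂ L) (P₁ : Point F₁) (P₂ : Point F₂) :
    J ω ∈ formSpan DL DL' (prodLocalRing L P₁ P₂) := by
  simp only [canonicalForms, Submodule.mem_iInf, Submodule.restrictScalars_mem] at hω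
  have h := hω P₁ P₂
  clear hω
  induction h using Submodule.span_induction with
  | mem x hx =>
    obtain ⟨a, ha, b, hb, rfl⟩ := hx
    rw [hJ]
    exact Submodule.subset_span ⟨a, ha, b, hb, rfl⟩
  | zero => rw [map_zero]; exact Submodule.zero_mem _
  | add x y _ _ hx hy => rw [map_add]; exact Submodule.add_mem _ hx hy
  | smul r x _ hx =>
    have h := Submodule.smul_mem _
      (⟨((r : SurfaceField ρ₁ ρ₂ L) : L), r.2⟩ : prodLocalRing L P₁ P₂) hx
    have e : J (r • x) = ((r : SurfaceField ρ₁ ρ₂ L) : L) * J x :=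
      J.map_smul (r : SurfaceField ρ₁ ρ₂ L) x
    rw [e]
    exact h

omit [IsFractionRing (F₁ ⊗[ℂ] F₂) L] in
theorem isTensorRing_pull (P₁ : Point F₁) (P₂ : Point F₂) :
    IsTensorRing (pull₁ F₁ F₂ L) (pull₂ F₁ F₂ L) P₁ P₂ (tensorRing L P₁ P₂)
      (vanishingIdeal L P₁ P₂) := ⟨rfl, rfl⟩

/-- Finite-dimensionality is essential: `finrank` is `0` on infinite-dimensional spaces. -/
theorem N_ne_zero {Y₁ Z₁ : E → F₁} {f₁ : E → ℂ[X]} {Y₂ Z₂ : E → F₂} {f₂ : E → ℂ[X]}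
    (h₁ : IsFrameUnramifiedAtInfty ρ₁ t₁ Y₁ f₁ Z₁) (h₂ : IsFrameUnramifiedAtInfty ρ₂ t₂ Y₂ f₂ Z₂)
    {c : E} (hc₁ : eigenDiff ρ₁ (dotProductEquiv (ZMod 2) (Fin 3) c) ≠ ⊥)
    (hc₂ : eigenDiff ρ₂ (dotProductEquiv (ZMod 2) (Fin 3) c) ≠ ⊥) :
    N ρ₁ ρ₂ (dotProductEquiv (ZMod 2) (Fin 3) c) ≠ 0 := by
  have := h₁.finite_eigenDiff c
  have := h₂.finite_eigenDiff c
  rw [N, Module.finrank_tensorProduct]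
  exact mul_ne_zero (by rwa [Ne, Submodule.finrank_eq_zero])
    (by rwa [Ne, Submodule.finrank_eq_zero])

theorem proj_congr {F : Type*} [Field F] [Algebra ℂ F] {ρ ρ' : G →* (F ≃ₐ[ℂ] F)} {x : F}
    (h : ∀ v, act ρ v x = act ρ' v x) (c : E) : proj ρ c x = proj ρ' c x := by
  simp only [proj, h]

/-- If the characters contributing to `H⁰(S, K_S)` lie in an affine hyperplane, then the canonical
map is not birational. -/
theorem not_isCanonicalMapBirational (h₁ : IsGaloisCoverOfLine ρ₁) (h₂ : IsGaloisCoverOfLine ρ₂)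
    {g : E} (hg : g ≠ 0) (k : ZMod 2)
    (hN : ∀ c : E, N ρ₁ ρ₂ (dotProductEquiv (ZMod 2) (Fin 3) c) ≠ 0 → c ⬝ᵥ g = k) :
    ¬ IsCanonicalMapBirational ρ₁ ρ₂ L := by
  obtain ⟨t₁, Y₁, f₁, Z₁, H₁⟩ := h₁.exists_frame
  obtain ⟨t₂, Y₂, f₂, Z₂, H₂⟩ := h₂.exists_frame
  have hL := isProductField_pull (F₁ := F₁) (F₂ := F₂) L
  obtain ⟨D₁, hD₁⟩ := H₁.coord.exists_derivation
  obtain ⟨D₂, hD₂⟩ := H₂.coord.exists_derivation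
  obtain ⟨DL₁, e11, e12⟩ := hL.exists_derivation D₁
  obtain ⟨DL₂, e22, e21⟩ := hL.swap.exists_derivation D₂
  obtain ⟨J, hJ⟩ := exists_jacobian L (SurfaceField ρ₁ ρ₂ L) DL₁ DL₂
  set s₁ : SurfaceField ρ₁ ρ₂ L := ⟨_, pull₁_mem_surfaceField L H₁.coord.fixed⟩ with hs₁
  set s₂ : SurfaceField ρ₁ ρ₂ L := ⟨_, pull₂_mem_surfaceField L H₂.coord.fixed⟩ with hs₂
  have hJ1 : J (exteriorPower.ιMulti _ 2
      ![KaehlerDifferential.D ℂ _ s₁, KaehlerDifferential.D ℂ _ s₂]) = 1 := by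
    rw [hJ]
    simp [hs₁, hs₂, e11, e12, e21, e22, hD₁, hD₂]
  -- Since `J (ds₁ ∧ ds₂) = 1`, the map `J` reads off the coefficient of a 2-form relative to `ds₁ ∧
  -- ds₂`. In particular it is injective, with `G`-invariant values.
  have hcoef : ∀ ω, ∃ a : SurfaceField ρ₁ ρ₂ L, ω = a • exteriorPower.ιMulti _ 2
      ![KaehlerDifferential.D ℂ _ s₁, KaehlerDifferential.D ℂ _ s₂] ∧ J ω = a := fun ω => by
    obtain ⟨a, ha⟩ := exists_eq_smul_ιMulti
      (exists_eq_smul_add_smul L H₁.coord H₂.coord (ρ₁ := ρ₁) (ρ₂ := ρ₂)) ω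
    refine ⟨a, ha, ?_⟩
    rw [ha, map_smul, hJ1]
    exact mul_one _
  have hJinj : ∀ ω, J ω = 0 → ω = 0 := fun ω hω => by
    obtain ⟨a, ha, ha'⟩ := hcoef ω
    have : a = 0 := Subtype.ext (ha'.symm.trans hω)
    rw [ha, this, zero_smul]
  have hJeigen : ∀ ω, IsEigen (prodAction ρ₁ ρ₂ L) 0 (J ω) := fun ω => by
    obtain ⟨a, -, ha'⟩ := hcoef ω
    rw [ha']
    exact (mem_surfaceField_iff L).1 a.2
  set R₁ := prodAction ρ₁ (1 : G →* (F₂ ≃ₐ[ℂ] F₂)) L with hR₁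
  set R₂ := prodAction (1 : G →* (F₁ ≃ₐ[ℂ] F₁)) ρ₂ L with hR₂
  -- Split `J ω` under the action through the first factor. Every nonzero component belongs to a
  -- character with `N ≠ 0`, and on it `g` acts by the common sign `sgn k`.
  have hscale : ∀ ω ∈ canonicalForms ρ₁ ρ₂ L, act R₁ g (J ω) = sgn k • J ω := fun ω hω => by
    conv_lhs => rw [← sum_proj (ρ := R₁) (J ω)]
    conv_rhs => rw [← sum_proj (ρ := R₁) (J ω)]
    rw [map_sum, Finset.smul_sum]
    refine Finset.sum_congr rfl fun c _ => ?_
    by_cases hc : proj R₁ c (J ω) = 0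
    · rw [hc, map_zero, smul_zero]
    -- By invariance the two one-sided actions agree on `J ω`, so its `c`-component is the same
    -- through either factor, and both curves acquire a nonzero differential for `c`.
    have hc' : proj R₂ c (J ω) ≠ 0 := by
      rwa [← proj_congr (act_left_eq_act_right L (hJeigen ω)) c]
    have hn := N_ne_zero H₁ H₂
      (eigenDiff_ne_bot_of_proj_ne_zero hL H₁ H₂ hD₁ hD₂ e11 e12 e21 e22
        (act_prodAction_pull₁ L) (fun v b => by rw [act_prodAction_pull₂]; simp [act])
        (fun P P' => ⟨_, _, isTensorRing_pull L P P', jacobian_mem_formSpan hJ hω P P'⟩) hc)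
      (eigenDiff_ne_bot_of_proj_ne_zero hL.swap H₂ H₁ hD₂ hD₁ e22 e21 e12 e11
        (act_prodAction_pull₂ L) (fun v b => by rw [act_prodAction_pull₁]; simp [act])
        (fun P P' => ⟨_, _, (isTensorRing_pull L P' P).swap, by
          rw [formSpan_swap]; exact jacobian_mem_formSpan hJ hω P' P⟩) hc')
    rw [isEigen_proj c (J ω) g, hN c hn]
  intro hbir
  -- In a quotient of two 2-forms the common sign cancels; birationality makes such quotients
  -- generate the whole function field of `S`.
  have hfix : ∀ x : SurfaceField ρ₁ ρ₂ L, act R₁ g (x : L) = x := fun x => by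
    have hx : x ∈ canonicalImageField ρ₁ ρ₂ L := by
      rw [show canonicalImageField ρ₁ ρ₂ L = ⊤ from hbir]; trivial
    rw [canonicalImageField] at hx
    induction hx using IntermediateField.adjoin_induction with
    | mem f hf =>
      obtain ⟨ω, hω, η, hη, hη0, rfl⟩ := hf
      have h1 := hscale _ hω
      rw [map_smul] at h1
      have h1 : act R₁ g ((f : L) * J η) = sgn k • ((f : L) * J η) := h1
      rw [map_mul, hscale η hη, mul_smul_comm] at h1
      have hne : J η ≠ 0 := fun h => hη0 (hJinj _ h)
      exact mul_right_cancel₀ hne (smul_right_injective L (sgn_ne_zero k) h1)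
    | algebraMap c => exact (act R₁ g).commutes c
    | add x y _ _ hx hy =>
      rw [IntermediateField.coe_add, map_add, hx, hy]
    | inv x _ hx => rw [IntermediateField.coe_inv, map_inv₀, hx]
    | mul x y _ _ hx hy => rw [IntermediateField.coe_mul, map_mul, hx, hy]
  obtain ⟨c, hc⟩ : ∃ c : E, c ⬝ᵥ g = 1 := by
    have key : ∀ g : E, g ≠ 0 → ∃ c : E, c ⬝ᵥ g = 1 := by decide
    exact key g hg
  -- For `c ⬝ᵥ g = 1` this product is invariant under the diagonal action but is negated by `g`
  -- acting on the first factor alone.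
  have hy : pull₁ F₁ F₂ L (Y₁ c) * pull₂ F₁ F₂ L (Y₂ c) ∈ SurfaceField ρ₁ ρ₂ L := by
    rw [mem_surfaceField_iff, isEigen_zero_iff]
    intro v
    rw [map_mul, act_prodAction_pull₁, act_prodAction_pull₂, H₁.isEigen c v, H₂.isEigen c v,
      map_smul, map_smul, smul_mul_smul_comm, sgn_mul_self, one_smul]
  have h := hfix ⟨_, hy⟩
  simp only [hR₁] at h
  rw [map_mul, act_prodAction_pull₁, act_prodAction_pull₂, H₁.isEigen c g, hc, sgn_one] at h
  have h0 : pull₁ F₁ F₂ L (Y₁ c) * pull₂ F₁ F₂ L (Y₂ c) ≠ 0 :=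
    mul_ne_zero (by simpa using H₁.toIsFrame.ne_zero c) (by simpa using H₂.toIsFrame.ne_zero c)
  have : CharZero L := charZero_of_injective_algebraMap (algebraMap ℂ L).injective
  refine h0 (self_eq_neg.1 ?_)
  simpa [act] using h.symm

end Surface

end

/-! ### Branching data -/

section Combinatorics

/-- The number of branch points of the double cover belonging to the character `c`, if `A x` is the
number of branch points with local monodromy `x`. -/
def charDegree (A : E → ℕ) (c : E) : ℕ := ∑ x ∈ Finset.univ.filter fun x : E => c ⬝ᵥ x = 1, A x

theorem sum_univ_E {M : Type*} [AddCommMonoid M] (A : E → M) :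
    ∑ x, A x = A ![0, 0, 0] + A ![1, 0, 0] + A ![0, 1, 0] + A ![0, 0, 1] + A ![1, 1, 0] +
      A ![1, 0, 1] + A ![0, 1, 1] + A ![1, 1, 1] := by
  have h : (Finset.univ : Finset E) = {![0, 0, 0], ![1, 0, 0], ![0, 1, 0], ![0, 0, 1], ![1, 1, 0],
      ![1, 0, 1], ![0, 1, 1], ![1, 1, 1]} := by decide
  rw [h]
  repeat rw [Finset.sum_insert (by decide)]
  rw [Finset.sum_singleton]
  simp only [add_assoc]

theorem E_cases (c : E) : c = ![0, 0, 0] ∨ c = ![1, 0, 0] ∨ c = ![0, 1, 0] ∨ c = ![0, 0, 1] ∨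
    c = ![1, 1, 0] ∨ c = ![1, 0, 1] ∨ c = ![0, 1, 1] ∨ c = ![1, 1, 1] := by
  revert c; decide

variable (A B : E → ℕ)

theorem charDegree_000 : charDegree A ![0, 0, 0] = 0 := by
  rw [charDegree, Finset.sum_filter, sum_univ_E]
  simp

theorem charDegree_100 :
    charDegree A ![1, 0, 0] = A ![1, 0, 0] + A ![1, 1, 0] + A ![1, 0, 1] + A ![1, 1, 1] := by
  rw [charDegree, Finset.sum_filter, sum_univ_E]
  simp

theorem charDegree_010 :
    charDegree A ![0, 1, 0] = A ![0, 1, 0] + A ![1, 1, 0] + A ![0, 1, 1] + A ![1, 1, 1] := by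
  rw [charDegree, Finset.sum_filter, sum_univ_E]
  simp

theorem charDegree_001 :
    charDegree A ![0, 0, 1] = A ![0, 0, 1] + A ![1, 0, 1] + A ![0, 1, 1] + A ![1, 1, 1] := by
  rw [charDegree, Finset.sum_filter, sum_univ_E]
  simp

theorem charDegree_110 :
    charDegree A ![1, 1, 0] = A ![1, 0, 0] + A ![0, 1, 0] + A ![1, 0, 1] + A ![0, 1, 1] := by
  rw [charDegree, Finset.sum_filter, sum_univ_E]
  simp [CharTwo.add_self_eq_zero]

theorem charDegree_101 :
    charDegree A ![1, 0, 1] = A ![1, 0, 0] + A ![0, 0, 1] + A ![1, 1, 0] + A ![0, 1, 1] := by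
  rw [charDegree, Finset.sum_filter, sum_univ_E]
  simp [CharTwo.add_self_eq_zero]

theorem charDegree_011 :
    charDegree A ![0, 1, 1] = A ![0, 1, 0] + A ![0, 0, 1] + A ![1, 1, 0] + A ![1, 0, 1] := by
  rw [charDegree, Finset.sum_filter, sum_univ_E]
  simp [CharTwo.add_self_eq_zero]

theorem charDegree_111 :
    charDegree A ![1, 1, 1] = A ![1, 0, 0] + A ![0, 1, 0] + A ![0, 0, 1] + A ![1, 1, 1] := by
  rw [charDegree, Finset.sum_filter, sum_univ_E]
  simp [CharTwo.add_self_eq_zero]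

/-- The branching data of a pair of connected covers of the line with free diagonal action, with
coordinates such that the standard basis is contained in the support of the first one. -/
structure IsBranchingPair : Prop where
  even₁ : ∀ c, Even (charDegree A c)
  even₂ : ∀ c, Even (charDegree B c)
  pos₂ : ∀ c, c ≠ 0 → 0 < charDegree B c
  disjoint : ∀ x, x ≠ 0 → A x = 0 ∨ B x = 0
  basis_ne_zero : A ![1, 0, 0] ≠ 0 ∧ A ![0, 1, 0] ≠ 0 ∧ A ![0, 0, 1] ≠ 0

/-- The characters for which both isotypic components are nonzero are contained in no affine
hyperplane. -/
def IsSpread : Prop :=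
  ∀ g : E, g ≠ 0 → ∀ k : ZMod 2, ∃ c, 4 ≤ charDegree A c ∧ 4 ≤ charDegree B c ∧ c ⬝ᵥ g ≠ k

variable {A B}

/-- The hyperplane condition is unfolded character by character, so that concrete multiplicities
leave decidable goals. The trivial character has degree `0` and never contributes. -/
theorem not_isSpread (g : E) (hg : g ≠ 0) (k : ZMod 2) :
      (4 ≤ charDegree A ![1, 0, 0] → 4 ≤ charDegree B ![1, 0, 0] → g 0 = k) →
      (4 ≤ charDegree A ![0, 1, 0] → 4 ≤ charDegree B ![0, 1, 0] → g 1 = k) →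
      (4 ≤ charDegree A ![0, 0, 1] → 4 ≤ charDegree B ![0, 0, 1] → g 2 = k) →
      (4 ≤ charDegree A ![1, 1, 0] → 4 ≤ charDegree B ![1, 1, 0] → g 0 + g 1 = k) →
      (4 ≤ charDegree A ![1, 0, 1] → 4 ≤ charDegree B ![1, 0, 1] → g 0 + g 2 = k) →
      (4 ≤ charDegree A ![0, 1, 1] → 4 ≤ charDegree B ![0, 1, 1] → g 1 + g 2 = k) →
      (4 ≤ charDegree A ![1, 1, 1] → 4 ≤ charDegree B ![1, 1, 1] → g 0 + g 1 + g 2 = k) →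
      ¬ IsSpread A B := by
  intro c1 c2 c3 c4 c5 c6 c7 hs
  obtain ⟨c, h1, h2, h3⟩ := hs g hg k
  rcases E_cases c with rfl | rfl | rfl | rfl | rfl | rfl | rfl | rfl
  · rw [charDegree_000] at h1; omega
  · exact h3 (by simpa [dotProduct, Fin.sum_univ_three] using c1 h1 h2)
  · exact h3 (by simpa [dotProduct, Fin.sum_univ_three] using c2 h1 h2)
  · exact h3 (by simpa [dotProduct, Fin.sum_univ_three] using c3 h1 h2)
  · exact h3 (by simpa [dotProduct, Fin.sum_univ_three] using c4 h1 h2)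
  · exact h3 (by simpa [dotProduct, Fin.sum_univ_three] using c5 h1 h2)
  · exact h3 (by simpa [dotProduct, Fin.sum_univ_three] using c6 h1 h2)
  · exact h3 (by simpa [dotProduct, Fin.sum_univ_three] using c7 h1 h2)

namespace IsBranchingPair

variable (h : IsBranchingPair A B)
include h

theorem eq_zero : B ![1, 0, 0] = 0 ∧ B ![0, 1, 0] = 0 ∧ B ![0, 0, 1] = 0 :=
  ⟨(h.disjoint _ (by decide)).resolve_left h.basis_ne_zero.1,
    (h.disjoint _ (by decide)).resolve_left h.basis_ne_zero.2.1,
    (h.disjoint _ (by decide)).resolve_left h.basis_ne_zero.2.2⟩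

theorem charDegree₁_mod_two : ∀ c, charDegree A c % 2 = 0 := fun c => Nat.even_iff.1 (h.even₁ c)

theorem charDegree₂_mod_two : ∀ c, charDegree B c % 2 = 0 := fun c => Nat.even_iff.1 (h.even₂ c)

/-- The second cover is branched over `(1, 1, 1)` and over all but at most one of the sums of two
basis vectors. -/
theorem second_ne_zero : B ![1, 1, 1] ≠ 0 ∧ B ![1, 0, 1] + B ![0, 1, 1] ≠ 0 ∧
    B ![1, 1, 0] + B ![0, 1, 1] ≠ 0 ∧ B ![1, 1, 0] + B ![1, 0, 1] ≠ 0 := by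
  obtain ⟨b1, b2, b3⟩ := h.eq_zero
  have p1 := h.pos₂ ![1, 1, 1] (by decide)
  have p2 := h.pos₂ ![1, 1, 0] (by decide)
  have p3 := h.pos₂ ![1, 0, 1] (by decide)
  have p4 := h.pos₂ ![0, 1, 1] (by decide)
  rw [charDegree_111] at p1
  rw [charDegree_110] at p2
  rw [charDegree_101] at p3
  rw [charDegree_011] at p4
  omega

/-- By `second_ne_zero` and disjointness, besides the basis vectors at most one sum of two of them,
say `e₀ + e₁`, carries a multiplicity of `A`. The multiplicity at `e₂` is even and positive. If the
one at `e₀ + e₁` were nonzero, it and those at `e₀`, `e₁` would be three positive numbers of equal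
parity with sum `2` or `4`, which is impossible. So three positive even numbers add up to `6`. -/
theorem eq_two_of_sum_eq_six (hr : A ![1, 0, 0] + A ![0, 1, 0] + A ![0, 0, 1] + A ![1, 1, 0] +
      A ![1, 0, 1] + A ![0, 1, 1] + A ![1, 1, 1] = 6) :
    A ![1, 0, 0] = 2 ∧ A ![0, 1, 0] = 2 ∧ A ![0, 0, 1] = 2 ∧ A ![1, 1, 0] = 0 ∧
      A ![1, 0, 1] = 0 ∧ A ![0, 1, 1] = 0 ∧ A ![1, 1, 1] = 0 := by
  have hB := h.second_ne_zero
  have hA := h.basis_ne_zero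
  have e1 := h.charDegree₁_mod_two ![1, 0, 0]
  have e2 := h.charDegree₁_mod_two ![0, 1, 0]
  have e3 := h.charDegree₁_mod_two ![0, 0, 1]
  rw [charDegree_100] at e1
  rw [charDegree_010] at e2
  rw [charDegree_001] at e3
  have d1 := h.disjoint ![1, 1, 1] (by decide)
  have d2 := h.disjoint ![1, 1, 0] (by decide)
  have d3 := h.disjoint ![1, 0, 1] (by decide)
  have d4 := h.disjoint ![0, 1, 1] (by decide)
  omega

/-- The degree in `A` of a character is now twice its number of nonzero coordinates, so only those
with at least two can contribute. Omitting `(1,1,0)`, `(1,0,1)` or `(0,1,1)` leaves characters with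
a common coordinate equal to `1`; omitting `(1,1,1)` leaves characters with coordinate sum `0`.
Spreading needs all four. -/
theorem of_sum_eq_six (hs : IsSpread A B)
    (hr : A ![1, 0, 0] + A ![0, 1, 0] + A ![0, 0, 1] + A ![1, 1, 0] +
      A ![1, 0, 1] + A ![0, 1, 1] + A ![1, 1, 1] = 6) :
    4 ≤ charDegree B ![1, 1, 0] ∧ 4 ≤ charDegree B ![1, 0, 1] ∧ 4 ≤ charDegree B ![0, 1, 1] ∧
      4 ≤ charDegree B ![1, 1, 1] := by
  obtain ⟨a1, a2, a3, a4, a5, a6, a7⟩ := h.eq_two_of_sum_eq_six hr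
  refine ⟨?_, ?_, ?_, ?_⟩
  · obtain ⟨c, h1, h2, h3⟩ := hs ![0, 0, 1] (by decide) 1
    rcases E_cases c with rfl | rfl | rfl | rfl | rfl | rfl | rfl | rfl <;>
      simp_all [charDegree_000, charDegree_100, charDegree_010, charDegree_001, charDegree_111]
  · obtain ⟨c, h1, h2, h3⟩ := hs ![0, 1, 0] (by decide) 1
    rcases E_cases c with rfl | rfl | rfl | rfl | rfl | rfl | rfl | rfl <;>
      simp_all [charDegree_000, charDegree_100, charDegree_010, charDegree_001, charDegree_111]
  · obtain ⟨c, h1, h2, h3⟩ := hs ![1, 0, 0] (by decide) 1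
    rcases E_cases c with rfl | rfl | rfl | rfl | rfl | rfl | rfl | rfl <;>
      simp_all [charDegree_000, charDegree_100, charDegree_010, charDegree_001, charDegree_111]
  · obtain ⟨c, h1, h2, h3⟩ := hs ![1, 1, 1] (by decide) 0
    rcases E_cases c with rfl | rfl | rfl | rfl | rfl | rfl | rfl | rfl <;>
      simp_all [charDegree_000, charDegree_100, charDegree_010, charDegree_001, charDegree_111,
        CharTwo.add_self_eq_zero]

/-- If the first cover has six branch points, then the second one has at least ten, and the
multiplicities are determined if it has ten or eleven. -/
theorem second_of_sum_eq_six (hs : IsSpread A B)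
    (hr : A ![1, 0, 0] + A ![0, 1, 0] + A ![0, 0, 1] + A ![1, 1, 0] +
      A ![1, 0, 1] + A ![0, 1, 1] + A ![1, 1, 1] = 6)
    (hr' : B ![1, 0, 0] + B ![0, 1, 0] + B ![0, 0, 1] + B ![1, 1, 0] +
      B ![1, 0, 1] + B ![0, 1, 1] + B ![1, 1, 1] ≤ 11) :
    B ![1, 1, 1] = 4 ∧ (B ![1, 1, 0] = 2 ∧ B ![1, 0, 1] = 2 ∧ B ![0, 1, 1] = 2 ∨
      B ![1, 1, 0] = 1 ∧ B ![1, 0, 1] = 3 ∧ B ![0, 1, 1] = 3 ∨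
      B ![1, 1, 0] = 3 ∧ B ![1, 0, 1] = 1 ∧ B ![0, 1, 1] = 3 ∨
      B ![1, 1, 0] = 3 ∧ B ![1, 0, 1] = 3 ∧ B ![0, 1, 1] = 1) := by
  obtain ⟨p1, p2, p3, p4⟩ := h.of_sum_eq_six hs hr
  have e1 := h.charDegree₂_mod_two ![1, 0, 0]
  have e2 := h.charDegree₂_mod_two ![0, 1, 0]
  have e3 := h.charDegree₂_mod_two ![1, 1, 1]
  obtain ⟨b1, b2, b3⟩ := h.eq_zero
  rw [charDegree_100] at e1
  rw [charDegree_010] at e2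
  rw [charDegree_111] at e3 p4
  rw [charDegree_110] at p1
  rw [charDegree_101] at p2
  rw [charDegree_011] at p3
  simp only [b1, b2, b3, zero_add] at p1 p2 p3 p4 e1 e2 e3 hr'
  -- Any two of the multiplicities at sums of two basis vectors add up to at least `4`, so the three
  -- total at least `6`. The multiplicity at `(1,1,1)` is thus at most `5`, and it is even and at
  -- least `4`.
  have f1 : B ![1, 1, 1] = 4 := by omega
  have f2 : B ![1, 1, 0] = 1 ∨ B ![1, 1, 0] = 2 ∨ B ![1, 1, 0] = 3 := by omega
  have f3 : B ![1, 0, 1] = 1 ∨ B ![1, 0, 1] = 2 ∨ B ![1, 0, 1] = 3 := by omega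
  refine ⟨f1, ?_⟩
  clear p4 hr e3
  rcases f2 with f2 | f2 | f2 <;> rcases f3 with f3 | f3 | f3 <;> omega

/-- The degree of `(1,1,1)` in `A` is even and `A` vanishes at `(1,1,1)`, so the basis vectors
contribute an even number. Hence `A` is nonzero at some sum of two basis vectors, and there `B`
vanishes. -/
theorem exists_eq_zero_of_odd (hr : (A ![1, 0, 0] + A ![0, 1, 0] + A ![0, 0, 1] + A ![1, 1, 0] +
      A ![1, 0, 1] + A ![0, 1, 1] + A ![1, 1, 1]) % 2 = 1) :
    B ![1, 1, 0] = 0 ∨ B ![1, 0, 1] = 0 ∨ B ![0, 1, 1] = 0 := by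
  have hB := h.second_ne_zero
  have e1 := h.charDegree₁_mod_two ![1, 1, 1]
  rw [charDegree_111] at e1
  have d1 := h.disjoint ![1, 1, 1] (by decide)
  have d2 := h.disjoint ![1, 1, 0] (by decide)
  have d3 := h.disjoint ![1, 0, 1] (by decide)
  have d4 := h.disjoint ![0, 1, 1] (by decide)
  omega

/-- Parity leaves four possibilities for `A` and three for `B`. If `A` is `4` at `(0,0,1)`, every
contributing character has last coordinate `1`. Otherwise exactly three characters contribute, two
among `(1,0,0)`, `(0,1,0)`, `(1,1,0)` and one among `(1,0,1)`, `(0,1,1)`, `(1,1,1)`, and three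
points of `𝔽₂³` always lie in an affine plane. -/
theorem not_isSpread_of_sum_eq_seven (hB : B ![1, 1, 0] = 0)
    (hr : A ![1, 0, 0] + A ![0, 1, 0] + A ![0, 0, 1] + A ![1, 1, 0] +
      A ![1, 0, 1] + A ![0, 1, 1] + A ![1, 1, 1] = 7)
    (hr' : B ![1, 0, 0] + B ![0, 1, 0] + B ![0, 0, 1] + B ![1, 1, 0] +
      B ![1, 0, 1] + B ![0, 1, 1] + B ![1, 1, 1] = 8) : ¬ IsSpread A B := by
  have hA0 := h.basis_ne_zero
  have hB0 := h.second_ne_zero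
  obtain ⟨b1, b2, b3⟩ := h.eq_zero
  have d1 := (h.disjoint ![1, 1, 1] (by decide)).resolve_right (by omega)
  have d2 := (h.disjoint ![1, 0, 1] (by decide)).resolve_right (by omega)
  have d3 := (h.disjoint ![0, 1, 1] (by decide)).resolve_right (by omega)
  have e1 := h.charDegree₁_mod_two ![1, 0, 0]
  have e2 := h.charDegree₁_mod_two ![0, 1, 0]
  have e3 := h.charDegree₁_mod_two ![0, 0, 1]
  have e4 := h.charDegree₂_mod_two ![1, 0, 0]
  have e5 := h.charDegree₂_mod_two ![0, 1, 0]
  have e6 := h.charDegree₂_mod_two ![1, 1, 1]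
  rw [charDegree_100] at e1 e4
  rw [charDegree_010] at e2 e5
  rw [charDegree_001] at e3
  rw [charDegree_111] at e6
  simp only [d1, d2, d3, b1, b2, b3, hB, zero_add, add_zero] at e1 e2 e3 e4 e5 e6 hr hr' hB0
  have hA : (A ![0, 0, 1] = 4 ∧ A ![1, 0, 0] = 1 ∧ A ![0, 1, 0] = 1 ∧ A ![1, 1, 0] = 1) ∨
      (A ![0, 0, 1] = 2 ∧ A ![1, 0, 0] = 3 ∧ A ![0, 1, 0] = 1 ∧ A ![1, 1, 0] = 1) ∨
      (A ![0, 0, 1] = 2 ∧ A ![1, 0, 0] = 1 ∧ A ![0, 1, 0] = 3 ∧ A ![1, 1, 0] = 1) ∨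
      (A ![0, 0, 1] = 2 ∧ A ![1, 0, 0] = 1 ∧ A ![0, 1, 0] = 1 ∧ A ![1, 1, 0] = 3) := by
    have f1 : A ![0, 0, 1] = 2 ∨ A ![0, 0, 1] = 4 := by omega
    have f2 : A ![1, 0, 0] = 1 ∨ A ![1, 0, 0] = 3 := by omega
    have f3 : A ![0, 1, 0] = 1 ∨ A ![0, 1, 0] = 3 := by omega
    rcases f1 with f1 | f1 <;> rcases f2 with f2 | f2 <;> rcases f3 with f3 | f3 <;> omega
  have hB' : (B ![1, 0, 1] = 4 ∧ B ![0, 1, 1] = 2 ∧ B ![1, 1, 1] = 2) ∨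
      (B ![1, 0, 1] = 2 ∧ B ![0, 1, 1] = 4 ∧ B ![1, 1, 1] = 2) ∨
      (B ![1, 0, 1] = 2 ∧ B ![0, 1, 1] = 2 ∧ B ![1, 1, 1] = 4) := by
    clear hA
    have f1 : B ![1, 0, 1] = 2 ∨ B ![1, 0, 1] = 4 := by omega
    have f2 : B ![0, 1, 1] = 2 ∨ B ![0, 1, 1] = 4 := by omega
    rcases f1 with f1 | f1 <;> rcases f2 with f2 | f2 <;> omega
  have key := @not_isSpread A B
  simp only [charDegree_100, charDegree_010, charDegree_001, charDegree_110, charDegree_101,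
    charDegree_011, charDegree_111, d1, d2, d3, b1, b2, b3, hB] at key
  rcases hA with ⟨a1, a2, a3, a4⟩ | ⟨a1, a2, a3, a4⟩ | ⟨a1, a2, a3, a4⟩ | ⟨a1, a2, a3, a4⟩
  · exact key ![0, 0, 1] (by decide) 1 (by omega) (by omega) (fun _ _ => rfl) (by omega)
      (fun _ _ => rfl) (fun _ _ => rfl) (fun _ _ => rfl)
  -- Each vector below is the normal of the plane through the three contributing characters, in the
  -- order of the cases for `A` and then for `B`.
  all_goals
    rcases hB' with ⟨b4, b5, b6⟩ | ⟨b4, b5, b6⟩ | ⟨b4, b5, b6⟩ <;>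
    simp only [a1, a2, a3, a4, b4, b5, b6] at key
  · exact key ![1, 0, 1] (by decide) 1 (by decide) (by decide) (by decide) (by decide) (by decide)
      (by decide) (by decide)
  · exact key ![1, 0, 0] (by decide) 1 (by decide) (by decide) (by decide) (by decide) (by decide)
      (by decide) (by decide)
  · exact key ![1, 0, 0] (by decide) 1 (by decide) (by decide) (by decide) (by decide) (by decide)
      (by decide) (by decide)
  · exact key ![0, 1, 0] (by decide) 1 (by decide) (by decide) (by decide) (by decide) (by decide)
      (by decide) (by decide)
  · exact key ![0, 1, 1] (by decide) 1 (by decide) (by decide) (by decide) (by decide) (by decide)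
      (by decide) (by decide)
  · exact key ![0, 1, 0] (by decide) 1 (by decide) (by decide) (by decide) (by decide) (by decide)
      (by decide) (by decide)
  · exact key ![1, 1, 0] (by decide) 1 (by decide) (by decide) (by decide) (by decide) (by decide)
      (by decide) (by decide)
  · exact key ![1, 1, 0] (by decide) 1 (by decide) (by decide) (by decide) (by decide) (by decide)
      (by decide) (by decide)
  · exact key ![1, 1, 1] (by decide) 1 (by decide) (by decide) (by decide) (by decide) (by decide)
      (by decide) (by decide)

end IsBranchingPair

end Combinatorics

section

open Polynomial

/-! ### Branching data in coordinates adapted to a basis -/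

section Coordinates

variable {F : Type*} [Field F] [Algebra ℂ F] (ρ : G →* (F ≃ₐ[ℂ] F))
  (e : Module.Basis (Fin 3) (ZMod 2) E)

/-- The number of branch points with given local monodromy, in terms of coordinates with respect to
a basis. -/
def coordMult (x : E) : ℕ := mult ρ (e.equivFun.symm x)

/-- The character with given coordinates with respect to the dual basis. -/
def coordChar (c : E) : Module.Dual (ZMod 2) E := ∑ i, c i • e.coord i

theorem coordChar_equivFun_symm (c x : E) : coordChar e c (e.equivFun.symm x) = c ⬝ᵥ x := by
  simp only [coordChar, LinearMap.sum_apply, LinearMap.smul_apply, Module.Basis.coord_apply,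
    ← Module.Basis.equivFun_apply, LinearEquiv.apply_symm_apply]
  rfl

theorem coordChar_of_apply (χ : Module.Dual (ZMod 2) E) : coordChar e (fun i => χ (e i)) = χ := by
  refine e.ext fun i => ?_
  simp [coordChar]

theorem coordChar_ne_zero {c : E} (hc : c ≠ 0) : coordChar e c ≠ 0 := by
  intro h
  apply hc
  rw [← dotProduct_eq_zero_iff]
  intro x
  rw [← coordChar_equivFun_symm e, h, LinearMap.zero_apply]

theorem charDegree_coordMult (c : E) : charDegree (coordMult ρ e) c =
    charDegree (mult ρ) ((dotProductEquiv (ZMod 2) (Fin 3)).symm (coordChar e c)) := by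
  refine Finset.sum_equiv e.equivFun.symm.toEquiv (fun x => ?_) fun x _ => rfl
  simp only [Finset.mem_filter, Finset.mem_univ, true_and]
  have h : (dotProductEquiv (ZMod 2) (Fin 3)).symm (coordChar e c) ⬝ᵥ e.equivFun.symm x =
      coordChar e c (e.equivFun.symm x) := by
    rw [← dotProductEquiv_apply_apply, LinearEquiv.apply_symm_apply]
  change _ ↔ _ ⬝ᵥ e.equivFun.symm x = 1
  rw [h, coordChar_equivFun_symm]

theorem coordMult_100 : coordMult ρ e ![1, 0, 0] = mult ρ (e 0) := by
  simp [coordMult, Module.Basis.equivFun_symm_apply, Fin.sum_univ_three]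

theorem coordMult_010 : coordMult ρ e ![0, 1, 0] = mult ρ (e 1) := by
  simp [coordMult, Module.Basis.equivFun_symm_apply, Fin.sum_univ_three]

theorem coordMult_001 : coordMult ρ e ![0, 0, 1] = mult ρ (e 2) := by
  simp [coordMult, Module.Basis.equivFun_symm_apply, Fin.sum_univ_three]

theorem coordMult_110 : coordMult ρ e ![1, 1, 0] = mult ρ (e 0 + e 1) := by
  simp [coordMult, Module.Basis.equivFun_symm_apply, Fin.sum_univ_three]

theorem coordMult_101 : coordMult ρ e ![1, 0, 1] = mult ρ (e 0 + e 2) := by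
  simp [coordMult, Module.Basis.equivFun_symm_apply, Fin.sum_univ_three]

theorem coordMult_011 : coordMult ρ e ![0, 1, 1] = mult ρ (e 1 + e 2) := by
  simp [coordMult, Module.Basis.equivFun_symm_apply, Fin.sum_univ_three]

theorem coordMult_111 : coordMult ρ e ![1, 1, 1] = mult ρ (e 0 + e 1 + e 2) := by
  simp [coordMult, Module.Basis.equivFun_symm_apply, Fin.sum_univ_three]

theorem coordChar_110 : coordChar e ![1, 1, 0] = e.coord 0 + e.coord 1 := by
  simp [coordChar, Fin.sum_univ_three]

theorem coordChar_101 : coordChar e ![1, 0, 1] = e.coord 0 + e.coord 2 := by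
  simp [coordChar, Fin.sum_univ_three]

theorem coordChar_011 : coordChar e ![0, 1, 1] = e.coord 1 + e.coord 2 := by
  simp [coordChar, Fin.sum_univ_three]

theorem coordChar_111 : coordChar e ![1, 1, 1] = e.coord 0 + e.coord 1 + e.coord 2 := by
  simp [coordChar, Fin.sum_univ_three]

namespace IsGaloisCoverOfLine

variable {ρ} (h : IsGaloisCoverOfLine ρ)
include h

theorem even_charDegree (c : E) : Even (charDegree (coordMult ρ e) c) := by
  obtain ⟨t, Y, f, Z, H⟩ := h.exists_frame
  rw [charDegree_coordMult, charDegree, H.sum_mult_eq_natDegree]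
  exact H.even_natDegree _

theorem charDegree_pos {c : E} (hc : c ≠ 0) : 0 < charDegree (coordMult ρ e) c := by
  obtain ⟨t, Y, f, Z, H⟩ := h.exists_frame
  rw [charDegree_coordMult, charDegree, H.sum_mult_eq_natDegree]
  exact H.natDegree_pos (by simpa using coordChar_ne_zero e hc)

theorem finrank_eigenDiff_coordChar (c : E) :
    Module.finrank ℂ (eigenDiff ρ (coordChar e c)) = charDegree (coordMult ρ e) c / 2 - 1 := by
  obtain ⟨t, Y, f, Z, H⟩ := h.exists_frame
  rw [charDegree_coordMult, charDegree, H.sum_mult_eq_natDegree, ← H.finrank_eigenDiff,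
    LinearEquiv.apply_symm_apply]

theorem numBranch_eq : numBranch ρ = coordMult ρ e ![1, 0, 0] + coordMult ρ e ![0, 1, 0] +
    coordMult ρ e ![0, 0, 1] + coordMult ρ e ![1, 1, 0] + coordMult ρ e ![1, 0, 1] +
    coordMult ρ e ![0, 1, 1] + coordMult ρ e ![1, 1, 1] := by
  obtain ⟨t, Y, f, Z, H⟩ := h.exists_frame
  have h1 : ∑ v ∈ Finset.univ.filter (fun v : E => v ≠ 0), mult ρ v =
      ∑ x ∈ Finset.univ.filter (fun x : E => x ≠ 0), coordMult ρ e x :=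
    (Finset.sum_equiv e.equivFun.symm.toEquiv (fun x => by
      simp [-Module.Basis.equivFun_symm_apply]) fun x _ => rfl).symm
  rw [H.numBranch_eq_sum, h1, Finset.sum_filter, sum_univ_E, if_neg (by decide)]
  repeat rw [if_pos (by decide)]
  rw [zero_add]

theorem ncard_stabSet :
    (stabSet ρ).ncard = ∑ x : E, if x ≠ 0 ∧ coordMult ρ e x ≠ 0 then 1 else 0 := by
  obtain ⟨t, Y, f, Z, H⟩ := h.exists_frame
  have h1 : stabSet ρ = e.equivFun.symm ''
      (Finset.univ.filter fun x : E => x ≠ 0 ∧ coordMult ρ e x ≠ 0 : Finset E) := by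
    ext v
    rw [H.mem_stabSet_iff]
    constructor
    · rintro ⟨hv, hm⟩
      refine ⟨e.equivFun v, Finset.mem_coe.2 (Finset.mem_filter.2 ⟨Finset.mem_univ _,
        (map_ne_zero_iff _ e.equivFun.injective).2 hv, ?_⟩), e.equivFun.symm_apply_apply v⟩
      rwa [coordMult, LinearEquiv.symm_apply_apply]
    · rintro ⟨x, hx, rfl⟩
      obtain ⟨-, hx0, hx⟩ := Finset.mem_filter.1 (Finset.mem_coe.1 hx)
      exact ⟨(map_ne_zero_iff _ e.equivFun.symm.injective).2 hx0, hx⟩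
  rw [h1, Set.ncard_image_of_injective _ e.equivFun.symm.injective, Set.ncard_coe_finset,
    Finset.card_filter]

/-- As the cover is connected, the local monodromies generate the group. -/
theorem exists_basis_mult_ne_zero :
    ∃ e : Module.Basis (Fin 3) (ZMod 2) E, ∀ i, mult ρ (e i) ≠ 0 := by
  obtain ⟨t, Y, f, Z, H⟩ := h.exists_frame
  let S : Set E := {v | mult ρ v ≠ 0}
  have hS : ⊤ ≤ Submodule.span (ZMod 2) S := by
    by_contra hlt
    -- A nonzero character killing all local monodromies would have a polynomial without roots,
    -- contradicting `natDegree_pos`.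
    obtain ⟨χ, hχ0, hχ⟩ := Submodule.exists_le_ker_of_lt_top _ (lt_top_iff_ne_top.2 fun h' =>
      hlt h'.ge)
    have hpos := H.natDegree_pos (c := (dotProductEquiv (ZMod 2) (Fin 3)).symm χ) (by simpa using hχ0)
    rw [← H.sum_mult_eq_natDegree, Finset.sum_pos_iff] at hpos
    obtain ⟨v, hv, hm⟩ := hpos
    have h1 : χ v = 1 := by
      rw [← (Finset.mem_filter.1 hv).2, ← dotProductEquiv_apply_apply, LinearEquiv.apply_symm_apply]
    have h0 : χ v = 0 := hχ (Submodule.subset_span hm.ne')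
    rw [h0] at h1
    exact zero_ne_one h1
  let b := Module.Basis.ofSpan hS
  refine ⟨b.reindex (b.indexEquiv (Pi.basisFun (ZMod 2) (Fin 3))), fun i => ?_⟩
  rw [Module.Basis.reindex_apply]
  exact Module.Basis.ofSpan_subset hS (Set.mem_range_self _)

end IsGaloisCoverOfLine

end Coordinates

/-- After a permutation of the basis, a property of some sum of two basis vectors is a property of
the sum of the first two. -/
theorem exists_basis_reindex (e : Module.Basis (Fin 3) (ZMod 2) E) {p : E → Prop} {q : E → Prop} (he : ∀ i, q (e i))
    (hp : p (e 0 + e 1) ∨ p (e 0 + e 2) ∨ p (e 1 + e 2)) :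
    ∃ e' : Module.Basis (Fin 3) (ZMod 2) E, (∀ i, q (e' i)) ∧ p (e' 0 + e' 1) := by
  rcases hp with hp | hp | hp
  · exact ⟨e, he, hp⟩
  · refine ⟨e.reindex (Equiv.swap 1 2), fun i => ?_, ?_⟩
    · rw [Module.Basis.reindex_apply]; exact he _
    · simpa [Module.Basis.reindex_apply, show Equiv.swap (1 : Fin 3) 2 0 = 0 by decide] using hp
  · refine ⟨e.reindex (Equiv.swap 0 2), fun i => ?_, ?_⟩
    · rw [Module.Basis.reindex_apply]; exact he _
    · simpa [Module.Basis.reindex_apply, show Equiv.swap (0 : Fin 3) 2 1 = 1 by decide,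
        add_comm (e 2)] using hp

/-! ### From the pair of covers to the combinatorial conditions -/

section Pair

variable {F₁ F₂ : Type*} [Field F₁] [Field F₂] [Algebra ℂ F₁] [Algebra ℂ F₂]
  {ρ₁ : G →* (F₁ ≃ₐ[ℂ] F₁)} {ρ₂ : G →* (F₂ ≃ₐ[ℂ] F₂)}
  (h₁ : IsGaloisCoverOfLine ρ₁) (h₂ : IsGaloisCoverOfLine ρ₂)
  (e : Module.Basis (Fin 3) (ZMod 2) E)
include h₁ h₂

theorem N_coordChar (c : E) : N ρ₁ ρ₂ (coordChar e c) =
    (charDegree (coordMult ρ₁ e) c / 2 - 1) * (charDegree (coordMult ρ₂ e) c / 2 - 1) := by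
  rw [N, Module.finrank_tensorProduct, h₁.finrank_eigenDiff_coordChar,
    h₂.finrank_eigenDiff_coordChar]

theorem IsFreeOnProduct.mult_eq_zero (hfree : IsFreeOnProduct ρ₁ ρ₂) {v : E} (hv : v ≠ 0) :
    mult ρ₁ v = 0 ∨ mult ρ₂ v = 0 := by
  obtain ⟨t₁, Y₁, f₁, Z₁, H₁⟩ := h₁.exists_frame
  obtain ⟨t₂, Y₂, f₂, Z₂, H₂⟩ := h₂.exists_frame
  by_contra! hcon
  obtain ⟨-, P₁, hP₁⟩ := H₁.mem_stabSet_iff.2 ⟨hv, hcon.1⟩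
  obtain ⟨-, P₂, hP₂⟩ := H₂.mem_stabSet_iff.2 ⟨hv, hcon.2⟩
  have h : Multiplicative.ofAdd v ∈ stab ρ₁ P₁ ⊓ stab ρ₂ P₂ := ⟨hP₁, hP₂⟩
  rw [hfree, Subgroup.mem_bot] at h
  exact hv (Multiplicative.ofAdd.injective h)

theorem isBranchingPair (hfree : IsFreeOnProduct ρ₁ ρ₂) (he : ∀ i, mult ρ₁ (e i) ≠ 0) :
    IsBranchingPair (coordMult ρ₁ e) (coordMult ρ₂ e) where
  even₁ := h₁.even_charDegree e
  even₂ := h₂.even_charDegree e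
  pos₂ _ := h₂.charDegree_pos e
  disjoint x hx := hfree.mult_eq_zero h₁ h₂ ((map_ne_zero_iff _ e.equivFun.symm.injective).2 hx)
  basis_ne_zero := by
    rw [coordMult_100, coordMult_010, coordMult_001]
    exact ⟨he 0, he 1, he 2⟩

/-- This is the contrapositive of `not_isCanonicalMapBirational`: the dimension `deg / 2 - 1` is
nonzero exactly if the degree, being even, is at least `4`. -/
theorem isSpread (L : Type*) [Field L] [Algebra ℂ L] [Algebra (F₁ ⊗[ℂ] F₂) L]
    [IsScalarTower ℂ (F₁ ⊗[ℂ] F₂) L] [IsFractionRing (F₁ ⊗[ℂ] F₂) L]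
    (hbir : IsCanonicalMapBirational ρ₁ ρ₂ L) : IsSpread (coordMult ρ₁ e) (coordMult ρ₂ e) := by
  intro g hg k
  by_contra! hcon
  refine not_isCanonicalMapBirational L h₁ h₂ (g := e.equivFun.symm g) ((map_ne_zero_iff _ e.equivFun.symm.injective).2 hg) k
    (fun c hc => ?_) hbir
  rw [← dotProductEquiv_apply_apply]
  rw [← coordChar_of_apply e (dotProductEquiv (ZMod 2) (Fin 3) c)] at hc ⊢
  rw [N_coordChar h₁ h₂] at hc
  have hc₁ := left_ne_zero_of_mul hc
  have hc₂ := right_ne_zero_of_mul hc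
  rw [coordChar_equivFun_symm]
  exact hcon _ (by omega) (by omega)

theorem ncard_stabSet_of_numBranch_eq_six (hfree : IsFreeOnProduct ρ₁ ρ₂)
    (he : ∀ i, mult ρ₁ (e i) ≠ 0) (hr : numBranch ρ₁ = 6) : (stabSet ρ₁).ncard = 3 := by
  rw [h₁.numBranch_eq e] at hr
  obtain ⟨a1, a2, a3, a4, a5, a6, a7⟩ :=
    (isBranchingPair h₁ h₂ e hfree he).eq_two_of_sum_eq_six hr
  rw [h₁.ncard_stabSet e, sum_univ_E]
  simp [a1, a2, a3, a4, a5, a6, a7]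

end Pair

end

end SIP

end

/-! ### The four cases -/

theorem proposition4p6
    {F₁ F₂ L : Type*} [Field F₁] [Field F₂] [Field L] [Algebra ℂ F₁] [Algebra ℂ F₂] [Algebra ℂ L]
    [Algebra (F₁ ⊗[ℂ] F₂) L] [IsScalarTower ℂ (F₁ ⊗[ℂ] F₂) L] [IsFractionRing (F₁ ⊗[ℂ] F₂) L]
    (ρ₁ : G →* (F₁ ≃ₐ[ℂ] F₁)) (ρ₂ : G →* (F₂ ≃ₐ[ℂ] F₂))
    (h₁ : IsGaloisCoverOfLine ρ₁) (h₂ : IsGaloisCoverOfLine ρ₂)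
    (hfree : IsFreeOnProduct ρ₁ ρ₂) :
    -- the case `p_g = 6`, `r₁ = 6`, `r₂ = 11`
    (geometricGenus ρ₁ ρ₂ L = 6 → numBranch ρ₁ = 6 → numBranch ρ₂ = 11 →
      IsCanonicalMapBirational ρ₁ ρ₂ L →
      (stabSet ρ₁).ncard = 3 ∧ (stabSet ρ₂).ncard = 4 ∧
      ∃ e : Module.Basis (Fin 3) (ZMod 2) E,
        (∀ i, mult ρ₁ (e i) = 2) ∧
        mult ρ₂ (e 0 + e 1 + e 2) = 4 ∧
        mult ρ₂ (e 1 + e 2) = 3 ∧ mult ρ₂ (e 0 + e 2) = 3 ∧ mult ρ₂ (e 0 + e 1) = 1 ∧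
        N ρ₁ ρ₂ (e.coord 0 + e.coord 1 + e.coord 2) = 2 ∧
        N ρ₁ ρ₂ (e.coord 0 + e.coord 1) = 2 ∧
        N ρ₁ ρ₂ (e.coord 0 + e.coord 2) = 1 ∧
        N ρ₁ ρ₂ (e.coord 1 + e.coord 2) = 1) ∧
    -- the case `p_g = 4`, `r₁ = 6`, `r₂ = 9`
    (geometricGenus ρ₁ ρ₂ L = 4 → numBranch ρ₁ = 6 → numBranch ρ₂ = 9 →
      ¬ IsCanonicalMapBirational ρ₁ ρ₂ L) ∧
    -- the case `p_g = 5`, `r₁ = 6`, `r₂ = 10`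
    (geometricGenus ρ₁ ρ₂ L = 5 → numBranch ρ₁ = 6 → numBranch ρ₂ = 10 →
      IsCanonicalMapBirational ρ₁ ρ₂ L →
      (stabSet ρ₁).ncard = 3 ∧ (stabSet ρ₂).ncard = 4 ∧
      ∃ e : Module.Basis (Fin 3) (ZMod 2) E,
        (∀ i, mult ρ₁ (e i) = 2) ∧
        mult ρ₂ (e 0 + e 1 + e 2) = 4 ∧
        (∀ i j, i ≠ j → mult ρ₂ (e i + e j) = 2) ∧
        N ρ₁ ρ₂ (e.coord 0 + e.coord 1 + e.coord 2) = 2 ∧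
        (∀ i j, i ≠ j → N ρ₁ ρ₂ (e.coord i + e.coord j) = 1)) ∧
    -- the case `p_g = 5`, `r₁ = 7`, `r₂ = 8`
    (geometricGenus ρ₁ ρ₂ L = 5 → numBranch ρ₁ = 7 → numBranch ρ₂ = 8 →
      ¬ IsCanonicalMapBirational ρ₁ ρ₂ L) := by
  obtain ⟨e, he⟩ := h₁.exists_basis_mult_ne_zero
  have hpair := isBranchingPair h₁ h₂ e hfree he
  refine ⟨fun _ hr₁ hr₂ hbir => ?_, fun _ hr₁ hr₂ hbir => ?_, fun _ hr₁ hr₂ hbir => ?_,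
    fun _ hr₁ hr₂ hbir => ?_⟩
  · refine ⟨ncard_stabSet_of_numBranch_eq_six h₁ h₂ e hfree he hr₁, ?_⟩
    have hsecond := hpair.second_of_sum_eq_six (isSpread h₁ h₂ e L hbir)
      (by rw [← h₁.numBranch_eq]; exact hr₁) (by rw [← h₂.numBranch_eq, hr₂])
    have hz := hpair.eq_zero
    have hr := hr₂
    rw [h₂.numBranch_eq e] at hr
    -- With `r₂ = 11` the multiplicities at the sums of two basis vectors are `1, 3, 3` in some
    -- order; the basis is permuted so that `1` occurs at the sum of the first two, and the analysis
    -- is repeated.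
    obtain ⟨e', he', hone⟩ := exists_basis_reindex e (p := fun v => mult ρ₂ v = 1)
      (q := fun v => mult ρ₁ v ≠ 0) he (by
        rw [← coordMult_110, ← coordMult_101, ← coordMult_011]
        omega)
    clear hpair hsecond hz hr he
    have hpair := isBranchingPair h₁ h₂ e' hfree he'
    have hr := h₁.numBranch_eq e'
    obtain ⟨a1, a2, a3, a4, a5, a6, a7⟩ := hpair.eq_two_of_sum_eq_six (hr.symm.trans hr₁)
    obtain ⟨b7, hb⟩ := hpair.second_of_sum_eq_six (isSpread h₁ h₂ e' L hbir)
      (hr.symm.trans hr₁) (by rw [← h₂.numBranch_eq, hr₂])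
    obtain ⟨b1, b2, b3⟩ := hpair.eq_zero
    have b4 : coordMult ρ₂ e' ![1, 1, 0] = 1 := by rw [coordMult_110, hone]
    obtain ⟨b5, b6⟩ : coordMult ρ₂ e' ![1, 0, 1] = 3 ∧ coordMult ρ₂ e' ![0, 1, 1] = 3 := by
      omega
    refine ⟨?_, e', ?_, ?_⟩
    · rw [h₂.ncard_stabSet e', sum_univ_E]
      simp [b1, b2, b3, b4, b5, b6, b7]
    · rw [coordMult_100] at a1
      rw [coordMult_010] at a2
      rw [coordMult_001] at a3
      intro i
      fin_cases i <;> assumption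
    · rw [← coordMult_110, ← coordMult_101, ← coordMult_011, ← coordMult_111, ← coordChar_111,
        ← coordChar_110, ← coordChar_101, ← coordChar_011, N_coordChar h₁ h₂, N_coordChar h₁ h₂,
        N_coordChar h₁ h₂, N_coordChar h₁ h₂]
      simp only [charDegree_110, charDegree_101, charDegree_011, charDegree_111, a1, a2, a3, a4, a5,
        a6, a7, b1, b2, b3, b4, b5, b6, b7]
      decide
  · have hsecond := hpair.second_of_sum_eq_six (isSpread h₁ h₂ e L hbir)
      (by rw [← h₁.numBranch_eq]; exact hr₁) (by rw [← h₂.numBranch_eq, hr₂]; norm_num)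
    have hz := hpair.eq_zero
    rw [h₂.numBranch_eq e] at hr₂
    -- The possible multiplicities of the second cover add up to `10` or `11`, not to `9`.
    omega
  · refine ⟨ncard_stabSet_of_numBranch_eq_six h₁ h₂ e hfree he hr₁, ?_⟩
    have hr := h₁.numBranch_eq e
    obtain ⟨a1, a2, a3, a4, a5, a6, a7⟩ := hpair.eq_two_of_sum_eq_six (hr.symm.trans hr₁)
    obtain ⟨b7, hb⟩ := hpair.second_of_sum_eq_six (isSpread h₁ h₂ e L hbir)
      (hr.symm.trans hr₁) (by rw [← h₂.numBranch_eq, hr₂]; norm_num)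
    obtain ⟨b1, b2, b3⟩ := hpair.eq_zero
    rw [h₂.numBranch_eq e] at hr₂
    obtain ⟨b4, b5, b6⟩ : coordMult ρ₂ e ![1, 1, 0] = 2 ∧ coordMult ρ₂ e ![1, 0, 1] = 2 ∧
        coordMult ρ₂ e ![0, 1, 1] = 2 := by omega
    have hN : N ρ₁ ρ₂ (coordChar e ![1, 1, 1]) = 2 ∧ N ρ₁ ρ₂ (coordChar e ![1, 1, 0]) = 1 ∧
        N ρ₁ ρ₂ (coordChar e ![1, 0, 1]) = 1 ∧ N ρ₁ ρ₂ (coordChar e ![0, 1, 1]) = 1 := by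
      rw [N_coordChar h₁ h₂, N_coordChar h₁ h₂, N_coordChar h₁ h₂, N_coordChar h₁ h₂]
      simp only [charDegree_110, charDegree_101, charDegree_011, charDegree_111, a1, a2, a3, a4, a5,
        a6, a7, b1, b2, b3, b4, b5, b6, b7]
      decide
    rw [coordChar_110, coordChar_101, coordChar_011, coordChar_111] at hN
    refine ⟨?_, e, ?_, ?_, ?_, hN.1, ?_⟩
    · rw [h₂.ncard_stabSet e, sum_univ_E]
      simp [b1, b2, b3, b4, b5, b6, b7]
    · rw [coordMult_100] at a1
      rw [coordMult_010] at a2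
      rw [coordMult_001] at a3
      intro i
      fin_cases i <;> assumption
    · rwa [← coordMult_111]
    · rw [coordMult_110] at b4
      rw [coordMult_101] at b5
      rw [coordMult_011] at b6
      intro i j hij
      fin_cases i <;> fin_cases j <;> first | exact absurd rfl hij | assumption |
        (rw [add_comm]; assumption)
    · obtain ⟨-, n1, n2, n3⟩ := hN
      intro i j hij
      fin_cases i <;> fin_cases j <;> first | exact absurd rfl hij | assumption |
        (rw [add_comm]; assumption)
  · have hr := hr₁
    rw [h₁.numBranch_eq e] at hr
    have hzero := hpair.exists_eq_zero_of_odd (by rw [hr])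
    rw [coordMult_110, coordMult_101, coordMult_011] at hzero
    -- As `r₁` is odd, the second cover is unbranched at some sum of two basis vectors; the basis is
    -- permuted to make it the sum of the first two.
    obtain ⟨e', he', h0⟩ := exists_basis_reindex e (p := fun v => mult ρ₂ v = 0)
      (q := fun v => mult ρ₁ v ≠ 0) he hzero
    refine (isBranchingPair h₁ h₂ e' hfree he').not_isSpread_of_sum_eq_seven
      (by rw [coordMult_110, h0]) ?_ ?_ (isSpread h₁ h₂ e' L hbir)
    · rw [← h₁.numBranch_eq, hr₁]
    · rw [← h₂.numBranch_eq, hr₂]
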